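/- Let $\epsilon,\delta>0$. For $n\in\mathbb Z$ let $D_{Ln}$ and $D_{Rn}$ be the open unit disks in $\mathbb R^2$ centred at $(-1-\frac\epsilon2,\,n(2+\delta))$ and $(1+\frac\epsilon2,\,n(2+\delta))$. Let $\Omega=\mathbb R\times(-1-\frac\delta2,\,1+\frac\delta2)$, and on $\partial D_{L0}$ and $\partial D_{R0}$ let $\nu$ be the unit normal pointing toward the inside of the disk. Functions below are $C^1$ up to the boundary of $\Omega\setminus\overline{D_{L0}\cup D_{R0}}$, where their normal derivatives are taken from within this domain. There exist a constant $c_0$ (depending on $\epsilon$ and $\delta$) and a harmonic function $\phi$ in $\Omega\setminus\overline{D_{L0}\cup D_{R0}}$ such that $$\begin{cases}\partial_\nu\phi=0&\text{on }\partial\Omega=\mathbb R\times\{-1-\frac\delta2,\,1+\frac\delta2\},\\ \phi=c_0&\text{on }\partial D_{R0},\\ \phi=-c_0&\text{on }\partial D_{L0},\\ \int_{\partial D_{R0}}\partial_\nu\phi\,ds=-\int_{\partial D_{L0}}\partial_\nu\phi\,ds=1,\\ \int_{\Omega\setminus\overline{D_{L0}\cup D_{R0}}}|\nabla\phi|^2\,dx\,dy<\infty,\end{cases}$$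 and such that the following holds. Let $H$ be any harmonic function in $\mathbb R^2$ with $\nabla H(x,y)=\nabla H(x,y+2+\delta)$ for all $(x,y)\in\mathbb R^2$, and let $u$ be a harmonic function in $E=\mathbb R^2\setminus\overline{\bigcup_{n\in\mathbb Z}(D_{Ln}\cup D_{Rn})}$ such that, for some constants $c_L,c_R$, $$\begin{cases}u=c_L\text{ on }\partial D_{L0},\qquad u=c_R\text{ on }\partial D_{R0},\\ \int_{\partial D_{L0}}\partial_\nu u\,ds=\int_{\partial D_{R0}}\partial_\nu u\,ds=0,\\ \int_{\Omega\setminus\overline{D_{L0}\cup D_{R0}}}|\nabla(u-H)|^2\,dx\,dy<\infty,\\ \nabla u(x,y)=\nabla u(x,y+2+\delta)\text{ for }(x,y)\in E.\end{cases}$$ Then $$u\big|_{\partial D_{R0}}-u\big|_{\partial D_{L0}}=c_R-c_L=\int_{\partial D_{L0}\cup\partial D_{R0}}H\,\partial_\nu\phi\,ds.$$ -/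

import Mathlib

open scoped Gradient

noncomputable section

namespace TwoRows

/-- The centre of the disk `D_{Ln}`. The plane `ℝ²` is `ℂ`, with `(x, y) = x + iy`. -/
def centerL (ε δ : ℝ) (n : ℤ) : ℂ := ⟨-1 - ε / 2, n * (2 + δ)⟩

/-- The centre of the disk `D_{Rn}`. -/
def centerR (ε δ : ℝ) (n : ℤ) : ℂ := ⟨1 + ε / 2, n * (2 + δ)⟩

/-- The open unit disk `D_{Ln}`. -/
def diskL (ε δ : ℝ) (n : ℤ) : Set ℂ := Metric.ball (centerL ε δ n) 1

/-- The open unit disk `D_{Rn}`. -/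
def diskR (ε δ : ℝ) (n : ℤ) : Set ℂ := Metric.ball (centerR ε δ n) 1

/-- The plane without the closure of the union of all disks. -/
def exterior (ε δ : ℝ) : Set ℂ := (closure (⋃ n : ℤ, diskL ε δ n ∪ diskR ε δ n))ᶜ

/-- The strip `Ω = ℝ × (-1 - δ/2, 1 + δ/2)`. -/
def strip (δ : ℝ) : Set ℂ := {z | -1 - δ / 2 < z.im ∧ z.im < 1 + δ / 2}

/-- The domain `Ω \ closure (D_{L0} ∪ D_{R0})`. -/
def stripDomain (ε δ : ℝ) : Set ℂ := strip δ \ closure (diskL ε δ 0 ∪ diskR ε δ 0)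

/-- The derivative in the direction `ν` at a point `z` of the boundary of `Ω \ closure (D_{L0} ∪ D_{R0})`,
taken from inside the domain. It is used only for functions that are `C¹` up to the boundary. -/
def bdryDeriv (ε δ : ℝ) (f : ℂ → ℝ) (z ν : ℂ) : ℝ :=
  fderivWithin ℝ f (closure (stripDomain ε δ)) z ν

/-- The arc length integral `∫ g ds` over the unit circle centred at `c`. -/
def circleInt (c : ℂ) (g : ℂ → ℝ) : ℝ := ∫ θ in (0 : ℝ)..(2 * Real.pi), g (circleMap c 1 θ)

/-- `∂_ν f` on the unit circle centred at `c`, where `ν = c - z` is the unit normal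
that points toward the inside of the disk. -/
def normalDeriv (ε δ : ℝ) (c : ℂ) (f : ℂ → ℝ) (z : ℂ) : ℝ := bdryDeriv ε δ f z (c - z)

/-- `∇ f` has period `2 + δ` in the `y` direction on the set `S`. -/
def PeriodicGradientOn (δ : ℝ) (f : ℂ → ℝ) (S : Set ℂ) : Prop :=
  ∀ z ∈ S, ∇ f z = ∇ f (z + ((2 + δ : ℝ) : ℂ) * Complex.I)

/-- `∫ |∇ f|² dx dy < ∞` over `Ω \ closure (D_{L0} ∪ D_{R0})`. -/
def FiniteEnergy (ε δ : ℝ) (f : ℂ → ℝ) : Prop :=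
  ∫⁻ z in stripDomain ε δ, ENNReal.ofReal (‖∇ f z‖ ^ 2) < ⊤

/-- The admissible `H`: harmonic functions in the plane whose gradient has period `2 + δ` in `y`. -/
structure Admissible (δ : ℝ) (H : ℂ → ℝ) : Prop where
  harmonic : InnerProductSpace.HarmonicOnNhd H Set.univ
  periodic : PeriodicGradientOn δ H Set.univ

/-- `u` is a (classical) solution of the two-row problem for `H`, with the value `cL` on `∂D_{L0}`
and the value `cR` on `∂D_{R0}`. -/
structure IsSolution (ε δ : ℝ) (H u : ℂ → ℝ) (cL cR : ℝ) : Prop where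
  harmonic : InnerProductSpace.HarmonicOnNhd u (exterior ε δ)
  regular : ContDiffOn ℝ 1 u (closure (stripDomain ε δ))
  valueL : ∀ z ∈ Metric.sphere (centerL ε δ 0) 1, u z = cL
  valueR : ∀ z ∈ Metric.sphere (centerR ε δ 0) 1, u z = cR
  fluxL : circleInt (centerL ε δ 0) (normalDeriv ε δ (centerL ε δ 0) u) = 0
  fluxR : circleInt (centerR ε δ 0) (normalDeriv ε δ (centerR ε δ 0) u) = 0
  energy : FiniteEnergy ε δ (fun z => u z - H z)
  periodic : PeriodicGradientOn δ u (exterior ε δ)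

/-- The conditions on `φ`: harmonic in `Ω \ closure (D_{L0} ∪ D_{R0})` and `C¹` up to the boundary,
zero Neumann data on both lines of `∂Ω`, values `∓c₀` and fluxes `∓1` on the circles
`∂D_{L0}` and `∂D_{R0}`, finite energy. -/
structure IsPotential (ε δ : ℝ) (φ : ℂ → ℝ) (c₀ : ℝ) : Prop where
  harmonic : InnerProductSpace.HarmonicOnNhd φ (stripDomain ε δ)
  regular : ContDiffOn ℝ 1 φ (closure (stripDomain ε δ))
  neumannTop : ∀ z : ℂ, z.im = 1 + δ / 2 → bdryDeriv ε δ φ z Complex.I = 0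
  neumannBottom : ∀ z : ℂ, z.im = -1 - δ / 2 → bdryDeriv ε δ φ z (-Complex.I) = 0
  valueR : ∀ z ∈ Metric.sphere (centerR ε δ 0) 1, φ z = c₀
  valueL : ∀ z ∈ Metric.sphere (centerL ε δ 0) 1, φ z = -c₀
  fluxR : circleInt (centerR ε δ 0) (normalDeriv ε δ (centerR ε δ 0) φ) = 1
  fluxL : -circleInt (centerL ε δ 0) (normalDeriv ε δ (centerL ε δ 0) φ) = 1
  energy : FiniteEnergy ε δ φ

end TwoRows

end

/-!
Write `P = 2 + δ` and `c = 1 + ε/2`. The potential `φ` is the real part of the holomorphic function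
made of `iP`-periodic logarithmic sources at `±c` and a layer of dipoles on circles of radius `1/R`
inside the disks. Reflection in the unit circle sends this circle to the one of radius `R > 1`, and
the requirement that `φ` be constant on the unit circle becomes a second-kind integral equation
there with a smooth kernel. By the Fredholm alternative it is enough that the homogeneous equation
has only the zero solution. Such a solution gives a holomorphic function on the cell with constant
real part on each disk and limits at both ends; any other value of the real part would be taken on
a compact level set, which the open mapping theorem excludes, so this function is constant and the
density vanishes. The potential is odd by construction, averaging makes it symmetric under
conjugation, and `∇φ` decays exponentially.

Now integrate the divergence-free field `v ∇φ - φ ∇v` with `v = u - H` over the cell truncated at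
`|Re z| = X`. The horizontal sides cancel, since `∂φ/∂y = 0` there while `φ` and `∇v` are periodic.
Finite energy of `v` provides arbitrarily large `X` for which `∇v` is small on the vertical sides
and `v` grows at most linearly, so that these sides contribute nothing in the limit. What remains on
the two circles is the formula for `cR - cL`, because `φ` and `u` are constant there and neither `u`
nor `H` has any flux.
-/

open Complex Set Filter Topology MeasureTheory Metric InnerProductSpace
open scoped Real ComplexConjugate Interval Gradient

noncomputable section

namespace TwoRows

/-! ### The periodic Cauchy kernel -/

section Kernel

variable {P : ℝ} {w : ℂ}

/-- The entire function `e^{2πw/P} - 1`, whose zeros are the points of `iPℤ`. -/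
def expSub (P : ℝ) (w : ℂ) : ℂ := exp ((2 * π / P : ℝ) * w) - 1

/-- The odd `iP`-periodic function `(π/P) coth(πw/P)`. -/
def cothKernel (P : ℝ) (w : ℂ) : ℂ := (2 * π / P : ℝ) * (1 / 2 + (expSub P w)⁻¹)

theorem expSub_eq_zero_iff (hP : 0 < P) : expSub P w = 0 ↔ ∃ n : ℤ, w = n * P * I := by
  have hP' : (P : ℂ) ≠ 0 := by exact_mod_cast hP.ne'
  have hpi : (π : ℂ) ≠ 0 := by exact_mod_cast Real.pi_ne_zero
  rw [expSub, sub_eq_zero, exp_eq_one_iff]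
  refine exists_congr fun n => ?_
  push_cast
  constructor
  · intro h
    field_simp at h
    rw [← mul_right_inj' (mul_ne_zero two_ne_zero hpi)]
    linear_combination (2 : ℂ) * π * h
  · rintro rfl
    field_simp

theorem hasDerivAt_expSub (P : ℝ) (w : ℂ) :
    HasDerivAt (expSub P) ((2 * π / P : ℝ) * exp ((2 * π / P : ℝ) * w)) w := by
  have h := (((hasDerivAt_id w).const_mul ((2 * π / P : ℝ) : ℂ)).cexp).sub_const 1
  convert! h using 1
  simp [mul_comm]

theorem differentiable_expSub (P : ℝ) : Differentiable ℂ (expSub P) :=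
  fun w => (hasDerivAt_expSub P w).differentiableAt

theorem expSub_add_period (hP : 0 < P) (w : ℂ) : expSub P (w + P * I) = expSub P w := by
  have hP' : (P : ℂ) ≠ 0 := by exact_mod_cast hP.ne'
  have hexp : ((2 * π / P : ℝ) : ℂ) * (w + P * I) = (2 * π / P : ℝ) * w + 2 * π * I := by
    push_cast
    field_simp
  rw [expSub, expSub, hexp, exp_periodic]

theorem cothKernel_add_period (hP : 0 < P) (w : ℂ) :
    cothKernel P (w + P * I) = cothKernel P w := by
  rw [cothKernel, expSub_add_period hP, cothKernel]

theorem expSub_neg (P : ℝ) (w : ℂ) :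
    expSub P (-w) = -(exp (-((2 * π / P : ℝ) * w)) * expSub P w) := by
  rw [expSub, expSub, mul_sub, ← exp_add]
  simp

theorem cothKernel_neg (hw : expSub P w ≠ 0) : cothKernel P (-w) = -cothKernel P w := by
  have hne := exp_ne_zero ((2 * π / P : ℝ) * w)
  have hexp : exp ((2 * π / P : ℝ) * w) = expSub P w + 1 := by simp [expSub]
  rw [cothKernel, cothKernel, expSub_neg, exp_neg]
  rw [hexp] at hne ⊢
  field_simp
  ring

theorem hasDerivAt_cothKernel (hw : expSub P w ≠ 0) :
    HasDerivAt (cothKernel P)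
      (-((2 * π / P : ℝ) : ℂ) ^ 2 * exp ((2 * π / P : ℝ) * w) / expSub P w ^ 2) w := by
  have h := (((hasDerivAt_expSub P w).inv hw).const_add (1 / 2)).const_mul ((2 * π / P : ℝ) : ℂ)
  convert! h using 1
  ring

theorem isOpen_expSub_ne_zero (P : ℝ) : IsOpen {w | expSub P w ≠ 0} :=
  isOpen_ne_fun (differentiable_expSub P).continuous continuous_const

theorem differentiableOn_cothKernel (P : ℝ) :
    DifferentiableOn ℂ (cothKernel P) {w | expSub P w ≠ 0} :=
  fun _ hw => (hasDerivAt_cothKernel hw).differentiableAt.differentiableWithinAt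

theorem expSub_ne_zero_of_re_ne_zero (hP : 0 < P) (hw : w.re ≠ 0) : expSub P w ≠ 0 := by
  rw [Ne, expSub_eq_zero_iff hP]
  rintro ⟨n, rfl⟩
  simp at hw

theorem expSub_ne_zero_of_norm_lt (hP : 0 < P) (hw : w ≠ 0) (hw' : ‖w‖ < P) :
    expSub P w ≠ 0 := by
  rw [Ne, expSub_eq_zero_iff hP]
  rintro ⟨n, rfl⟩
  have hn : n ≠ 0 := by
    rintro rfl
    simp at hw
  have hn1 : (1 : ℝ) ≤ |(n : ℝ)| := by exact_mod_cast Int.one_le_abs hn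
  simp only [norm_mul, norm_intCast, norm_real, norm_I, mul_one, Real.norm_eq_abs,
    abs_of_pos hP] at hw'
  nlinarith

theorem norm_expSub_ge (P : ℝ) (w : ℂ) : Real.exp (2 * π / P * w.re) - 1 ≤ ‖expSub P w‖ := by
  have h := norm_sub_norm_le (exp ((2 * π / P : ℝ) * w)) 1
  rw [norm_exp, re_ofReal_mul, norm_one] at h
  exact h

theorem norm_deriv_cothKernel_le_of_one_le_re (hP : 0 < P) (hw : 1 ≤ w.re) :
    ‖deriv (cothKernel P) w‖ ≤
      (2 * π / P) ^ 2 / (1 - Real.exp (-(2 * π / P))) ^ 2 * Real.exp (-(2 * π / P * w.re)) := by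
  have hl : 0 < 2 * π / P := by positivity
  rw [(hasDerivAt_cothKernel (expSub_ne_zero_of_re_ne_zero hP (by linarith))).deriv]
  set l := 2 * π / P
  have hlt : 0 < 1 - Real.exp (-l) := sub_pos.2 (Real.exp_lt_one_iff.2 (by linarith))
  have hexpSub : (1 - Real.exp (-l)) * Real.exp (l * w.re) ≤ ‖expSub P w‖ := by
    refine le_trans ?_ (norm_expSub_ge P w)
    rw [sub_mul, ← Real.exp_add, one_mul]
    exact sub_le_sub_left (Real.one_le_exp (by nlinarith)) _
  have hpos : 0 < (1 - Real.exp (-l)) * Real.exp (l * w.re) := mul_pos hlt (Real.exp_pos _)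
  rw [norm_div, norm_mul, norm_neg, norm_pow, norm_pow, norm_exp, re_ofReal_mul, norm_real,
    Real.norm_eq_abs, sq_abs]
  calc l ^ 2 * Real.exp (l * w.re) / ‖expSub P w‖ ^ 2
      ≤ l ^ 2 * Real.exp (l * w.re) / ((1 - Real.exp (-l)) * Real.exp (l * w.re)) ^ 2 :=
        div_le_div_of_nonneg_left (by positivity) (pow_pos hpos 2)
          (pow_le_pow_left₀ hpos.le hexpSub 2)
    _ = _ := by
        rw [Real.exp_neg (l * w.re)]
        field_simp

theorem deriv_cothKernel_neg (hw : expSub P w ≠ 0) :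
    deriv (cothKernel P) (-w) = deriv (cothKernel P) w := by
  have hodd : (fun z => cothKernel P (-z)) =ᶠ[𝓝 w] fun z => -cothKernel P z := by
    filter_upwards [(isOpen_expSub_ne_zero P).mem_nhds hw] with z hz using cothKernel_neg hz
  refine neg_injective ?_
  rw [← deriv_comp_neg, hodd.deriv_eq, deriv.fun_neg]

theorem norm_deriv_cothKernel_le (hP : 0 < P) (hw : 1 ≤ |w.re|) :
    ‖deriv (cothKernel P) w‖ ≤
      (2 * π / P) ^ 2 / (1 - Real.exp (-(2 * π / P))) ^ 2 * Real.exp (-(2 * π / P * |w.re|)) := by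
  rcases le_total 0 w.re with h | h
  · rw [abs_of_nonneg h] at hw ⊢
    exact norm_deriv_cothKernel_le_of_one_le_re hP hw
  · rw [abs_of_nonpos h] at hw ⊢
    rw [← deriv_cothKernel_neg (expSub_ne_zero_of_re_ne_zero hP (by linarith))]
    exact norm_deriv_cothKernel_le_of_one_le_re hP hw

theorem tendsto_cothKernel_re_atTop (hP : 0 < P) :
    Tendsto (cothKernel P) (comap re atTop) (𝓝 (π / P : ℝ)) := by
  have hl : 0 < 2 * π / P := by positivity
  have hexp : Tendsto (fun w : ℂ => Real.exp (2 * π / P * w.re) - 1) (comap re atTop) atTop :=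
    tendsto_atTop_add_const_right _ _
      (Real.tendsto_exp_atTop.comp (Tendsto.const_mul_atTop hl tendsto_comap))
  have hinv : Tendsto (fun w => (expSub P w)⁻¹) (comap re atTop) (𝓝 0) :=
    tendsto_inv₀_cobounded.comp
      (tendsto_norm_atTop_iff_cobounded.1 (tendsto_atTop_mono (norm_expSub_ge P) hexp))
  convert! (hinv.const_add (1 / 2)).const_mul ((2 * π / P : ℝ) : ℂ) using 2
  push_cast
  ring

/-- The entire function `(e^{2πw/P} - 1) / w`. -/
def expQuot (P : ℝ) : ℂ → ℂ := dslope (expSub P) 0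

theorem differentiable_expQuot (P : ℝ) : Differentiable ℂ (expQuot P) := by
  rw [← differentiableOn_univ]
  exact (differentiableOn_dslope univ_mem).2 (differentiable_expSub P).differentiableOn

theorem expSub_eq_mul_expQuot (P : ℝ) (w : ℂ) : expSub P w = w * expQuot P w := by
  have h0 : expSub P 0 = 0 := by simp [expSub]
  simpa only [expQuot, sub_zero, h0, smul_eq_mul] using (sub_smul_dslope (expSub P) 0 w).symm

theorem expQuot_ne_zero (hP : 0 < P) (hw : ‖w‖ < P) : expQuot P w ≠ 0 := by
  rcases eq_or_ne w 0 with rfl | h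
  · rw [expQuot, dslope_same, (hasDerivAt_expSub P 0).deriv]
    simp [Real.pi_ne_zero, hP.ne']
  · have := expSub_ne_zero_of_norm_lt hP h hw
    rw [expSub_eq_mul_expQuot] at this
    exact right_ne_zero_of_mul this

/-- The regular part `(π/P) coth(πw/P) - 1/w` of `cothKernel` at the origin, as the logarithmic
derivative of `expQuot` up to a constant. -/
def regKernel (P : ℝ) (w : ℂ) : ℂ := deriv (expQuot P) w / expQuot P w - (π / P : ℝ)

theorem differentiableOn_regKernel (hP : 0 < P) :
    DifferentiableOn ℂ (regKernel P) (ball 0 P) := fun w hw =>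
  ((((differentiable_expQuot P).deriv w).div (differentiable_expQuot P w)
    (expQuot_ne_zero hP (by simpa using hw))).sub_const _).differentiableWithinAt

theorem deriv_expQuot (hw : w ≠ 0) : deriv (expQuot P) w =
    ((2 * π / P : ℝ) * (w * expQuot P w + 1) - expQuot P w) / w := by
  have hprod : HasDerivAt (expSub P) (1 * expQuot P w + w * deriv (expQuot P) w) w :=
    ((hasDerivAt_id w).mul (differentiable_expQuot P w).hasDerivAt).congr_of_eventuallyEq
      (Eventually.of_forall (expSub_eq_mul_expQuot P))
  have hexp : exp ((2 * π / P : ℝ) * w) = w * expQuot P w + 1 := by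
    rw [← expSub_eq_mul_expQuot, expSub, sub_add_cancel]
  have hderiv := hprod.unique (hasDerivAt_expSub P w)
  rw [hexp] at hderiv
  field_simp
  linear_combination hderiv

theorem cothKernel_eq_inv_add_regKernel (hP : 0 < P) (hw : w ≠ 0) (hw' : ‖w‖ < P) :
    cothKernel P w = w⁻¹ + regKernel P w := by
  have hne := expQuot_ne_zero hP hw'
  rw [cothKernel, regKernel, expSub_eq_mul_expQuot, deriv_expQuot hw]
  push_cast
  field_simp
  ring

end Kernel

section IntegralShift

theorem exists_ball_add_mem_isCompact {V : Set ℂ} (hV : IsOpen V) {s : ℝ → ℂ} (hs : Continuous s)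
    {a b : ℝ} {z : ℂ} (hz : ∀ θ ∈ Icc a b, z + s θ ∈ V) :
    ∃ r > 0, ∃ K ⊆ V, IsCompact K ∧ ∀ x ∈ ball z r, ∀ θ ∈ Icc a b, x + s θ ∈ K := by
  have hK : IsCompact ((fun θ => z + s θ) '' Icc a b) :=
    isCompact_Icc.image (continuous_const.add hs)
  obtain ⟨r, hr, hsub⟩ := hK.exists_cthickening_subset_open hV (image_subset_iff.2 hz)
  refine ⟨r, hr, _, hsub, hK.cthickening, fun x hx θ hθ => ?_⟩
  refine mem_cthickening_of_dist_le _ (z + s θ) _ _ ⟨θ, hθ, rfl⟩ ?_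
  rw [dist_add_right]
  exact (mem_ball.1 hx).le

theorem hasDerivAt_integral_shift {G : ℂ → ℂ} {V : Set ℂ} (hV : IsOpen V)
    (hG : DifferentiableOn ℂ G V) {m s : ℝ → ℂ} (hm : Continuous m) (hs : Continuous s)
    {a b : ℝ} (hab : a ≤ b) {z : ℂ} (hz : ∀ θ ∈ Icc a b, z + s θ ∈ V) :
    HasDerivAt (fun z => ∫ θ in a..b, m θ * G (z + s θ))
      (∫ θ in a..b, m θ * deriv G (z + s θ)) z := by
  obtain ⟨r, hr, K, hKV, hK, hxK⟩ := exists_ball_add_mem_isCompact hV hs hz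
  have hG' : ContinuousOn (deriv G) V := (hG.deriv hV).continuousOn
  obtain ⟨B, hB⟩ := hK.exists_bound_of_continuousOn (hG'.mono hKV)
  obtain ⟨B', hB'⟩ := (isCompact_Icc (a := a) (b := b)).exists_bound_of_continuousOn hm.continuousOn
  have hcont : ∀ {g : ℂ → ℂ}, ContinuousOn g V → ∀ x ∈ ball z r,
      ContinuousOn (fun θ => m θ * g (x + s θ)) (Icc a b) := fun hg x hx =>
    hm.continuousOn.mul (hg.comp (continuous_const.add hs).continuousOn
      fun θ hθ => hKV (hxK x hx θ hθ))
  have hII : Ι a b ⊆ Icc a b := by rw [uIoc_of_le hab]; exact Ioc_subset_Icc_self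
  refine (intervalIntegral.hasDerivAt_integral_of_dominated_loc_of_deriv_le
    (bound := fun _ => B' * B) (F' := fun x θ => m θ * deriv G (x + s θ))
    (ball_mem_nhds z hr) ?_ ?_ ?_ ?_ intervalIntegrable_const ?_).2
  · filter_upwards [ball_mem_nhds z hr] with x hx
    exact ((hcont hG.continuousOn x hx).mono hII).aestronglyMeasurable measurableSet_uIoc
  · refine ContinuousOn.intervalIntegrable ?_
    rw [uIcc_of_le hab]
    exact hcont hG.continuousOn z (mem_ball_self hr)
  · exact ((hcont hG' z (mem_ball_self hr)).mono hII).aestronglyMeasurable measurableSet_uIoc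
  · refine Eventually.of_forall fun θ hθ x hx => ?_
    rw [norm_mul]
    have h1 := hB' θ (hII hθ)
    have h2 := hB _ (hxK x hx θ (hII hθ))
    exact mul_le_mul h1 h2 (norm_nonneg _) ((norm_nonneg _).trans h1)
  · refine Eventually.of_forall fun θ hθ x hx => ?_
    have h1 := (hG.differentiableAt (hV.mem_nhds (hKV (hxK x hx θ (hII hθ))))).hasDerivAt
    exact (h1.comp_add_const x (s θ)).const_mul (m θ)

theorem analyticAt_integral_shift {G : ℂ → ℂ} {V : Set ℂ} (hV : IsOpen V)
    (hG : DifferentiableOn ℂ G V) {m s : ℝ → ℂ} (hm : Continuous m) (hs : Continuous s)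
    {a b : ℝ} (hab : a ≤ b) {z : ℂ} (hz : ∀ θ ∈ Icc a b, z + s θ ∈ V) :
    AnalyticAt ℂ (fun z => ∫ θ in a..b, m θ * G (z + s θ)) z := by
  obtain ⟨r, hr, K, hKV, -, hxK⟩ := exists_ball_add_mem_isCompact hV hs hz
  refine DifferentiableOn.analyticAt (s := ball z r) (fun x hx => ?_) (ball_mem_nhds z hr)
  exact (hasDerivAt_integral_shift hV hG hm hs hab
    fun θ hθ => hKV (hxK x hx θ hθ)).differentiableAt.differentiableWithinAt

end IntegralShift

/-! ### Compact integral operators and the Fredholm alternative -/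

section Compactness

theorem isCompact_setOf_norm_le_and_dist_le {X E : Type*} [TopologicalSpace X] [CompactSpace X]
    [NormedAddCommGroup E] [ProperSpace E] (C : ℝ) {m : X → X → ℝ}
    (hm : ∀ x, Tendsto (m x) (𝓝 x) (𝓝 0)) :
    IsCompact {f : C(X, E) | (∀ x, ‖f x‖ ≤ C) ∧ ∀ x y, dist (f x) (f y) ≤ m x y} := by
  let S' : Set (X → E) := {g | (∀ x, ‖g x‖ ≤ C) ∧ ∀ x y, dist (g x) (g y) ≤ m x y}
  have hS' : IsCompact S' := by
    refine (isCompact_univ_pi fun _ : X => isCompact_closedBall (0 : E) C).of_isClosed_subset ?_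
      fun g hg x _ => mem_closedBall_zero_iff.2 (hg.1 x)
    simp only [S', ofPred_and, ofPred_forall]
    refine IsClosed.inter (isClosed_iInter fun x => ?_)
      (isClosed_iInter fun x => isClosed_iInter fun y => ?_)
    · exact isClosed_le (continuous_apply x).norm continuous_const
    · exact isClosed_le ((continuous_apply x).dist (continuous_apply y)) continuous_const
  have hcont : ∀ g ∈ S', Continuous g := fun g hg => continuous_iff_continuousAt.2 fun x => by
    rw [ContinuousAt, tendsto_iff_dist_tendsto_zero]
    refine squeeze_zero (fun _ => dist_nonneg) (fun y => ?_) (hm x)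
    rw [dist_comm]
    exact hg.2 x y
  have himage : ContinuousMap.toFun '' {f : C(X, E) | ⇑f ∈ S'} = S' :=
    Subset.antisymm (image_subset_iff.2 fun _ hf => hf) fun g hg => ⟨⟨g, hcont g hg⟩, hg, rfl⟩
  refine ArzelaAscoli.isCompact_of_equicontinuous _ (himage ▸ hS') fun x => ?_
  exact Metric.equicontinuousAt_of_continuity_modulus _ (hm x) _
    (Eventually.of_forall fun y f => f.2.2 x y)

theorem exists_add_eq_of_isCompactOperator {𝕜 E : Type*} [NontriviallyNormedField 𝕜]
    [NormedAddCommGroup E] [NormedSpace 𝕜 E] [CompleteSpace E] {T : E →L[𝕜] E}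
    (hT : IsCompactOperator T) (hinj : ∀ x, x + T x = 0 → x = 0) (y : E) :
    ∃ x, x + T x = y := by
  rcases hT.hasEigenvalue_or_mem_resolventSet (μ := (-1 : 𝕜)) (by simp) with h | h
  · obtain ⟨x, hx⟩ := h.exists_hasEigenvector
    refine absurd (hinj x ?_) hx.2
    have hTx : T x = -x := by simpa using hx.apply_eq_smul
    rw [hTx, add_neg_cancel]
  · obtain ⟨S, hS⟩ := (spectrum.mem_resolventSet_iff.1 h).exists_right_inv
    have hSy := congrArg (fun A : E →L[𝕜] E => A y) hS
    simp only [map_neg, map_one, mul_apply_eq_comp, sub_apply, neg_apply,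
      one_apply_eq_self] at hSy
    exact ⟨-(S y), by rw [map_neg, ← sub_eq_add_neg, hSy]⟩

end Compactness

section ConjIntegral

variable {X : Type*} [TopologicalSpace X]

/-- The modulus of continuity, with respect to the first variable and in the mean over the second,
of a kernel. -/
def kernelModulus (κ : C(X × ℝ, ℂ)) (w w' : X) : ℝ :=
  ∫ θ in (0 : ℝ)..(2 * π), ‖κ (w, θ) - κ (w', θ)‖

theorem kernelModulus_nonneg (κ : C(X × ℝ, ℂ)) (w w' : X) : 0 ≤ kernelModulus κ w w' :=
  intervalIntegral.integral_nonneg Real.two_pi_pos.le fun _ _ => norm_nonneg _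

theorem tendsto_kernelModulus (κ : C(X × ℝ, ℂ)) (w : X) :
    Tendsto (kernelModulus κ w) (𝓝 w) (𝓝 0) := by
  have hcont : Continuous (kernelModulus κ w) := by
    unfold kernelModulus
    refine intervalIntegral.continuous_parametric_intervalIntegral_of_continuous'
      (f := fun w' θ => ‖κ (w, θ) - κ (w', θ)‖) ?_ 0 (2 * π)
    exact ((κ.continuous.comp (continuous_const.prodMk continuous_snd)).sub κ.continuous).norm
  simpa [kernelModulus] using hcont.tendsto w

theorem exists_norm_kernel_le [CompactSpace X] (κ : C(X × ℝ, ℂ)) :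
    ∃ M, 0 ≤ M ∧ ∀ w, ∀ θ ∈ Icc (0 : ℝ) (2 * π), ‖κ (w, θ)‖ ≤ M := by
  obtain ⟨M, hM⟩ := ((isCompact_univ (X := X)).prod
    (isCompact_Icc (a := (0 : ℝ)) (b := 2 * π))).exists_bound_of_continuousOn
    κ.continuous.continuousOn
  exact ⟨max M 0, le_max_right _ _, fun w θ hθ =>
    (hM (w, θ) ⟨mem_univ _, hθ⟩).trans (le_max_left _ _)⟩

theorem continuous_conj_comp_exp (p : C(Circle, ℂ)) :
    Continuous fun θ : ℝ => conj (p (Circle.exp θ)) :=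
  continuous_conj.comp (p.continuous.comp Circle.exp.continuous)

/-- The function `w ↦ ∫ conj (p(e^{iθ})) κ(w, θ) dθ`. -/
def conjIntegral (κ : C(X × ℝ, ℂ)) (p : C(Circle, ℂ)) : C(X, ℂ) where
  toFun w := ∫ θ in (0 : ℝ)..(2 * π), conj (p (Circle.exp θ)) * κ (w, θ)
  continuous_toFun := by
    refine intervalIntegral.continuous_parametric_intervalIntegral_of_continuous'
      (f := fun w θ => conj (p (Circle.exp θ)) * κ (w, θ)) ?_ 0 (2 * π)
    exact ((continuous_conj_comp_exp p).comp continuous_snd).mul κ.continuous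

theorem norm_conjIntegral_apply_le {κ : C(X × ℝ, ℂ)} {M : ℝ}
    (hM : ∀ w, ∀ θ ∈ Icc (0 : ℝ) (2 * π), ‖κ (w, θ)‖ ≤ M) (p : C(Circle, ℂ)) (w : X) :
    ‖conjIntegral κ p w‖ ≤ M * (2 * π) * ‖p‖ := by
  have h := intervalIntegral.norm_integral_le_of_norm_le_const (a := 0) (b := 2 * π)
    (f := fun θ => conj (p (Circle.exp θ)) * κ (w, θ)) (C := ‖p‖ * M) fun θ hθ => by
      rw [uIoc_of_le Real.two_pi_pos.le] at hθ
      rw [norm_mul, RCLike.norm_conj]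
      exact mul_le_mul (p.norm_coe_le_norm _) (hM w θ (Ioc_subset_Icc_self hθ)) (norm_nonneg _)
        (norm_nonneg _)
  rw [sub_zero, abs_of_pos Real.two_pi_pos] at h
  exact h.trans (le_of_eq (by ring))

theorem dist_conjIntegral_apply_le (κ : C(X × ℝ, ℂ)) (p : C(Circle, ℂ)) (w w' : X) :
    dist (conjIntegral κ p w) (conjIntegral κ p w') ≤ ‖p‖ * kernelModulus κ w w' := by
  have hc : ∀ w, Continuous fun θ => conj (p (Circle.exp θ)) * κ (w, θ) := fun w =>
    (continuous_conj_comp_exp p).mul (by fun_prop)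
  have hκ : Continuous fun θ => ‖κ (w, θ) - κ (w', θ)‖ := by fun_prop
  change dist (∫ θ in (0 : ℝ)..(2 * π), _) (∫ θ in (0 : ℝ)..(2 * π), _) ≤ _
  rw [dist_eq_norm, ← intervalIntegral.integral_sub ((hc w).intervalIntegrable _ _)
    ((hc w').intervalIntegrable _ _), kernelModulus, ← intervalIntegral.integral_const_mul]
  refine intervalIntegral.norm_integral_le_of_norm_le Real.two_pi_pos.le
    (Eventually.of_forall fun θ _ => ?_) ((continuous_const.mul hκ).intervalIntegrable _ _)
  rw [← mul_sub, norm_mul, RCLike.norm_conj]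
  exact mul_le_mul_of_nonneg_right (p.norm_coe_le_norm _) (norm_nonneg _)

variable [CompactSpace X]

/-- `conjIntegral` as an operator. It is only real-linear, because of the conjugate. -/
def conjIntegralOp (κ : C(X × ℝ, ℂ)) : C(Circle, ℂ) →L[ℝ] C(X, ℂ) :=
  LinearMap.mkContinuousOfExistsBound
    { toFun := conjIntegral κ
      map_add' := fun p q => by
        ext w
        have hc : ∀ p : C(Circle, ℂ), Continuous fun θ => conj (p (Circle.exp θ)) * κ (w, θ) :=
          fun p => (continuous_conj_comp_exp p).mul (by fun_prop)
        simp only [conjIntegral, ContinuousMap.coe_mk, ContinuousMap.add_apply]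
        rw [← intervalIntegral.integral_add ((hc p).intervalIntegrable _ _)
          ((hc q).intervalIntegrable _ _)]
        simp [add_mul]
      map_smul' := fun a p => by
        ext w
        simp only [conjIntegral, ContinuousMap.coe_mk, ContinuousMap.smul_apply, RingHom.id_apply]
        rw [← intervalIntegral.integral_smul]
        simp [mul_assoc] }
    (by
      obtain ⟨M, hM0, hM⟩ := exists_norm_kernel_le κ
      exact ⟨M * (2 * π), fun p => (ContinuousMap.norm_le _ (by positivity)).2
        (norm_conjIntegral_apply_le hM p)⟩)

theorem conjIntegralOp_apply (κ : C(X × ℝ, ℂ)) (p : C(Circle, ℂ)) (w : X) :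
    conjIntegralOp κ p w = ∫ θ in (0 : ℝ)..(2 * π), conj (p (Circle.exp θ)) * κ (w, θ) := rfl

theorem isCompactOperator_conjIntegralOp (κ : C(X × ℝ, ℂ)) :
    IsCompactOperator (conjIntegralOp κ) := by
  obtain ⟨M, hM0, hM⟩ := exists_norm_kernel_le κ
  refine ⟨_, isCompact_setOf_norm_le_and_dist_le (M * (2 * π)) (tendsto_kernelModulus κ),
    mem_of_superset (closedBall_mem_nhds 0 one_pos) fun p hp => ?_⟩
  rw [mem_closedBall_zero_iff] at hp
  refine ⟨fun w => (norm_conjIntegral_apply_le hM p w).trans ?_,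
    fun w w' => (dist_conjIntegral_apply_le κ p w w').trans ?_⟩
  · exact mul_le_of_le_one_right (by positivity) hp
  · exact mul_le_of_le_one_left (kernelModulus_nonneg κ w w') hp

end ConjIntegral

/-! ### The boundary integral equation -/

section BoundaryEquation

/-- Radii `1 < R < R'` for which sources on the circle of radius `1/R` and field points in the disk
of radius `R'` stay away from all image poles. -/
structure Radii (P c R R' : ℝ) : Prop where
  one_lt : 1 < R
  lt : R < R'
  lt_period : R' + R⁻¹ < P
  lt_gap : R' + R⁻¹ < 2 * c

namespace Radii

variable {P c R R' : ℝ}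

theorem pos (h : Radii P c R R') : 0 < R := one_pos.trans h.one_lt

theorem inv_lt_one (h : Radii P c R R') : R⁻¹ < 1 := inv_lt_one_of_one_lt₀ h.one_lt

theorem inv_pos (h : Radii P c R R') : 0 < R⁻¹ := _root_.inv_pos.2 h.pos

theorem period_pos (h : Radii P c R R') : 0 < P := by
  linarith [h.lt_period, h.inv_pos, h.pos, h.lt]

end Radii

/-- The source density `conj (p(e^{iθ})) s` at the point `s = e^{iθ}/R`. -/
def density (R : ℝ) (p : C(Circle, ℂ)) (θ : ℝ) : ℂ :=
  conj (p (Circle.exp θ)) * circleMap 0 R⁻¹ θ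

/-- The holomorphic potential of the `iP`-periodic arrays of sources around `c` and `-c`. -/
def layer (P c R : ℝ) (p : C(Circle, ℂ)) (z : ℂ) : ℂ :=
  (2 * π : ℂ)⁻¹ *
    ((∫ θ in (0 : ℝ)..(2 * π), density R p θ * cothKernel P (z + -(c + circleMap 0 R⁻¹ θ))) +
      ∫ θ in (0 : ℝ)..(2 * π), density R p θ * cothKernel P (z + (c + circleMap 0 R⁻¹ θ)))

/-- The part of the potential `layer`, as a function of `ζ = z - c`, that is regular in the
disk around `c`. -/
def regPart (P c R : ℝ) (p : C(Circle, ℂ)) (ζ : ℂ) : ℂ :=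
  (2 * π : ℂ)⁻¹ *
    ((∫ θ in (0 : ℝ)..(2 * π), density R p θ * regKernel P (ζ + -circleMap 0 R⁻¹ θ)) +
      ∫ θ in (0 : ℝ)..(2 * π), density R p θ * cothKernel P (ζ + (2 * c + circleMap 0 R⁻¹ θ)))

variable {P c R R' : ℝ}

theorem continuous_density (R : ℝ) (p : C(Circle, ℂ)) : Continuous (density R p) :=
  (continuous_conj_comp_exp p).mul (continuous_circleMap _ _)

theorem norm_circleMap_inv (h : Radii P c R R') (θ : ℝ) : ‖circleMap 0 R⁻¹ θ‖ = R⁻¹ := by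
  rw [norm_circleMap_zero, abs_of_pos h.inv_pos]

theorem sub_mem_ball (h : Radii P c R R') {ζ : ℂ} (hζ : ζ ∈ ball (0 : ℂ) R') (θ : ℝ) :
    ζ + -circleMap 0 R⁻¹ θ ∈ ball (0 : ℂ) P := by
  rw [mem_ball_zero_iff] at hζ ⊢
  have := norm_add_le ζ (-circleMap 0 R⁻¹ θ)
  rw [norm_neg, norm_circleMap_inv h] at this
  linarith [h.lt_period]

theorem expSub_add_gap_ne_zero (h : Radii P c R R') {ζ : ℂ} (hζ : ζ ∈ ball (0 : ℂ) R') (θ : ℝ) :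
    expSub P (ζ + (2 * c + circleMap 0 R⁻¹ θ)) ≠ 0 := by
  refine expSub_ne_zero_of_re_ne_zero h.period_pos (ne_of_gt ?_)
  rw [mem_ball_zero_iff] at hζ
  have hζre := (neg_le_neg (abs_re_le_norm ζ)).trans (neg_abs_le ζ.re)
  have hsre := (neg_le_neg (abs_re_le_norm (circleMap 0 R⁻¹ θ))).trans (neg_abs_le _)
  rw [norm_circleMap_inv h] at hsre
  have hre : (ζ + (2 * c + circleMap 0 R⁻¹ θ)).re = ζ.re + (2 * c + (circleMap 0 R⁻¹ θ).re) := by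
    simp
  rw [hre]
  linarith [h.lt_gap]

theorem differentiableOn_regPart (h : Radii P c R R') (p : C(Circle, ℂ)) :
    DifferentiableOn ℂ (regPart P c R p) (ball 0 R') := by
  intro ζ hζ
  have hreg := analyticAt_integral_shift isOpen_ball (differentiableOn_regKernel h.period_pos)
    (continuous_density R p) (continuous_circleMap 0 R⁻¹).neg Real.two_pi_pos.le
    (fun θ _ => sub_mem_ball h hζ θ)
  have hcoth := analyticAt_integral_shift (isOpen_expSub_ne_zero P) (differentiableOn_cothKernel P)
    (continuous_density R p) (continuous_const.add (continuous_circleMap 0 R⁻¹))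
    Real.two_pi_pos.le (fun θ _ => expSub_add_gap_ne_zero h hζ θ)
  exact ((hreg.differentiableAt.add hcoth.differentiableAt).const_mul _).differentiableWithinAt

theorem mul_circle_mem_ball (h : Radii P c R R') (w : Circle) :
    (R * w : ℂ) ∈ ball (0 : ℂ) R' := by
  rw [mem_ball_zero_iff, norm_mul, Circle.norm_coe, mul_one, norm_real, Real.norm_eq_abs,
    abs_of_pos h.pos]
  exact h.lt

theorem zero_mem_ball (h : Radii P c R R') : (0 : ℂ) ∈ ball (0 : ℂ) R' :=
  mem_ball_self (h.pos.trans h.lt)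

/-- The field at `c + ζ` of the sources at `c + e^{iθ}/R` and `-(c + e^{iθ}/R)` and of their
translates by multiples of `iP`, without the pole at `ζ = e^{iθ}/R`. -/
def fieldKernel (P c R : ℝ) (ζ : ℂ) (θ : ℝ) : ℂ :=
  regKernel P (ζ + -circleMap 0 R⁻¹ θ) + cothKernel P (ζ + (2 * c + circleMap 0 R⁻¹ θ))

theorem continuous_regKernel_sub (h : Radii P c R R') {X : Type*} [TopologicalSpace X]
    {ζ : X → ℂ} (hζ : Continuous ζ) (hm : ∀ x, ζ x ∈ ball (0 : ℂ) R') :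
    Continuous fun q : X × ℝ => regKernel P (ζ q.1 + -circleMap 0 R⁻¹ q.2) :=
  (differentiableOn_regKernel h.period_pos).continuousOn.comp_continuous
    ((hζ.comp continuous_fst).add ((continuous_circleMap 0 R⁻¹).comp continuous_snd).neg)
    fun q => sub_mem_ball h (hm q.1) q.2

theorem continuous_cothKernel_add_gap (h : Radii P c R R') {X : Type*} [TopologicalSpace X]
    {ζ : X → ℂ} (hζ : Continuous ζ) (hm : ∀ x, ζ x ∈ ball (0 : ℂ) R') :
    Continuous fun q : X × ℝ => cothKernel P (ζ q.1 + (2 * c + circleMap 0 R⁻¹ q.2)) :=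
  (differentiableOn_cothKernel P).continuousOn.comp_continuous
    ((hζ.comp continuous_fst).add
      (continuous_const.add ((continuous_circleMap 0 R⁻¹).comp continuous_snd)))
    fun q => expSub_add_gap_ne_zero h (hm q.1) q.2

theorem continuous_fieldKernel (h : Radii P c R R') {X : Type*} [TopologicalSpace X]
    {ζ : X → ℂ} (hζ : Continuous ζ) (hm : ∀ x, ζ x ∈ ball (0 : ℂ) R') :
    Continuous fun q : X × ℝ => fieldKernel P c R (ζ q.1) q.2 :=
  (continuous_regKernel_sub h hζ hm).add (continuous_cothKernel_add_gap h hζ hm)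

theorem continuous_density_mul_regKernel (h : Radii P c R R') (p : C(Circle, ℂ)) {ζ : ℂ}
    (hζ : ζ ∈ ball (0 : ℂ) R') :
    Continuous fun θ => density R p θ * regKernel P (ζ + -circleMap 0 R⁻¹ θ) := by
  have hkernel := (continuous_regKernel_sub h (ζ := fun _ : Unit => ζ) continuous_const
    fun _ => hζ).comp (Continuous.prodMk_right ())
  exact (continuous_density R p).mul hkernel

theorem continuous_density_mul_cothKernel (h : Radii P c R R') (p : C(Circle, ℂ)) {ζ : ℂ}
    (hζ : ζ ∈ ball (0 : ℂ) R') :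
    Continuous fun θ => density R p θ * cothKernel P (ζ + (2 * c + circleMap 0 R⁻¹ θ)) := by
  have hkernel := (continuous_cothKernel_add_gap h (ζ := fun _ : Unit => ζ) continuous_const
    fun _ => hζ).comp (Continuous.prodMk_right ())
  exact (continuous_density R p).mul hkernel

theorem continuous_density_mul_fieldKernel (h : Radii P c R R') (p : C(Circle, ℂ)) {ζ : ℂ}
    (hζ : ζ ∈ ball (0 : ℂ) R') :
    Continuous fun θ => density R p θ * fieldKernel P c R ζ θ := by
  simpa only [fieldKernel, mul_add] using!
    (continuous_density_mul_regKernel h p hζ).add (continuous_density_mul_cothKernel h p hζ)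

/-- The kernel of the boundary integral operator on the circle of radius `R`. -/
def boundaryKernel (h : Radii P c R R') : C(Circle × ℝ, ℂ) where
  toFun q := (2 * π : ℂ)⁻¹ * circleMap 0 R⁻¹ q.2 *
    (fieldKernel P c R (R * q.1) q.2 - fieldKernel P c R 0 q.2)
  continuous_toFun := by
    refine (continuous_const.mul ((continuous_circleMap 0 R⁻¹).comp continuous_snd)).mul
      (Continuous.sub ?_ ?_)
    · exact continuous_fieldKernel h (ζ := fun w : Circle => (R * w : ℂ))
        (continuous_const.mul continuous_subtype_val) (mul_circle_mem_ball h)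
    · exact continuous_fieldKernel h (ζ := fun _ : Circle => (0 : ℂ)) continuous_const
        fun _ => zero_mem_ball h

theorem regPart_eq_integral (h : Radii P c R R') (p : C(Circle, ℂ)) {ζ : ℂ}
    (hζ : ζ ∈ ball (0 : ℂ) R') :
    regPart P c R p ζ =
      (2 * π : ℂ)⁻¹ * ∫ θ in (0 : ℝ)..(2 * π), density R p θ * fieldKernel P c R ζ θ := by
  simp only [regPart, fieldKernel, mul_add (density R p _)]
  rw [intervalIntegral.integral_add
    ((continuous_density_mul_regKernel h p hζ).intervalIntegrable _ _)
    ((continuous_density_mul_cothKernel h p hζ).intervalIntegrable _ _)]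

theorem conjIntegralOp_boundaryKernel (h : Radii P c R R') (p : C(Circle, ℂ)) (w : Circle) :
    conjIntegralOp (boundaryKernel h) p w = regPart P c R p (R * w) - regPart P c R p 0 := by
  have hw := mul_circle_mem_ball h w
  have h0 := zero_mem_ball h
  rw [conjIntegralOp_apply, regPart_eq_integral h p hw, regPart_eq_integral h p h0, ← mul_sub,
    ← intervalIntegral.integral_sub
      ((continuous_density_mul_fieldKernel h p hw).intervalIntegrable _ _)
      ((continuous_density_mul_fieldKernel h p h0).intervalIntegrable _ _),
    ← intervalIntegral.integral_const_mul]
  refine intervalIntegral.integral_congr fun θ _ => ?_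
  simp only [boundaryKernel, ContinuousMap.coe_mk, density]
  ring

theorem conj_circleMap_zero_inv (R θ : ℝ) :
    conj (circleMap 0 R⁻¹ θ) = (circleMap 0 R θ)⁻¹ := by
  simp only [circleMap, zero_add, map_mul, conj_ofReal, mul_inv, ofReal_inv, ← exp_neg, ← exp_conj]
  simp

theorem intervalIntegral_conj (f : ℝ → ℂ) (a b : ℝ) :
    ∫ θ in a..b, conj (f θ) = conj (∫ θ in a..b, f θ) := by
  simp only [intervalIntegral, integral_conj, map_sub]

theorem integral_mul_inv_circleMap_sub {q : ℂ → ℂ} {U : Set ℂ} (hU : IsOpen U)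
    (hsub : closedBall 0 R ⊆ U) (hq : DifferentiableOn ℂ q U) (hq0 : q 0 = 0) {w : ℂ}
    (hw : w ∈ ball (0 : ℂ) R) (hw0 : w ≠ 0) :
    ∫ θ in (0 : ℝ)..(2 * π), q (circleMap 0 R θ) * (circleMap 0 R θ - w)⁻¹ =
      2 * π * (q w / w) := by
  have hR : 0 < R := pos_of_mem_ball hw
  have hd : DifferentiableOn ℂ (dslope q 0) U :=
    (differentiableOn_dslope (hU.mem_nhds (hsub (mem_closedBall_self hR.le)))).2 hq
  have hdq : ∀ t ≠ 0, dslope q 0 t = q t / t := fun t ht => by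
    rw [dslope_of_ne _ ht, slope_def_field, hq0, sub_zero, sub_zero]
  have hcauchy := (hd.mono hsub).circleIntegral_sub_inv_smul hw
  have hcongr : ∀ θ : ℝ, deriv (circleMap 0 R) θ • ((circleMap 0 R θ - w)⁻¹ •
      dslope q 0 (circleMap 0 R θ)) = I * (q (circleMap 0 R θ) * (circleMap 0 R θ - w)⁻¹) := by
    intro θ
    have hne : circleMap 0 R θ ≠ 0 := circleMap_ne_center hR.ne'
    rw [hdq _ hne, deriv_circleMap, smul_eq_mul, smul_eq_mul]
    field_simp
  simp only [circleIntegral, hdq w hw0, hcongr] at hcauchy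
  rw [intervalIntegral.integral_const_mul, smul_eq_mul] at hcauchy
  refine mul_left_cancel₀ I_ne_zero (hcauchy.trans ?_)
  ring

theorem circleMap_inv_mul_inv_sub {w : ℂ} (hw : w ∈ ball (0 : ℂ) R) (hw0 : w ≠ 0) (θ : ℝ) :
    circleMap 0 R⁻¹ θ * ((conj w)⁻¹ + -circleMap 0 R⁻¹ θ)⁻¹ =
      conj (w * (circleMap 0 R θ - w)⁻¹) := by
  have hR : 0 < R := pos_of_mem_ball hw
  have hne : circleMap 0 R θ ≠ 0 := circleMap_ne_center hR.ne'
  have hsub : circleMap 0 R θ - w ≠ 0 := sub_ne_zero.2 <| by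
    rintro rfl
    rw [mem_ball_zero_iff, norm_circleMap_zero, abs_of_pos hR] at hw
    exact lt_irrefl _ hw
  apply (starRingEnd ℂ).injective
  have hdiff : w⁻¹ + -(circleMap 0 R θ)⁻¹ = (circleMap 0 R θ - w) / (w * circleMap 0 R θ) := by
    field_simp
    ring
  rw [conj_conj, map_mul, map_inv₀, map_add, map_neg, map_inv₀, conj_conj,
    conj_circleMap_zero_inv, hdiff]
  field_simp

/-- The Cauchy integral formula outside the circle of radius `1/R`, for the reflection
`ζ ↦ conj (q(1/conj ζ))` of a function holomorphic in the disk of radius `R`. -/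
theorem integral_conj_mul_div_sub {q : ℂ → ℂ} (hR : 0 < R) {U : Set ℂ} (hU : IsOpen U)
    (hsub : closedBall 0 R ⊆ U) (hq : DifferentiableOn ℂ q U) (hq0 : q 0 = 0) {ζ : ℂ}
    (hζ : R⁻¹ < ‖ζ‖) :
    ∫ θ in (0 : ℝ)..(2 * π), conj (q (circleMap 0 R θ)) * circleMap 0 R⁻¹ θ *
      (ζ + -circleMap 0 R⁻¹ θ)⁻¹ = 2 * π * conj (q ((conj ζ)⁻¹)) := by
  have hζ0 : ζ ≠ 0 := norm_pos_iff.1 ((inv_pos.2 hR).trans hζ)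
  obtain ⟨w, rfl⟩ : ∃ w, (conj w)⁻¹ = ζ := ⟨(conj ζ)⁻¹, by simp⟩
  have hw0 : w ≠ 0 := by simpa using hζ0
  have hw : w ∈ ball (0 : ℂ) R := by
    rw [norm_inv, RCLike.norm_conj] at hζ
    simpa using (inv_lt_inv₀ hR (norm_pos_iff.2 hw0)).1 hζ
  have hpoint : ∀ θ : ℝ, conj (q (circleMap 0 R θ)) * circleMap 0 R⁻¹ θ *
      ((conj w)⁻¹ + -circleMap 0 R⁻¹ θ)⁻¹ =
      conj (w * (q (circleMap 0 R θ) * (circleMap 0 R θ - w)⁻¹)) := fun θ => by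
    rw [mul_assoc, circleMap_inv_mul_inv_sub hw hw0, ← map_mul, mul_left_comm]
  have hcancel : w * (2 * π * (q w / w)) = (2 * π : ℝ) * q w := by
    push_cast
    field_simp
  simp only [hpoint]
  rw [intervalIntegral_conj, intervalIntegral.integral_const_mul,
    integral_mul_inv_circleMap_sub hU hsub hq hq0 hw hw0, hcancel, map_mul, conj_ofReal,
    map_inv₀, conj_conj, inv_inv]
  push_cast
  rfl

/-- The holomorphic extension to the disk of radius `R'` of a solution `p` of the boundary
integral equation with data `d`. -/
def extension (P c R : ℝ) (d : ℂ → ℂ) (p : C(Circle, ℂ)) (ζ : ℂ) : ℂ :=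
  -(d ζ - d 0) - (regPart P c R p ζ - regPart P c R p 0)

theorem extension_zero (d : ℂ → ℂ) (p : C(Circle, ℂ)) : extension P c R d p 0 = 0 := by
  simp [extension]

theorem differentiableOn_extension (h : Radii P c R R') {d : ℂ → ℂ}
    (hd : DifferentiableOn ℂ d (ball 0 R')) (p : C(Circle, ℂ)) :
    DifferentiableOn ℂ (extension P c R d p) (ball 0 R') :=
  (hd.sub_const _).neg.sub ((differentiableOn_regPart h p).sub_const _)

/-- The boundary integral equation with data `d`. -/
def IsDensity (P c R : ℝ) (d : ℂ → ℂ) (p : C(Circle, ℂ)) : Prop :=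
  ∀ w : Circle, p w = extension P c R d p (R * w)

theorem density_mul_cothKernel_eq (h : Radii P c R R') {d : ℂ → ℂ} {p : C(Circle, ℂ)}
    (hp : IsDensity P c R d p) {ζ : ℂ} (hζ : ζ ∈ ball (0 : ℂ) R') {θ : ℝ}
    (hne : ζ + -circleMap 0 R⁻¹ θ ≠ 0) :
    density R p θ * cothKernel P (ζ + -circleMap 0 R⁻¹ θ) =
      conj (extension P c R d p (circleMap 0 R θ)) * circleMap 0 R⁻¹ θ *
        (ζ + -circleMap 0 R⁻¹ θ)⁻¹ + density R p θ * regKernel P (ζ + -circleMap 0 R⁻¹ θ) := by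
  have hcircle : circleMap 0 R θ = R * (Circle.exp θ : ℂ) := by simp [circleMap]
  rw [cothKernel_eq_inv_add_regKernel h.period_pos hne (by simpa using sub_mem_ball h hζ θ),
    hcircle, ← hp, density]
  ring

theorem layer_eq_conj_extension_add_regPart (h : Radii P c R R') {d : ℂ → ℂ}
    (hd : DifferentiableOn ℂ d (ball 0 R')) {p : C(Circle, ℂ)} (hp : IsDensity P c R d p)
    {ζ : ℂ} (hζ : R⁻¹ < ‖ζ‖) (hζ' : ‖ζ‖ < R') :
    layer P c R p (c + ζ) = conj (extension P c R d p ((conj ζ)⁻¹)) + regPart P c R p ζ := by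
  have hζb : ζ ∈ ball (0 : ℂ) R' := by simpa using hζ'
  have hsub : closedBall (0 : ℂ) R ⊆ ball 0 R' := closedBall_subset_ball h.lt
  have hext := differentiableOn_extension h hd p
  have hcm := continuous_circleMap 0 R⁻¹
  have hne : ∀ θ, ζ + -circleMap 0 R⁻¹ θ ≠ 0 := fun θ h0 => by
    rw [eq_neg_of_add_eq_zero_left h0, neg_neg, norm_circleMap_inv h] at hζ
    exact lt_irrefl _ hζ
  have hright : ∀ θ, (c : ℂ) + ζ + -(c + circleMap 0 R⁻¹ θ) = ζ + -circleMap 0 R⁻¹ θ :=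
    fun θ => by ring
  have hleft : ∀ θ, (c : ℂ) + ζ + (c + circleMap 0 R⁻¹ θ) = ζ + (2 * c + circleMap 0 R⁻¹ θ) :=
    fun θ => by ring
  have hcont : Continuous fun θ => conj (extension P c R d p (circleMap 0 R θ)) *
      circleMap 0 R⁻¹ θ * (ζ + -circleMap 0 R⁻¹ θ)⁻¹ := by
    refine ((continuous_conj.comp ?_).mul hcm).mul ((continuous_const.add hcm.neg).inv₀ hne)
    exact hext.continuousOn.comp_continuous (continuous_circleMap 0 R) fun θ =>
      hsub (by simp [abs_of_pos h.pos])
  rw [layer, regPart]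
  simp only [hright, hleft, density_mul_cothKernel_eq h hp hζb (hne _)]
  rw [intervalIntegral.integral_add (hcont.intervalIntegrable _ _)
    ((continuous_density_mul_regKernel h p hζb).intervalIntegrable _ _),
    integral_conj_mul_div_sub h.pos isOpen_ball hsub hext (extension_zero d p) hζ]
  have hpi : (π : ℂ) ≠ 0 := by exact_mod_cast Real.pi_ne_zero
  field_simp
  ring

theorem layer_on_circle (h : Radii P c R R') {d : ℂ → ℂ}
    (hd : DifferentiableOn ℂ d (ball 0 R')) {p : C(Circle, ℂ)} (hp : IsDensity P c R d p)
    {ζ : ℂ} (hζ : ‖ζ‖ = 1) :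
    layer P c R p (c + ζ) = conj (extension P c R d p ζ) - extension P c R d p ζ - d ζ +
      (d 0 + regPart P c R p 0) := by
  have hinv : (conj ζ)⁻¹ = ζ := by
    rw [inv_eq_iff_eq_inv, inv_def, normSq_eq_norm_sq, hζ]
    simp
  rw [layer_eq_conj_extension_add_regPart h hd hp (by rw [hζ]; exact h.inv_lt_one)
    (by rw [hζ]; exact h.one_lt.trans h.lt), hinv]
  simp only [extension]
  ring

theorem re_layer_on_circle (h : Radii P c R R') {d : ℂ → ℂ}
    (hd : DifferentiableOn ℂ d (ball 0 R')) {p : C(Circle, ℂ)} (hp : IsDensity P c R d p)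
    {ζ : ℂ} (hζ : ‖ζ‖ = 1) :
    (layer P c R p (c + ζ)).re + (d ζ).re = (d 0 + regPart P c R p 0).re := by
  rw [layer_on_circle h hd hp hζ]
  simp

theorem isDensity_iff (h : Radii P c R R') (d : ℂ → ℂ) (p : C(Circle, ℂ)) :
    IsDensity P c R d p ↔
      ∀ w : Circle, p w + conjIntegralOp (boundaryKernel h) p w = -(d (R * w) - d 0) :=
  forall_congr' fun w => by
    rw [extension, conjIntegralOp_boundaryKernel, eq_sub_iff_add_eq]

theorem exists_isDensity (h : Radii P c R R')
    (hinj : ∀ p, IsDensity P c R 0 p → p = 0) {d : ℂ → ℂ}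
    (hd : DifferentiableOn ℂ d (ball 0 R')) : ∃ p, IsDensity P c R d p := by
  let g : C(Circle, ℂ) := ⟨fun w => -(d (R * w) - d 0), by
    have : Continuous fun w : Circle => d (R * w) := hd.continuousOn.comp_continuous
      (continuous_const.mul continuous_subtype_val) (mul_circle_mem_ball h)
    exact (this.sub continuous_const).neg⟩
  obtain ⟨p, hp⟩ := exists_add_eq_of_isCompactOperator
    (isCompactOperator_conjIntegralOp (boundaryKernel h))
    (fun p hp => hinj p ((isDensity_iff h 0 p).2 fun w => by
      simpa using DFunLike.congr_fun hp w)) g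
  exact ⟨p, (isDensity_iff h d p).2 fun w => DFunLike.congr_fun hp w⟩

end BoundaryEquation

/-! ### Period cells -/

section Cells

variable {P c : ℝ} {z : ℂ}

/-- The closed period cell outside the open unit disks around `±c`. -/
def closedCell (P c : ℝ) : Set ℂ := {z | |z.im| ≤ P / 2 ∧ 1 ≤ ‖z - c‖ ∧ 1 ≤ ‖z + c‖}

/-- The interior of `closedCell`. -/
def openCell (P c : ℝ) : Set ℂ := {z | |z.im| < P / 2 ∧ 1 < ‖z - c‖ ∧ 1 < ‖z + c‖}

/-- A closed part of the plane, wider than one period, outside the open unit disks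
around `±c`. -/
def wideCell (P c : ℝ) : Set ℂ := {z | |z.im| ≤ P - 1 ∧ 1 ≤ ‖z - c‖ ∧ 1 ≤ ‖z + c‖}

/-- The interior of `wideCell`. -/
def openWideCell (P c : ℝ) : Set ℂ := {z | |z.im| < P - 1 ∧ 1 < ‖z - c‖ ∧ 1 < ‖z + c‖}

/-- The points at distance greater than `r` from `±c + iPℤ`. -/
def farSet (P c r : ℝ) : Set ℂ :=
  {z | ∀ n : ℤ, r < ‖z - c - n * P * I‖ ∧ r < ‖z + c - n * P * I‖}

theorem isClosed_closedCell (P c : ℝ) : IsClosed (closedCell P c) :=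
  (isClosed_le (continuous_im.abs) continuous_const).inter
    ((isClosed_le continuous_const (continuous_id.sub continuous_const).norm).inter
      (isClosed_le continuous_const (continuous_id.add continuous_const).norm))

theorem isOpen_openCell (P c : ℝ) : IsOpen (openCell P c) :=
  (isOpen_lt (continuous_im.abs) continuous_const).inter
    ((isOpen_lt continuous_const (continuous_id.sub continuous_const).norm).inter
      (isOpen_lt continuous_const (continuous_id.add continuous_const).norm))

theorem isOpen_openWideCell (P c : ℝ) : IsOpen (openWideCell P c) :=
  (isOpen_lt (continuous_im.abs) continuous_const).inter
    ((isOpen_lt continuous_const (continuous_id.sub continuous_const).norm).inter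
      (isOpen_lt continuous_const (continuous_id.add continuous_const).norm))

theorem openCell_subset_closedCell (P c : ℝ) : openCell P c ⊆ closedCell P c :=
  fun _ hz => ⟨hz.1.le, hz.2.1.le, hz.2.2.le⟩

theorem openWideCell_subset_wideCell (P c : ℝ) : openWideCell P c ⊆ wideCell P c :=
  fun _ hz => ⟨hz.1.le, hz.2.1.le, hz.2.2.le⟩

theorem closedCell_subset_wideCell (hP : 2 < P) : closedCell P c ⊆ wideCell P c :=
  fun _ hz => ⟨hz.1.trans (by linarith), hz.2⟩

theorem norm_sub_ge_abs_im (z : ℂ) (c : ℝ) : |z.im| ≤ ‖z - c‖ := by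
  simpa using abs_im_le_norm (z - c)

theorem norm_add_ge_abs_im (z : ℂ) (c : ℝ) : |z.im| ≤ ‖z + c‖ := by
  simpa using abs_im_le_norm (z + c)

theorem mem_closedCell_of_one_le_abs_im (hz : 1 ≤ |z.im|) (hz' : |z.im| ≤ P / 2) :
    z ∈ closedCell P c :=
  ⟨hz', hz.trans (norm_sub_ge_abs_im z c), hz.trans (norm_add_ge_abs_im z c)⟩

theorem add_smul_mem_openWideCell {ζ : ℂ} (hζ : ‖ζ‖ = 1) {t : ℝ} (ht : 1 < t) (htP : t < P - 1)
    (htc : t < 2 * c - 1) : c + t * ζ ∈ openWideCell P c := by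
  have hn : ‖(t : ℂ) * ζ‖ = t := by
    rw [norm_mul, hζ, mul_one, norm_real, Real.norm_eq_abs, abs_of_pos (by linarith)]
  have him := abs_im_le_norm ((t : ℂ) * ζ)
  have hre := (abs_le.1 (abs_re_le_norm ((t : ℂ) * ζ))).1
  rw [hn] at him hre
  refine ⟨?_, ?_, lt_of_lt_of_le ?_ (re_le_norm _)⟩
  · rw [add_im, ofReal_im, zero_add]
    exact him.trans_lt htP
  · rwa [add_sub_cancel_left, hn]
  · rw [add_re, add_re, ofReal_re]
    linarith

theorem circle_subset_wideCell (hP : 2 < P) (hc : 1 < c) (hz : ‖z - c‖ = 1) :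
    z ∈ wideCell P c := by
  have him := abs_im_le_norm (z - c)
  have hre := abs_re_le_norm (z - c)
  rw [hz] at him hre
  simp only [sub_im, ofReal_im, sub_zero, sub_re, ofReal_re] at him hre
  refine ⟨by linarith, hz.ge, le_trans ?_ (re_le_norm _)⟩
  rw [add_re, ofReal_re]
  linarith [(abs_le.1 hre).1]

theorem wideCell_subset_farSet (hP : 0 < P) {r : ℝ} (hr : r < 1) :
    wideCell P c ⊆ farSet P c r := by
  rintro z ⟨him, hright, hleft⟩ n
  rcases eq_or_ne n 0 with rfl | hn
  · simp only [Int.cast_zero, zero_mul, sub_zero]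
    exact ⟨hr.trans_le hright, hr.trans_le hleft⟩
  · have hn' : (1 : ℝ) ≤ |(n : ℝ)| := by exact_mod_cast Int.one_le_abs hn
    have hdist : 1 ≤ |z.im - n * P| := by
      have := abs_sub_abs_le_abs_sub (n * P) z.im
      rw [abs_mul, abs_of_pos hP, abs_sub_comm] at this
      nlinarith
    constructor
    · refine hr.trans_le (hdist.trans (le_trans (le_of_eq ?_) (abs_im_le_norm _)))
      simp
    · refine hr.trans_le (hdist.trans (le_trans (le_of_eq ?_) (abs_im_le_norm _)))
      simp

theorem mem_farSet_of_abs_re {r : ℝ} (hr : r ≤ 1) (hz : |c| + 1 < |z.re|) :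
    z ∈ farSet P c r := by
  intro n
  have hright := abs_sub_abs_le_abs_sub z.re c
  have hleft := abs_sub_abs_le_abs_sub z.re (-c)
  rw [abs_neg] at hleft
  have hright' : (z - c - n * P * I).re = z.re - c := by simp
  have hleft' : (z + c - n * P * I).re = z.re - -c := by simp
  refine ⟨lt_of_lt_of_le ?_ (abs_re_le_norm _), lt_of_lt_of_le ?_ (abs_re_le_norm _)⟩
  · rw [hright']
    linarith
  · rw [hleft']
    linarith

theorem exists_mem_closedCell_eq {α : Type*} {F : ℂ → α}
    (hper : ∀ z, F (z + P * I) = F z) (hz : z ∈ openWideCell P c) :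
    ∃ z' ∈ closedCell P c, F z' = F z := by
  have him : |z.im| < P - 1 := hz.1
  have him' := abs_lt.1 him
  have hsub : (z - P * I).im = z.im - P := by simp
  have hadd : (z + P * I).im = z.im + P := by simp
  by_cases htop : P / 2 < z.im
  · refine ⟨z - P * I, mem_closedCell_of_one_le_abs_im ?_ ?_, by rw [← hper, sub_add_cancel]⟩ <;>
    · rw [hsub, abs_of_neg (by linarith)]
      linarith
  by_cases hbot : z.im < -(P / 2)
  · refine ⟨z + P * I, mem_closedCell_of_one_le_abs_im ?_ ?_, hper z⟩ <;>
    · rw [hadd, abs_of_pos (by linarith)]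
      linarith
  · exact ⟨z, ⟨abs_le.2 ⟨by linarith, by linarith⟩, hz.2.1.le, hz.2.2.le⟩, rfl⟩

end Cells

/-! ### Analytic continuation, periodicity and limits of the layer potential -/

section Layer

variable {P c R R' : ℝ}

theorem expSub_ne_zero_of_mem_farSet (h : Radii P c R R') {z : ℂ} (hz : z ∈ farSet P c R⁻¹)
    (θ : ℝ) : expSub P (z + -(c + circleMap 0 R⁻¹ θ)) ≠ 0 ∧
      expSub P (z + (c + circleMap 0 R⁻¹ θ)) ≠ 0 := by
  simp only [Ne, expSub_eq_zero_iff h.period_pos]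
  constructor
  · rintro ⟨n, hn⟩
    have hfar := (hz n).1
    have hdiff : z - c - n * P * I = circleMap 0 R⁻¹ θ := by linear_combination hn
    rw [hdiff, norm_circleMap_inv h] at hfar
    exact lt_irrefl _ hfar
  · rintro ⟨n, hn⟩
    have hfar := (hz n).2
    have hdiff : z + c - n * P * I = -circleMap 0 R⁻¹ θ := by linear_combination hn
    rw [hdiff, norm_neg, norm_circleMap_inv h] at hfar
    exact lt_irrefl _ hfar

theorem continuous_source (c R : ℝ) : Continuous fun θ => (c : ℂ) + circleMap 0 R⁻¹ θ :=
  continuous_const.add (continuous_circleMap 0 R⁻¹)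

theorem analyticAt_layer (h : Radii P c R R') (p : C(Circle, ℂ)) {z : ℂ}
    (hz : z ∈ farSet P c R⁻¹) : AnalyticAt ℂ (layer P c R p) z := by
  have hright := analyticAt_integral_shift (isOpen_expSub_ne_zero P)
    (differentiableOn_cothKernel P) (continuous_density R p) (continuous_source c R).neg
    Real.two_pi_pos.le (fun θ _ => (expSub_ne_zero_of_mem_farSet h hz θ).1)
  have hleft := analyticAt_integral_shift (isOpen_expSub_ne_zero P)
    (differentiableOn_cothKernel P) (continuous_density R p) (continuous_source c R)
    Real.two_pi_pos.le (fun θ _ => (expSub_ne_zero_of_mem_farSet h hz θ).2)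
  exact analyticAt_const.mul (hright.add hleft)

theorem deriv_layer (h : Radii P c R R') (p : C(Circle, ℂ)) {z : ℂ}
    (hz : z ∈ farSet P c R⁻¹) : deriv (layer P c R p) z = (2 * π : ℂ)⁻¹ *
    ((∫ θ in (0 : ℝ)..(2 * π), density R p θ *
        deriv (cothKernel P) (z + -(c + circleMap 0 R⁻¹ θ))) +
      ∫ θ in (0 : ℝ)..(2 * π), density R p θ *
        deriv (cothKernel P) (z + (c + circleMap 0 R⁻¹ θ))) := by
  have hright := hasDerivAt_integral_shift (isOpen_expSub_ne_zero P)
    (differentiableOn_cothKernel P) (continuous_density R p) (continuous_source c R).neg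
    Real.two_pi_pos.le (fun θ _ => (expSub_ne_zero_of_mem_farSet h hz θ).1)
  have hleft := hasDerivAt_integral_shift (isOpen_expSub_ne_zero P)
    (differentiableOn_cothKernel P) (continuous_density R p) (continuous_source c R)
    Real.two_pi_pos.le (fun θ _ => (expSub_ne_zero_of_mem_farSet h hz θ).2)
  exact ((hright.add hleft).const_mul _).deriv

theorem layer_add_period (hP : 0 < P) (p : C(Circle, ℂ)) (z : ℂ) :
    layer P c R p (z + P * I) = layer P c R p z := by
  simp only [layer, add_right_comm z (P * I : ℂ), cothKernel_add_period hP]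

theorem layer_neg (h : Radii P c R R') (p : C(Circle, ℂ)) {z : ℂ}
    (hz : z ∈ farSet P c R⁻¹) : layer P c R p (-z) = -layer P c R p z := by
  have hright : ∀ θ, cothKernel P (-z + -(c + circleMap 0 R⁻¹ θ)) =
      -cothKernel P (z + (c + circleMap 0 R⁻¹ θ)) := fun θ => by
    rw [← neg_add, cothKernel_neg (expSub_ne_zero_of_mem_farSet h hz θ).2]
  have hleft : ∀ θ, cothKernel P (-z + (c + circleMap 0 R⁻¹ θ)) =
      -cothKernel P (z + -(c + circleMap 0 R⁻¹ θ)) := fun θ => by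
    rw [← cothKernel_neg (expSub_ne_zero_of_mem_farSet h hz θ).1, neg_add, neg_neg]
  simp only [layer, hright, hleft, mul_neg, intervalIntegral.integral_neg]
  ring

theorem tendsto_integral_shift {G : ℂ → ℂ} {L : ℂ} {l : Filter ℝ} [l.IsCountablyGenerated]
    (hG : Tendsto G (comap re l) (𝓝 L)) {m s : ℝ → ℂ} (hm : Continuous m)
    {a b : ℝ} (hmeas : ∀ᶠ z in comap re l, Continuous fun θ => G (z + s θ))
    (hl : ∀ V ∈ l, ∀ᶠ x in l, ∀ θ, x + (s θ).re ∈ V) :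
    Tendsto (fun z => ∫ θ in a..b, m θ * G (z + s θ)) (comap re l)
      (𝓝 (∫ θ in a..b, m θ * L)) := by
  have hshift : ∀ U ∈ comap re l, ∀ᶠ z in comap re l, ∀ θ, z + s θ ∈ U := by
    rintro U ⟨V, hV, hVU⟩
    filter_upwards [tendsto_comap.eventually (hl V hV)] with z hz θ
    exact hVU (by simpa using hz θ)
  have hb : ∀ᶠ w in comap re l, ‖G w‖ ≤ ‖L‖ + 1 := by
    have := hG.norm.eventually (gt_mem_nhds (lt_add_one ‖L‖))
    filter_upwards [this] with w hw using hw.le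
  refine intervalIntegral.tendsto_integral_filter_of_dominated_convergence
    (fun θ => ‖m θ‖ * (‖L‖ + 1)) ?_ ?_ ?_ ?_
  · filter_upwards [hmeas] with z hz
    exact (hm.mul hz).aestronglyMeasurable
  · filter_upwards [hshift _ hb] with z hz
    refine Eventually.of_forall fun θ _ => ?_
    rw [norm_mul]
    exact mul_le_mul_of_nonneg_left (hz θ) (norm_nonneg _)
  · exact (hm.norm.mul continuous_const).intervalIntegrable _ _
  · refine Eventually.of_forall fun θ _ => ?_
    refine Tendsto.const_mul _ (hG.comp ?_)
    refine fun U hU => mem_map.2 ?_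
    filter_upwards [hshift U hU] with z hz using hz θ

theorem tendsto_integral_cothKernel_atTop (hP : 0 < P) {m s : ℝ → ℂ} (hm : Continuous m)
    (hs : Continuous s) {M : ℝ} (hM : ∀ θ, |(s θ).re| ≤ M) (a b : ℝ) :
    Tendsto (fun z => ∫ θ in a..b, m θ * cothKernel P (z + s θ)) (comap re atTop)
      (𝓝 (∫ θ in a..b, m θ * (π / P : ℝ))) := by
  refine tendsto_integral_shift (tendsto_cothKernel_re_atTop hP) hm ?_ ?_
  · filter_upwards [tendsto_comap.eventually (eventually_gt_atTop M)] with z hz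
    refine (differentiableOn_cothKernel P).continuousOn.comp_continuous
      (continuous_const.add hs) fun θ => expSub_ne_zero_of_re_ne_zero hP ?_
    have := (abs_le.1 (hM θ)).1
    rw [add_re]
    linarith
  · intro V hV
    obtain ⟨A, hA⟩ := mem_atTop_sets.1 hV
    filter_upwards [eventually_ge_atTop (A + M)] with x hx θ
    have := (abs_le.1 (hM θ)).1
    exact hA _ (by linarith)

theorem exists_tendsto_layer_atTop (h : Radii P c R R') (p : C(Circle, ℂ)) :
    ∃ L, Tendsto (layer P c R p) (comap re atTop) (𝓝 L) := by
  have hre : ∀ θ, |((c : ℂ) + circleMap 0 R⁻¹ θ).re| ≤ |c| + R⁻¹ := fun θ => by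
    refine (abs_re_le_norm _).trans ((norm_add_le _ _).trans ?_)
    rw [norm_circleMap_inv h, norm_real, Real.norm_eq_abs]
  have hright := tendsto_integral_cothKernel_atTop h.period_pos (continuous_density R p)
    (continuous_source c R).neg (fun θ => by simpa only [Pi.neg_apply, neg_re, abs_neg] using hre θ)
    0 (2 * π)
  have hleft := tendsto_integral_cothKernel_atTop h.period_pos (continuous_density R p)
    (continuous_source c R) hre 0 (2 * π)
  exact ⟨_, (hright.add hleft).const_mul _⟩

theorem exists_tendsto_layer_atBot (h : Radii P c R R') (p : C(Circle, ℂ)) :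
    ∃ L, Tendsto (layer P c R p) (comap re atBot) (𝓝 L) := by
  obtain ⟨L, hL⟩ := exists_tendsto_layer_atTop h p
  have hneg : Tendsto (fun w : ℂ => -w) (comap re atBot) (comap re atTop) := by
    rw [tendsto_comap_iff]
    exact tendsto_neg_atBot_atTop.comp tendsto_comap
  refine ⟨-L, ((hL.comp hneg).neg).congr' ?_⟩
  filter_upwards [tendsto_comap.eventually (eventually_lt_atBot (-(|c| + 1)))] with z hz
  rw [Function.comp_apply, layer_neg h p (mem_farSet_of_abs_re h.inv_lt_one.le ?_), neg_neg]
  rw [abs_of_neg (a := z.re) (by linarith [abs_nonneg c])]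
  linarith

end Layer

/-! ### Uniqueness for the boundary integral equation -/

section Uniqueness

theorem deriv_eq_zero_of_re_mem_finite {F : ℂ → ℂ} {z : ℂ} (hF : AnalyticAt ℂ F z) {V : Set ℝ}
    (hV : V.Finite) (hFV : ∀ᶠ w in 𝓝 z, (F w).re ∈ V) : deriv F z = 0 := by
  rcases hF.eventually_constant_or_nhds_le_map_nhds with hconst | hopen
  · have : F =ᶠ[𝓝 z] fun _ => F z := hconst
    rw [this.deriv_eq, deriv_const]
  · have hnhds : ∀ᶠ t : ℝ in 𝓝 (F z).re, ((t : ℂ) + (F z).im * I).re ∈ V := by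
      have hline : Continuous fun t : ℝ => (t : ℂ) + (F z).im * I := by fun_prop
      have hmem : {w : ℂ | w.re ∈ V} ∈ 𝓝 (F z) := hopen (mem_map.2 hFV)
      exact (hline.tendsto' _ (F z) (re_add_im _)) hmem
    refine absurd hV (infinite_of_mem_nhds (F z).re ?_)
    filter_upwards [hnhds] with t ht
    simpa using ht

/-- On a compact level set of `re F`, choose a point where `im F` is maximal and, among these, one
where `re z` is maximal: there `F` can be neither open nor constant. -/
theorem re_ne_of_isCompact_level {F : ℂ → ℂ} {A O : Set ℂ} (hO : IsOpen O)
    (han : ∀ z ∈ O, AnalyticAt ℂ F z) (hFA : ContinuousOn F A)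
    (hOA : ∀ z ∈ O, ∃ z' ∈ A, F z' = F z) (hshift : ∀ z ∈ A, ∀ t : ℝ, z + t ∈ O → z + t ∈ A)
    {w : ℝ} (hK : IsCompact {z ∈ A | (F z).re = w}) (hKO : ∀ z ∈ A, (F z).re = w → z ∈ O)
    {z : ℂ} (hz : z ∈ A) : (F z).re ≠ w := by
  intro hzw
  set K : Set ℂ := {z ∈ A | (F z).re = w}
  have himK : ContinuousOn (fun z => (F z).im) K :=
    continuous_im.comp_continuousOn (hFA.mono fun z hz => hz.1)
  obtain ⟨zm, hzm, hmax⟩ := hK.exists_isMaxOn ⟨z, hz, hzw⟩ himK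
  set K₂ : Set ℂ := {z ∈ K | (F z).im = (F zm).im}
  have hK₂ : IsCompact K₂ := hK.of_isClosed_subset
    (himK.preimage_isClosed_of_isClosed hK.isClosed (isClosed_singleton (x := (F zm).im)))
    fun z hz => hz.1
  obtain ⟨z₁, ⟨⟨hz₁A, hz₁w⟩, hz₁m⟩, hmax₁⟩ :=
    hK₂.exists_isMaxOn ⟨zm, hzm, rfl⟩ continuous_re.continuousOn
  have hz₁O := hKO z₁ hz₁A hz₁w
  rcases (han z₁ hz₁O).eventually_constant_or_nhds_le_map_nhds with hconst | hopen
  · have hright : Tendsto (fun t : ℝ => z₁ + t) (𝓝[>] 0) (𝓝 z₁) := by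
      have : Continuous fun t : ℝ => z₁ + (t : ℂ) := by fun_prop
      simpa using (this.tendsto 0).mono_left nhdsWithin_le_nhds
    obtain ⟨t, ⟨hFt, hOt⟩, htpos : 0 < t⟩ :=
      ((hright.eventually (hconst.and (hO.mem_nhds hz₁O))).and self_mem_nhdsWithin).exists
    have hle : (z₁ + (t : ℂ)).re ≤ z₁.re :=
      hmax₁ ⟨⟨hshift z₁ hz₁A t hOt, by rwa [hFt]⟩, by rwa [hFt]⟩
    rw [add_re, ofReal_re] at hle
    linarith
  · have hup : Tendsto (fun t : ℝ => F z₁ + t * I) (𝓝[>] 0) (𝓝 (F z₁)) := by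
      have : Continuous fun t : ℝ => F z₁ + (t : ℂ) * I := by fun_prop
      simpa using (this.tendsto 0).mono_left nhdsWithin_le_nhds
    have himage : F '' O ∈ 𝓝 (F z₁) := hopen (image_mem_map (hO.mem_nhds hz₁O))
    obtain ⟨t, ⟨z₂, hz₂, hF₂⟩, htpos : 0 < t⟩ :=
      ((hup.eventually himage).and self_mem_nhdsWithin).exists
    obtain ⟨z₃, hz₃, hF₃⟩ := hOA z₂ hz₂
    rw [hF₂] at hF₃
    have hle : (F z₃).im ≤ (F zm).im := hmax ⟨hz₃, by simpa [hF₃] using hz₁w⟩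
    have him : (F z₁ + t * I).im = (F z₁).im + t := by simp
    rw [hF₃, him, hz₁m] at hle
    linarith

theorem isCompact_re_level {F : ℂ → ℂ} {A : Set ℂ} (hA : IsClosed A) {a : ℝ}
    (him : ∀ z ∈ A, |z.im| ≤ a) (hFA : ContinuousOn F A) {L L' : ℂ}
    (hL : Tendsto F (comap re atTop) (𝓝 L)) (hL' : Tendsto F (comap re atBot) (𝓝 L'))
    {w : ℝ} (hw : w ≠ L.re) (hw' : w ≠ L'.re) : IsCompact {z ∈ A | (F z).re = w} := by
  have htop : ∀ᶠ z in comap re atTop, (F z).re ≠ w :=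
    ((continuous_re.tendsto L).comp hL).eventually_ne hw.symm
  have hbot : ∀ᶠ z in comap re atBot, (F z).re ≠ w :=
    ((continuous_re.tendsto L').comp hL').eventually_ne hw'.symm
  rw [eventually_comap] at htop hbot
  obtain ⟨x₁, hx₁⟩ := eventually_atTop.1 htop
  obtain ⟨x₂, hx₂⟩ := eventually_atBot.1 hbot
  refine ((isCompact_Icc (a := x₂) (b := x₁)).reProdIm
    (isCompact_Icc (a := -a) (b := a))).of_isClosed_subset
    ((continuous_re.comp_continuousOn hFA).preimage_isClosed_of_isClosed hA
      (isClosed_singleton (x := w))) fun z hz => ⟨⟨?_, ?_⟩, abs_le.1 (him z hz.1)⟩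
  · by_contra! hlt
    exact hx₂ z.re hlt.le z rfl hz.2
  · by_contra! hlt
    exact hx₁ z.re hlt.le z rfl hz.2

variable {P c R R' : ℝ}

theorem deriv_eq_zero_of_re_const {F : ℂ → ℂ} (hP : 2 < P)
    (hper : ∀ z, F (z + P * I) = F z) (han : ∀ z ∈ wideCell P c, AnalyticAt ℂ F z)
    {b b' : ℝ} (hb : ∀ z : ℂ, ‖z - c‖ = 1 → (F z).re = b)
    (hb' : ∀ z : ℂ, ‖z + c‖ = 1 → (F z).re = b')
    {L L' : ℂ} (hL : Tendsto F (comap re atTop) (𝓝 L)) (hL' : Tendsto F (comap re atBot) (𝓝 L'))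
    {z : ℂ} (hz : z ∈ openWideCell P c) : deriv F z = 0 := by
  have hOan : ∀ z ∈ openWideCell P c, AnalyticAt ℂ F z := fun z hz =>
    han z (openWideCell_subset_wideCell P c hz)
  have hFA : ContinuousOn F (closedCell P c) := fun z hz =>
    (han z (closedCell_subset_wideCell hP hz)).continuousAt.continuousWithinAt
  refine deriv_eq_zero_of_re_mem_finite (hOan z hz) (V := {b, b', L.re, L'.re}) (by simp) ?_
  filter_upwards [(isOpen_openWideCell P c).mem_nhds hz] with z hz
  by_contra hmem
  simp only [mem_insert_iff, mem_singleton_iff, not_or] at hmem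
  obtain ⟨hwb, hwb', hwL, hwL'⟩ := hmem
  obtain ⟨z', hz', hF⟩ := exists_mem_closedCell_eq hper hz
  refine re_ne_of_isCompact_level (isOpen_openWideCell P c) hOan hFA
    (fun z hz => exists_mem_closedCell_eq hper hz)
    (fun z hz t ht => ⟨by simpa using hz.1, ht.2.1.le, ht.2.2.le⟩)
    (isCompact_re_level (isClosed_closedCell P c) (fun z hz => hz.1) hFA hL hL' hwL hwL')
    (fun y hy hyw => ⟨hy.1.trans_lt (by linarith), hy.2.1.lt_of_ne fun h => ?_,
      hy.2.2.lt_of_ne fun h => ?_⟩) hz' (congrArg re hF)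
  · exact hwb (hyw.symm.trans (hb y h.symm))
  · exact hwb' (hyw.symm.trans (hb' y h.symm))

theorem integral_sq_re_circleMap {q : ℂ → ℂ} {r : ℝ} (hr : 1 < r)
    (hq : DifferentiableOn ℂ q (ball 0 r)) (hq0 : q 0 = 0) {b : ℝ}
    (hb : ∀ ζ, ‖ζ‖ = 1 → (q ζ).im = b) :
    ∫ θ in (0 : ℝ)..(2 * π), (q (circleMap 0 1 θ)).re ^ 2 = -(2 * π * b ^ 2) := by
  set f : ℂ → ℂ := fun ζ => (q ζ - b * I) ^ 2
  have hmean : ∫ θ in (0 : ℝ)..(2 * π), f (circleMap 0 1 θ) = 2 * π * f 0 := by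
    have hf : DiffContOnCl ℂ f (ball 0 |(1 : ℝ)|) := by
      rw [abs_one]
      exact ((hq.sub_const _).pow 2).diffContOnCl_ball (closedBall_subset_ball hr)
    have hpi : (π : ℂ) ≠ 0 := by exact_mod_cast Real.pi_ne_zero
    rw [← hf.circleAverage, Real.circleAverage_def, real_smul]
    push_cast
    field_simp
  have hreal : ∀ θ : ℝ, f (circleMap 0 1 θ) = (((q (circleMap 0 1 θ)).re ^ 2 : ℝ) : ℂ) := by
    intro θ
    have : q (circleMap 0 1 θ) - b * I = ((q (circleMap 0 1 θ)).re : ℂ) := by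
      rw [← hb _ (by simp : ‖circleMap 0 1 θ‖ = 1), sub_eq_iff_eq_add, re_add_im]
    simp only [f, this, ofReal_pow]
  have hf0 : f 0 = ((-b ^ 2 : ℝ) : ℂ) := by
    simp only [f, hq0, zero_sub, neg_sq, mul_pow, I_sq]
    push_cast
    ring
  simp only [hreal] at hmean
  rw [intervalIntegral.integral_ofReal, hf0] at hmean
  rw [← mul_neg]
  exact_mod_cast hmean

theorem eqOn_zero_of_eqOn_sphere {q : ℂ → ℂ} {r : ℝ} (hr : 1 < r)
    (hq : DifferentiableOn ℂ q (ball 0 r)) (hsphere : ∀ ζ, ‖ζ‖ = 1 → q ζ = 0) :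
    EqOn q 0 (ball 0 r) := by
  have hball : ∀ ζ ∈ ball (0 : ℂ) 1, q ζ = 0 := by
    intro ζ hζ
    have hcl : DiffContOnCl ℂ q (ball 0 1) := hq.diffContOnCl_ball (closedBall_subset_ball hr)
    refine norm_le_zero_iff.1 (Complex.norm_le_of_forall_mem_frontier_norm_le isBounded_ball hcl
      (fun z hz => ?_) (subset_closure hζ))
    rw [frontier_ball _ one_ne_zero] at hz
    rw [hsphere z (by simpa using hz), norm_zero]
  refine (hq.analyticOnNhd isOpen_ball).eqOn_zero_of_preconnected_of_eventuallyEq_zero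
    (convex_ball 0 r).isPreconnected (mem_ball_self (by linarith)) ?_
  filter_upwards [ball_mem_nhds (0 : ℂ) one_pos] with ζ hζ using hball ζ hζ

theorem exists_circleMap_eq {ζ : ℂ} (hζ : ‖ζ‖ = 1) :
    ∃ θ ∈ Ioc 0 (2 * π), circleMap 0 1 θ = ζ := by
  have : ζ ∈ circleMap 0 1 '' Ioc 0 (2 * π) := by
    rw [image_circleMap_Ioc, abs_one]
    simpa using hζ
  exact this

theorem eqOn_zero_of_im_const {q : ℂ → ℂ} {r : ℝ} (hr : 1 < r)
    (hq : DifferentiableOn ℂ q (ball 0 r)) (hq0 : q 0 = 0) {b : ℝ}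
    (hb : ∀ ζ, ‖ζ‖ = 1 → (q ζ).im = b) : EqOn q 0 (ball 0 r) := by
  have hint := integral_sq_re_circleMap hr hq hq0 hb
  have hcont : Continuous fun θ : ℝ => (q (circleMap 0 1 θ)).re ^ 2 :=
    (continuous_re.comp (hq.continuousOn.comp_continuous (continuous_circleMap 0 1)
      fun θ => closedBall_subset_ball hr (by simp))).pow 2
  have hnonneg : 0 ≤ ∫ θ in (0 : ℝ)..(2 * π), (q (circleMap 0 1 θ)).re ^ 2 :=
    intervalIntegral.integral_nonneg Real.two_pi_pos.le fun _ _ => sq_nonneg _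
  have hb0 : b = 0 := by
    rw [hint] at hnonneg
    refine pow_eq_zero_iff two_ne_zero |>.1 (le_antisymm ?_ (sq_nonneg b))
    nlinarith [Real.pi_pos]
  have hre : ∀ θ ∈ Icc (0 : ℝ) (2 * π), (q (circleMap 0 1 θ)).re = 0 := by
    intro θ hθ
    by_contra hne
    have hpos : 0 < ∫ θ in (0 : ℝ)..(2 * π), (q (circleMap 0 1 θ)).re ^ 2 :=
      intervalIntegral.integral_pos Real.two_pi_pos hcont.continuousOn
        (fun _ _ => sq_nonneg _) ⟨θ, hθ, by positivity⟩
    rw [hint, hb0] at hpos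
    simp at hpos
  refine eqOn_zero_of_eqOn_sphere hr hq fun ζ hζ => ?_
  obtain ⟨θ, hθ, rfl⟩ := exists_circleMap_eq hζ
  exact Complex.ext (hre θ (Ioc_subset_Icc_self hθ)) ((hb _ hζ).trans hb0)

theorem eq_of_deriv_eq_zero_on_circle {F : ℂ → ℂ} {a : ℂ}
    (hF : ∀ ζ : ℂ, ‖ζ‖ = 1 → DifferentiableAt ℂ F (a + ζ))
    (hF' : ∀ ζ : ℂ, ‖ζ‖ = 1 → deriv F (a + ζ) = 0) {ζ : ℂ} (hζ : ‖ζ‖ = 1) :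
    F (a + ζ) = F (a + 1) := by
  obtain ⟨θ, -, rfl⟩ := exists_circleMap_eq hζ
  have hderiv : ∀ t : ℝ, HasDerivAt (fun t => F (a + circleMap 0 1 t)) 0 t := fun t => by
    have hn : ‖circleMap 0 1 t‖ = 1 := by simp
    have hFt := (hF _ hn).hasDerivAt
    rw [hF' _ hn] at hFt
    simpa only [smul_zero] using! hFt.scomp t ((hasDerivAt_circleMap 0 1 t).const_add a)
  have hone : circleMap 0 1 0 = 1 := by simp [circleMap]
  have hconst := is_const_of_deriv_eq_zero (fun t => (hderiv t).differentiableAt)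
    (fun t => (hderiv t).deriv) θ 0
  rwa [hone] at hconst

theorem deriv_layer_eq_zero_on_circle (h : Radii P c R R') (hP : 2 < P) (hc : 1 < c)
    {p : C(Circle, ℂ)} (hp : IsDensity P c R 0 p) {ζ : ℂ} (hζ : ‖ζ‖ = 1) :
    deriv (layer P c R p) (c + ζ) = 0 := by
  have hfar : wideCell P c ⊆ farSet P c R⁻¹ := wideCell_subset_farSet h.period_pos h.inv_lt_one
  have hright : ∀ z : ℂ, ‖z - c‖ = 1 → (layer P c R p z).re = (regPart P c R p 0).re :=
    fun z hz => by simpa using re_layer_on_circle h (differentiableOn_const 0) hp hz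
  have hleft : ∀ z : ℂ, ‖z + c‖ = 1 → (layer P c R p z).re = -(regPart P c R p 0).re := by
    intro z hz
    have hz' : ‖-z - c‖ = 1 := by rwa [← neg_add', norm_neg]
    rw [← hright (-z) hz', ← neg_neg z,
      layer_neg h p (hfar (circle_subset_wideCell hP hc hz')), neg_re, neg_neg]
  obtain ⟨L, hL⟩ := exists_tendsto_layer_atTop h p
  obtain ⟨L', hL'⟩ := exists_tendsto_layer_atBot h p
  have han : ∀ z ∈ wideCell P c, AnalyticAt ℂ (layer P c R p) z := fun z hz =>
    analyticAt_layer h p (hfar hz)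
  have hcont : ContinuousAt (deriv (layer P c R p)) (c + ζ) :=
    (han _ (circle_subset_wideCell hP hc (by simpa using hζ))).deriv.continuousAt
  have hray : Tendsto (fun t : ℝ => (c : ℂ) + t * ζ) (𝓝[>] 1) (𝓝 (c + ζ)) := by
    have : Continuous fun t : ℝ => (c : ℂ) + t * ζ := by fun_prop
    simpa using (this.tendsto 1).mono_left nhdsWithin_le_nhds
  refine tendsto_nhds_unique (hcont.tendsto.comp hray) (tendsto_const_nhds.congr' ?_)
  have hroom : (1 : ℝ) < min (P - 1) (2 * c - 1) := lt_min (by linarith) (by linarith)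
  filter_upwards [Ioo_mem_nhdsGT hroom] with t ht
  exact (deriv_eq_zero_of_re_const hP (layer_add_period h.period_pos p) han hright hleft hL hL'
    (add_smul_mem_openWideCell hζ ht.1 (ht.2.trans_le (min_le_left _ _))
      (ht.2.trans_le (min_le_right _ _)))).symm

theorem isDensity_zero_eq_zero (h : Radii P c R R') (hP : 2 < P) (hc : 1 < c)
    {p : C(Circle, ℂ)} (hp : IsDensity P c R 0 p) : p = 0 := by
  have hconst : ∀ ζ : ℂ, ‖ζ‖ = 1 → layer P c R p (c + ζ) = layer P c R p (c + 1) := fun ζ hζ =>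
    eq_of_deriv_eq_zero_on_circle (fun ζ hζ => (analyticAt_layer h p
      (wideCell_subset_farSet h.period_pos h.inv_lt_one
        (circle_subset_wideCell hP hc (by simpa using hζ)))).differentiableAt)
      (fun ζ => deriv_layer_eq_zero_on_circle h hP hc hp) hζ
  have hd : DifferentiableOn ℂ (0 : ℂ → ℂ) (ball 0 R') := differentiableOn_const 0
  have hext := eqOn_zero_of_im_const (h.one_lt.trans h.lt) (differentiableOn_extension h hd p)
    (extension_zero 0 p) (b := -(layer P c R p (c + 1) - regPart P c R p 0).im / 2) fun ζ hζ => by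
      rw [← hconst ζ hζ, layer_on_circle h hd hp hζ]
      simp
  ext w
  rw [hp w, hext (mul_circle_mem_ball h w)]
  rfl

end Uniqueness

/-! ### The periodic logarithmic source -/

section LogKernel

/-- The real-linear functional `h ↦ Re (g h)`. -/
def reMul (g : ℂ) : ℂ →L[ℝ] ℝ := reCLM.comp (ContinuousLinearMap.mul ℝ ℂ g)

theorem reMul_apply (g h : ℂ) : reMul g h = (g * h).re := rfl

theorem reMul_injective : Function.Injective reMul := by
  intro a b hab
  have hone := congrArg (fun l : ℂ →L[ℝ] ℝ => l 1) hab
  have hI := congrArg (fun l : ℂ →L[ℝ] ℝ => l I) hab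
  simp only [reMul_apply, mul_one, mul_I_re, neg_inj] at hone hI
  exact Complex.ext hone hI

theorem hasFDerivAt_re_of_hasDerivAt {f : ℂ → ℂ} {f' z : ℂ} (hf : HasDerivAt f f' z) :
    HasFDerivAt (fun z => (f z).re) (reMul f') z := by
  refine (reCLM.hasFDerivAt.comp z (hf.hasFDerivAt.restrictScalars ℝ)).congr_fderiv
    (ContinuousLinearMap.ext fun h => ?_)
  simp [reMul_apply, mul_comm]

theorem hasFDerivAt_log_norm {f : ℂ → ℂ} {f' z : ℂ} (hf : HasDerivAt f f' z) (hz : f z ≠ 0) :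
    HasFDerivAt (fun z => Real.log ‖f z‖) (reMul (f' / f z)) z := by
  have hlog : HasDerivAt (fun w => Complex.log (f w / f z)) (f' / f z) z := by
    have := (hf.div_const (f z)).clog (by rw [div_self hz]; exact one_mem_slitPlane)
    rwa [div_self hz, div_one] at this
  refine ((hasFDerivAt_re_of_hasDerivAt hlog).add_const
    (Real.log ‖f z‖)).congr_of_eventuallyEq ?_
  filter_upwards [hf.continuousAt.eventually_ne hz] with w hw
  rw [log_re, norm_div, Real.log_div (norm_ne_zero_iff.2 hw) (norm_ne_zero_iff.2 hz)]
  ring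

theorem harmonicAt_comp_add_const {f : ℂ → ℝ} {z a : ℂ} (hf : HarmonicAt f (z + a)) :
    HarmonicAt (fun w => f (w + a)) z := by
  obtain ⟨r, hr, hball⟩ := Metric.eventually_nhds_iff_ball.1 hf.eventually
  obtain ⟨F, hF, hFf⟩ := HarmonicOnNhd.exists_analyticOnNhd_ball_re_eq (f := f) hball
  have hF' : AnalyticAt ℂ (fun w => F (w + a)) z :=
    (hF _ (mem_ball_self hr)).fun_comp (f := fun w => w + a) (analyticAt_id.add analyticAt_const)
  refine (harmonicAt_congr_nhds ?_).1 hF'.harmonicAt_re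
  filter_upwards [(continuous_add_const a).tendsto z (ball_mem_nhds _ hr)] with w hw using hFf hw

variable {P : ℝ} {w : ℂ}

/-- The `iP`-periodic fundamental solution `log |2 sinh(πw/P)|`. -/
def logKernel (P : ℝ) (w : ℂ) : ℝ := Real.log ‖expSub P w‖ - π / P * w.re

theorem logKernel_add_period (hP : 0 < P) (w : ℂ) :
    logKernel P (w + P * I) = logKernel P w := by
  rw [logKernel, expSub_add_period hP, logKernel]
  simp

theorem logKernel_neg (hw : expSub P w ≠ 0) : logKernel P (-w) = logKernel P w := by
  rw [logKernel, logKernel, expSub_neg, norm_neg, norm_mul, norm_exp,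
    Real.log_mul (Real.exp_ne_zero _) (norm_ne_zero_iff.2 hw), Real.log_exp, neg_re,
    re_ofReal_mul, neg_re]
  ring

theorem hasFDerivAt_logKernel (hw : expSub P w ≠ 0) :
    HasFDerivAt (logKernel P) (reMul (cothKernel P w)) w := by
  have hlog := hasFDerivAt_log_norm (hasDerivAt_expSub P w) hw
  have hlin : HasFDerivAt (fun w : ℂ => π / P * w.re) ((π / P) • reCLM) w :=
    reCLM.hasFDerivAt.const_mul (π / P)
  refine (hlog.sub hlin).congr_fderiv (ContinuousLinearMap.ext fun h => ?_)
  have hcoth : ((2 * π / P : ℝ) : ℂ) * exp ((2 * π / P : ℝ) * w) / expSub P w =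
      cothKernel P w + (π / P : ℝ) := by
    have hexp : exp ((2 * π / P : ℝ) * w) = expSub P w + 1 := by simp [expSub]
    rw [hexp, cothKernel]
    push_cast
    field_simp
    ring
  rw [hcoth]
  simp only [sub_apply, smul_apply, reMul_apply, add_mul, add_re, re_ofReal_mul, reCLM_apply,
    smul_eq_mul]
  ring

theorem harmonicAt_const_mul_re (a : ℝ) (w : ℂ) : HarmonicAt (fun w : ℂ => a * w.re) w := by
  have han : AnalyticAt ℂ (fun w => (a : ℂ) * w) w := analyticAt_const.mul analyticAt_id
  simpa only [re_ofReal_mul] using han.harmonicAt_re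

theorem harmonicAt_logKernel (hw : expSub P w ≠ 0) : HarmonicAt (logKernel P) w :=
  (((differentiable_expSub P).analyticAt w).harmonicAt_log_norm hw).sub
    (harmonicAt_const_mul_re _ _)

end LogKernel

section RawPotential

variable {P c R R' : ℝ}

/-- The sum of logarithmic sources at `±c + iPℤ` and the potential of the density `p`. -/
def rawPotential (P c R : ℝ) (p : C(Circle, ℂ)) (z : ℂ) : ℝ :=
  -(2 * π)⁻¹ * (logKernel P (z + -c) - logKernel P (z + c)) + (layer P c R p z).re

/-- The complex derivative of `rawPotential`. -/
def rawGrad (P c R : ℝ) (p : C(Circle, ℂ)) (z : ℂ) : ℂ :=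
  ((-(2 * π)⁻¹ : ℝ) : ℂ) * (cothKernel P (z + -c) - cothKernel P (z + c)) +
    deriv (layer P c R p) z

theorem expSub_center_ne_zero (hP : 0 < P) {r : ℝ} (hr : 0 ≤ r) {z : ℂ}
    (hz : z ∈ farSet P c r) : expSub P (z + -c) ≠ 0 ∧ expSub P (z + c) ≠ 0 := by
  simp only [Ne, expSub_eq_zero_iff hP]
  constructor
  · rintro ⟨n, hn⟩
    have hfar := (hz n).1
    rw [← sub_eq_add_neg] at hn
    rw [hn, sub_self, norm_zero] at hfar
    exact hr.not_gt hfar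
  · rintro ⟨n, hn⟩
    have hfar := (hz n).2
    rw [hn, sub_self, norm_zero] at hfar
    exact hr.not_gt hfar

theorem hasFDerivAt_rawPotential (h : Radii P c R R') (p : C(Circle, ℂ)) {z : ℂ}
    (hz : z ∈ farSet P c R⁻¹) :
    HasFDerivAt (rawPotential P c R p) (reMul (rawGrad P c R p z)) z := by
  obtain ⟨hright, hleft⟩ := expSub_center_ne_zero h.period_pos h.inv_pos.le hz
  have hlogR := (hasFDerivAt_comp_add_right (-c : ℂ)).2 (hasFDerivAt_logKernel hright)
  have hlogL := (hasFDerivAt_comp_add_right (c : ℂ)).2 (hasFDerivAt_logKernel hleft)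
  have hlayer :=
    hasFDerivAt_re_of_hasDerivAt (analyticAt_layer h p hz).differentiableAt.hasDerivAt
  refine (((hlogR.sub hlogL).const_mul (-(2 * π)⁻¹)).add hlayer).congr_fderiv
    (ContinuousLinearMap.ext fun v => ?_)
  simp only [rawGrad, reMul_apply, add_apply, smul_apply, sub_apply, smul_eq_mul, add_mul,
    add_re, mul_assoc, re_ofReal_mul, sub_mul, sub_re]

theorem harmonicAt_rawPotential (h : Radii P c R R') (p : C(Circle, ℂ)) {z : ℂ}
    (hz : z ∈ farSet P c R⁻¹) : HarmonicAt (rawPotential P c R p) z := by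
  obtain ⟨hright, hleft⟩ := expSub_center_ne_zero h.period_pos h.inv_pos.le hz
  exact (((harmonicAt_comp_add_const (harmonicAt_logKernel hright)).sub
    (harmonicAt_comp_add_const (harmonicAt_logKernel hleft))).const_smul (c := -(2 * π)⁻¹)).add
    (analyticAt_layer h p hz).harmonicAt_re

theorem rawPotential_add_period (hP : 0 < P) (p : C(Circle, ℂ)) (z : ℂ) :
    rawPotential P c R p (z + P * I) = rawPotential P c R p z := by
  rw [rawPotential, rawPotential, layer_add_period hP, add_right_comm,
    logKernel_add_period hP, add_right_comm, logKernel_add_period hP]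

theorem rawPotential_neg (h : Radii P c R R') (p : C(Circle, ℂ)) {z : ℂ}
    (hz : z ∈ farSet P c R⁻¹) : rawPotential P c R p (-z) = -rawPotential P c R p z := by
  obtain ⟨hright, hleft⟩ := expSub_center_ne_zero h.period_pos h.inv_pos.le hz
  have hnegR : -z + -(c : ℂ) = -(z + c) := by ring
  have hnegL : -z + (c : ℂ) = -(z + -c) := by ring
  rw [rawPotential, rawPotential, layer_neg h p hz, hnegR, hnegL, logKernel_neg hright,
    logKernel_neg hleft, neg_re]
  ring

end RawPotential

section Decay

variable {P c R R' : ℝ}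

theorem expSub_add_ne_zero (hP : 0 < P) {z v : ℂ} (hv : |v.re| < |z.re|) :
    expSub P (z + v) ≠ 0 := by
  refine expSub_ne_zero_of_re_ne_zero hP fun h0 => ?_
  rw [add_re, add_eq_zero_iff_eq_neg] at h0
  rw [h0, abs_neg] at hv
  exact hv.false

theorem exists_norm_deriv_cothKernel_add_le (hP : 0 < P) (A : ℝ) :
    ∃ M, ∀ z v : ℂ, A + 1 ≤ |z.re| → |v.re| ≤ A →
      ‖deriv (cothKernel P) (z + v)‖ ≤ M * Real.exp (-(2 * π / P * |z.re|)) := by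
  refine ⟨(2 * π / P) ^ 2 / (1 - Real.exp (-(2 * π / P))) ^ 2 * Real.exp (2 * π / P * A),
    fun z v hz hv => ?_⟩
  have hre : |z.re| - A ≤ |(z + v).re| := by
    have := abs_sub_abs_le_abs_sub z.re (-v.re)
    rw [abs_neg, sub_neg_eq_add] at this
    rw [add_re]
    linarith
  refine (norm_deriv_cothKernel_le hP (by linarith)).trans ?_
  rw [mul_assoc, ← Real.exp_add]
  gcongr
  have := mul_le_mul_of_nonneg_left hre (by positivity : 0 ≤ 2 * π / P)
  linarith

theorem exists_norm_cothKernel_add_sub_le (hP : 0 < P) (c : ℝ) :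
    ∃ B, ∀ z : ℂ, |c| + 1 ≤ |z.re| → ‖cothKernel P (z + -c) - cothKernel P (z + c)‖ ≤
      B * Real.exp (-(2 * π / P * |z.re|)) := by
  obtain ⟨M, hderiv⟩ := exists_norm_deriv_cothKernel_add_le hP |c|
  refine ⟨M * (2 * |c|), fun z hz => ?_⟩
  have hmem : ∀ w ∈ segment ℝ (c : ℂ) (-c : ℂ), |w.re| ≤ |c| := fun w hw => by
    have hball := (convex_closedBall (0 : ℂ) |c|).segment_subset (x := (c : ℂ)) (y := -c)
      (by simp) (by simp) hw
    exact (abs_re_le_norm w).trans (by simpa using hball)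
  have hmvt := (convex_segment (c : ℂ) (-c)).norm_image_sub_le_of_norm_hasDerivWithin_le
    (f := fun w => cothKernel P (z + w)) (f' := fun w => deriv (cothKernel P) (z + w))
    (fun w hw => ((hasDerivAt_cothKernel (expSub_add_ne_zero hP
      (by linarith [hmem w hw]))).differentiableAt.hasDerivAt.comp_const_add z w).hasDerivWithinAt)
    (fun w hw => hderiv z w hz (hmem w hw)) (left_mem_segment _ _ _) (right_mem_segment _ _ _)
  refine hmvt.trans (le_of_eq ?_)
  have hdiff : -(c : ℂ) - c = ((-(2 * c) : ℝ) : ℂ) := by push_cast; ring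
  rw [hdiff, norm_real, Real.norm_eq_abs, abs_neg, abs_mul, abs_two]
  ring

theorem exists_norm_integral_deriv_cothKernel_le (hP : 0 < P) {m s : ℝ → ℂ} (hm : Continuous m)
    {A : ℝ} (hs : ∀ θ, |(s θ).re| ≤ A) (a b : ℝ) :
    ∃ B, ∀ z : ℂ, A + 1 ≤ |z.re| → ‖∫ θ in a..b, m θ * deriv (cothKernel P) (z + s θ)‖ ≤
      B * Real.exp (-(2 * π / P * |z.re|)) := by
  obtain ⟨D, hD⟩ := isCompact_uIcc.exists_bound_of_continuousOn (s := uIcc a b) hm.continuousOn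
  obtain ⟨M, hderiv⟩ := exists_norm_deriv_cothKernel_add_le hP A
  refine ⟨D * M * |b - a|, fun z hz => ?_⟩
  calc ‖∫ θ in a..b, m θ * deriv (cothKernel P) (z + s θ)‖
      ≤ D * (M * Real.exp (-(2 * π / P * |z.re|))) * |b - a| := by
        refine intervalIntegral.norm_integral_le_of_norm_le_const fun θ hθ => ?_
        have hDθ := hD θ (uIoc_subset_uIcc hθ)
        rw [norm_mul]
        exact mul_le_mul hDθ (hderiv z _ hz (hs θ)) (norm_nonneg _) ((norm_nonneg _).trans hDθ)
    _ = D * M * |b - a| * Real.exp (-(2 * π / P * |z.re|)) := by ring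

theorem exists_norm_deriv_layer_le (h : Radii P c R R') (p : C(Circle, ℂ)) :
    ∃ B, ∀ z : ℂ, |c| + 1 + 1 ≤ |z.re| → ‖deriv (layer P c R p) z‖ ≤
      B * Real.exp (-(2 * π / P * |z.re|)) := by
  have hre : ∀ θ, |((c : ℂ) + circleMap 0 R⁻¹ θ).re| ≤ |c| + 1 := fun θ => by
    refine (abs_re_le_norm _).trans ((norm_add_le _ _).trans ?_)
    rw [norm_circleMap_inv h, norm_real, Real.norm_eq_abs]
    linarith [h.inv_lt_one]
  obtain ⟨B₁, hB₁⟩ := exists_norm_integral_deriv_cothKernel_le h.period_pos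
    (continuous_density R p) (s := fun θ => -(c + circleMap 0 R⁻¹ θ))
    (fun θ => by rw [neg_re, abs_neg]; exact hre θ) 0 (2 * π)
  obtain ⟨B₂, hB₂⟩ := exists_norm_integral_deriv_cothKernel_le h.period_pos
    (continuous_density R p) hre 0 (2 * π)
  refine ⟨‖(2 * π : ℂ)⁻¹‖ * (B₁ + B₂), fun z hz => ?_⟩
  rw [deriv_layer h p (mem_farSet_of_abs_re h.inv_lt_one.le (by linarith)), norm_mul, mul_assoc,
    add_mul]
  gcongr
  exact (norm_add_le _ _).trans (add_le_add (hB₁ z hz) (hB₂ z hz))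

theorem exists_norm_rawGrad_le (h : Radii P c R R') (p : C(Circle, ℂ)) :
    ∃ B X, ∀ z : ℂ, X ≤ |z.re| →
      ‖rawGrad P c R p z‖ ≤ B * Real.exp (-(2 * π / P * |z.re|)) := by
  obtain ⟨B₁, hB₁⟩ := exists_norm_cothKernel_add_sub_le h.period_pos c
  obtain ⟨B₂, hB₂⟩ := exists_norm_deriv_layer_le h p
  refine ⟨‖((-(2 * π)⁻¹ : ℝ) : ℂ)‖ * B₁ + B₂, |c| + 1 + 1, fun z hz => ?_⟩
  rw [rawGrad, add_mul, mul_assoc]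
  refine (norm_add_le _ _).trans (add_le_add ?_ (hB₂ z hz))
  rw [norm_mul]
  gcongr
  exact hB₁ z (by linarith)

end Decay

section CircleData

variable {P c R R' : ℝ}

/-- The regular part, in the disk around `c`, of the logarithmic sources. -/
def regLog (P c : ℝ) (ζ : ℂ) : ℝ :=
  -(2 * π)⁻¹ * (Real.log ‖expQuot P ζ‖ - π / P * ζ.re - logKernel P (ζ + 2 * c))

theorem harmonicAt_regLog (h : Radii P c R R') {ζ : ℂ} (hζ : ζ ∈ ball (0 : ℂ) R') :
    HarmonicAt (regLog P c) ζ := by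
  rw [mem_ball_zero_iff] at hζ
  have hlog : HarmonicAt (fun w => Real.log ‖expQuot P w‖) ζ :=
    ((differentiable_expQuot P).analyticAt ζ).harmonicAt_log_norm
      (expQuot_ne_zero h.period_pos (by linarith [h.lt_period, h.inv_pos]))
  have hne : expSub P (ζ + 2 * c) ≠ 0 := by
    refine expSub_ne_zero_of_re_ne_zero h.period_pos (ne_of_gt ?_)
    have hre := (abs_le.1 ((abs_re_le_norm ζ).trans hζ.le)).1
    have hadd : (ζ + 2 * c).re = ζ.re + 2 * c := by simp
    rw [hadd]
    linarith [h.lt_gap, h.inv_pos]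
  exact ((hlog.sub (harmonicAt_const_mul_re _ _)).sub
    (harmonicAt_comp_add_const (harmonicAt_logKernel hne))).const_smul (c := -(2 * π)⁻¹)

theorem rawPotential_center_add (h : Radii P c R R') (p : C(Circle, ℂ)) {ζ : ℂ} (h0 : ζ ≠ 0)
    (hζ : ζ ∈ ball (0 : ℂ) R') : rawPotential P c R p (c + ζ) =
      -(2 * π)⁻¹ * Real.log ‖ζ‖ + (regLog P c ζ + (layer P c R p (c + ζ)).re) := by
  rw [mem_ball_zero_iff] at hζ
  have hne := expQuot_ne_zero h.period_pos (w := ζ) (by linarith [h.lt_period, h.inv_pos])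
  have hright : (c : ℂ) + ζ + -c = ζ := by ring
  have hleft : (c : ℂ) + ζ + c = ζ + 2 * c := by ring
  rw [rawPotential, hright, hleft, regLog, logKernel, expSub_eq_mul_expQuot, norm_mul,
    Real.log_mul (norm_ne_zero_iff.2 h0) (norm_ne_zero_iff.2 hne)]
  ring

theorem exists_radii (hP : 2 < P) (hc : 1 < c) : ∃ R R', Radii P c R R' := by
  have hm : 0 < min (P - 2) (2 * c - 2) := lt_min (by linarith) (by linarith)
  set m := min (P - 2) (2 * c - 2)
  have hmP : m ≤ P - 2 := min_le_left _ _
  have hmc : m ≤ 2 * c - 2 := min_le_right _ _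
  have hinv : (1 + m / 2)⁻¹ < 1 := inv_lt_one_of_one_lt₀ (by linarith)
  exact ⟨1 + m / 2, 1 + m, by linarith, by linarith, by linarith, by linarith⟩

theorem integral_deriv_mul_circleMap {f f' : ℂ → ℂ}
    (hf : ∀ ζ ∈ sphere (0 : ℂ) 1, HasDerivAt f (f' ζ) ζ) :
    ∫ θ in (0 : ℝ)..(2 * π), f' (circleMap 0 1 θ) * circleMap 0 1 θ = 0 := by
  have hcircle := circleIntegral.integral_eq_zero_of_hasDerivWithinAt (c := 0) (R := 1)
    zero_le_one fun z hz => (hf z hz).hasDerivWithinAt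
  have hpt : ∀ θ : ℝ, deriv (circleMap 0 1) θ • f' (circleMap 0 1 θ) =
      I * (f' (circleMap 0 1 θ) * circleMap 0 1 θ) := fun θ => by
    rw [deriv_circleMap, smul_eq_mul]
    ring
  simp only [circleIntegral, hpt, intervalIntegral.integral_const_mul] at hcircle
  exact (mul_eq_zero.1 hcircle).resolve_left I_ne_zero

theorem integral_re_source_add_deriv_mul_circleMap {f : ℂ → ℂ}
    (hf : AnalyticOnNhd ℂ f (sphere 0 1)) (a : ℝ) :
    ∫ θ in (0 : ℝ)..(2 * π),
      ((a * (circleMap 0 1 θ)⁻¹ + deriv f (circleMap 0 1 θ)) * circleMap 0 1 θ).re =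
      2 * π * a := by
  have hpt : ∀ θ : ℝ,
      ((a * (circleMap 0 1 θ)⁻¹ + deriv f (circleMap 0 1 θ)) * circleMap 0 1 θ).re =
      a + (deriv f (circleMap 0 1 θ) * circleMap 0 1 θ).re := fun θ => by
    rw [add_mul, mul_assoc, inv_mul_cancel₀ (circleMap_ne_center one_ne_zero), mul_one, add_re,
      ofReal_re]
  have hcont : Continuous fun θ : ℝ => deriv f (circleMap 0 1 θ) * circleMap 0 1 θ :=
    (hf.deriv.continuousOn.comp_continuous (continuous_circleMap 0 1) fun θ => by simp).mul
      (continuous_circleMap 0 1)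
  have hcont_re : Continuous fun θ : ℝ => (deriv f (circleMap 0 1 θ) * circleMap 0 1 θ).re :=
    continuous_re.comp hcont
  have hre : ∫ θ in (0 : ℝ)..(2 * π), (deriv f (circleMap 0 1 θ) * circleMap 0 1 θ).re = 0 := by
    have hcomm := reCLM.intervalIntegral_comp_comm (μ := volume)
      (hcont.intervalIntegrable 0 (2 * π))
    rw [integral_deriv_mul_circleMap fun ζ hζ => (hf ζ hζ).differentiableAt.hasDerivAt] at hcomm
    simpa using hcomm
  simp only [hpt]
  rw [intervalIntegral.integral_add intervalIntegrable_const
    (hcont_re.intervalIntegrable _ _), hre, intervalIntegral.integral_const]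
  simp

theorem rawGrad_center_add (h : Radii P c R R') (p : C(Circle, ℂ)) {d : ℂ → ℂ}
    (hd : DifferentiableOn ℂ d (ball 0 R'))
    (hdre : EqOn (fun z => (d z).re) (regLog P c) (ball 0 R')) {ζ : ℂ} (h0 : ζ ≠ 0)
    (hball : ζ ∈ ball (0 : ℂ) R') (hfar : (c : ℂ) + ζ ∈ farSet P c R⁻¹) :
    rawGrad P c R p (c + ζ) = ((-(2 * π)⁻¹ : ℝ) : ℂ) * ζ⁻¹ +
      deriv (fun ζ => d ζ + layer P c R p (c + ζ)) ζ := by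
  have hdiff : DifferentiableAt ℂ (fun ζ => d ζ + layer P c R p (c + ζ)) ζ :=
    (hd.differentiableAt (isOpen_ball.mem_nhds hball)).add
      ((analyticAt_layer h p hfar).differentiableAt.hasDerivAt.comp_const_add _ _).differentiableAt
  have hraw := (hasFDerivAt_comp_add_left (c : ℂ)).2 (hasFDerivAt_rawPotential h p hfar)
  have hsum := ((hasFDerivAt_log_norm (hasDerivAt_id ζ) h0).const_mul (-(2 * π)⁻¹)).add
    (hasFDerivAt_re_of_hasDerivAt hdiff.hasDerivAt)
  refine reMul_injective ((hraw.congr_of_eventuallyEq ?_).unique (hsum.congr_fderiv ?_))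
  · filter_upwards [isOpen_ball.mem_nhds hball, isOpen_ne.mem_nhds h0] with w hw hw0
    simp only [Pi.add_apply, id, rawPotential_center_add h p hw0 hw, ← hdre hw, add_re]
  · refine ContinuousLinearMap.ext fun v => ?_
    simp only [add_apply, smul_apply, reMul_apply, smul_eq_mul, add_mul, mul_assoc, add_re,
      re_ofReal_mul, one_div, id]

theorem integral_re_rawGrad_mul (h : Radii P c R R') (hP : 2 < P) (hc : 1 < c)
    (p : C(Circle, ℂ)) {d : ℂ → ℂ} (hd : DifferentiableOn ℂ d (ball 0 R'))
    (hdre : EqOn (fun z => (d z).re) (regLog P c) (ball 0 R')) :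
    ∫ θ in (0 : ℝ)..(2 * π), (rawGrad P c R p (circleMap c 1 θ) * (circleMap c 1 θ - c)).re =
      -1 := by
  have hfar : ∀ ζ : ℂ, ‖ζ‖ = 1 → (c : ℂ) + ζ ∈ farSet P c R⁻¹ := fun ζ hζ =>
    wideCell_subset_farSet h.period_pos h.inv_lt_one
      (circle_subset_wideCell hP hc (by simpa using hζ))
  have hball : ∀ ζ : ℂ, ‖ζ‖ = 1 → ζ ∈ ball (0 : ℂ) R' := fun ζ hζ => by
    rw [mem_ball_zero_iff, hζ]
    exact h.one_lt.trans h.lt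
  have hpt : ∀ θ : ℝ, rawGrad P c R p (circleMap c 1 θ) * (circleMap c 1 θ - c) =
      (((-(2 * π)⁻¹ : ℝ) : ℂ) * (circleMap 0 1 θ)⁻¹ +
        deriv (fun ζ => d ζ + layer P c R p (c + ζ)) (circleMap 0 1 θ)) * circleMap 0 1 θ := by
    intro θ
    have hn : ‖circleMap 0 1 θ‖ = 1 := by simp
    have hcm : circleMap (c : ℂ) 1 θ = c + circleMap 0 1 θ := by simp [circleMap]
    rw [hcm, add_sub_cancel_left, rawGrad_center_add h p hd hdre
      (circleMap_ne_center one_ne_zero) (hball _ hn) (hfar _ hn)]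
  have han : AnalyticOnNhd ℂ (fun ζ => d ζ + layer P c R p (c + ζ)) (sphere 0 1) := fun ζ hζ => by
    rw [mem_sphere_zero_iff_norm] at hζ
    exact ((hd.analyticOnNhd isOpen_ball) ζ (hball ζ hζ)).add ((analyticAt_layer h p
      (hfar ζ hζ)).fun_comp (f := fun w => (c : ℂ) + w) (analyticAt_const.add analyticAt_id))
  simp only [hpt, integral_re_source_add_deriv_mul_circleMap han]
  field_simp

end CircleData

/-! ### The periodic potential -/

/-- A periodic potential, odd under `z ↦ -z`, outside the unit disks around `±c + iPℤ`, with
the value `b` on the circle around `c`. Its differential is `h ↦ Re (g h)`. -/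
structure PeriodicPotential (P c : ℝ) (φ : ℂ → ℝ) (g : ℂ → ℂ) (b : ℝ) : Prop where
  harmonic : ∀ z ∈ wideCell P c, HarmonicAt φ z
  hasFDerivAt : ∀ z ∈ wideCell P c, HasFDerivAt φ (reMul (g z)) z
  periodic : ∀ z, φ (z + P * I) = φ z
  odd : ∀ z ∈ wideCell P c, φ (-z) = -φ z
  value : ∀ z : ℂ, ‖z - c‖ = 1 → φ z = b
  flux : ∫ θ in (0 : ℝ)..(2 * π), (g (circleMap c 1 θ) * (circleMap c 1 θ - c)).re = -1
  decay : ∃ B X, ∀ z : ℂ, X ≤ |z.re| → ‖g z‖ ≤ B * Real.exp (-(2 * π / P * |z.re|))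

section Symmetrize

variable {P c : ℝ}

theorem exists_periodicPotential (hP : 2 < P) (hc : 1 < c) :
    ∃ φ g b, PeriodicPotential P c φ g b := by
  obtain ⟨R, R', h⟩ := exists_radii hP hc
  obtain ⟨d, hd, hdre⟩ := HarmonicOnNhd.exists_analyticOnNhd_ball_re_eq (f := regLog P c) (z := 0)
    (R := R') fun ζ hζ => harmonicAt_regLog h hζ
  obtain ⟨p, hp⟩ :=
    exists_isDensity h (fun p => isDensity_zero_eq_zero h hP hc) hd.differentiableOn
  have hfar : wideCell P c ⊆ farSet P c R⁻¹ := wideCell_subset_farSet h.period_pos h.inv_lt_one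
  refine ⟨rawPotential P c R p, rawGrad P c R p, (d 0 + regPart P c R p 0).re,
    { harmonic := fun z hz => harmonicAt_rawPotential h p (hfar hz)
      hasFDerivAt := fun z hz => hasFDerivAt_rawPotential h p (hfar hz)
      periodic := rawPotential_add_period h.period_pos p
      odd := fun z hz => rawPotential_neg h p (hfar hz)
      value := fun z hz => ?_
      flux := integral_re_rawGrad_mul h hP hc p hd.differentiableOn hdre
      decay := exists_norm_rawGrad_le h p }⟩
  have h0 : z - c ≠ 0 := norm_ne_zero_iff.1 (by rw [hz]; exact one_ne_zero)
  have hball : z - c ∈ ball (0 : ℂ) R' := by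
    rw [mem_ball_zero_iff, hz]
    exact h.one_lt.trans h.lt
  have hvalue := rawPotential_center_add h p h0 hball
  rwa [hz, Real.log_one, mul_zero, zero_add, ← hdre hball, add_comm (d (z - c)).re,
    re_layer_on_circle h hd.differentiableOn hp hz, add_sub_cancel] at hvalue

theorem harmonicAt_comp_conj {f : ℂ → ℝ} {z : ℂ} (hf : HarmonicAt f (conj z)) :
    HarmonicAt (fun w => f (conj w)) z := by
  obtain ⟨r, hr, hball⟩ := Metric.eventually_nhds_iff_ball.1 hf.eventually
  obtain ⟨F, hF, hFf⟩ := HarmonicOnNhd.exists_analyticOnNhd_ball_re_eq (f := f) hball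
  have hnhds : ∀ᶠ w in 𝓝 z, conj w ∈ ball (conj z) r :=
    continuous_conj.tendsto z (ball_mem_nhds _ hr)
  have hanalytic : AnalyticAt ℂ (fun w => conj (F (conj w))) z := by
    rw [analyticAt_iff_eventually_differentiableAt]
    filter_upwards [hnhds] with w hw
    have hconj := (hF _ hw).differentiableAt.hasDerivAt.conj_conj
    rw [conj_conj] at hconj
    exact hconj.differentiableAt
  refine (harmonicAt_congr_nhds ?_).1 hanalytic.harmonicAt_re
  filter_upwards [hnhds] with w hw
  rw [conj_re]
  exact hFf hw

theorem norm_conj_sub_ofReal (z : ℂ) (c : ℝ) : ‖conj z - c‖ = ‖z - c‖ := by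
  rw [← RCLike.norm_conj, map_sub, conj_conj, conj_ofReal]

theorem norm_conj_add_ofReal (z : ℂ) (c : ℝ) : ‖conj z + c‖ = ‖z + c‖ := by
  rw [← RCLike.norm_conj, map_add, conj_conj, conj_ofReal]

theorem conj_mem_wideCell {z : ℂ} (hz : z ∈ wideCell P c) : conj z ∈ wideCell P c :=
  ⟨by simpa using hz.1, by rw [norm_conj_sub_ofReal]; exact hz.2.1,
    by rw [norm_conj_add_ofReal]; exact hz.2.2⟩

theorem complexPartial_eq_of_hasFDerivAt {φ : ℂ → ℝ} {g z : ℂ} (h : HasFDerivAt φ (reMul g) z) :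
    (fderiv ℝ φ z 1 : ℂ) - I * fderiv ℝ φ z I = g := by
  rw [h.fderiv, reMul_apply, reMul_apply, mul_one, mul_I_re]
  apply Complex.ext <;> simp

namespace PeriodicPotential

variable {φ φ₁ φ₂ : ℂ → ℝ} {g g₁ g₂ : ℂ → ℂ} {b : ℝ}

theorem continuousOn_grad (h : PeriodicPotential P c φ g b) : ContinuousOn g (wideCell P c) :=
  fun z hz => (HarmonicAt.analyticAt_complex_partial
    (h.harmonic z hz)).continuousAt.continuousWithinAt.congr
    (fun w hw => (complexPartial_eq_of_hasFDerivAt (h.hasFDerivAt w hw)).symm)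
    (complexPartial_eq_of_hasFDerivAt (h.hasFDerivAt z hz)).symm

theorem continuous_flux (h : PeriodicPotential P c φ g b) (hP : 2 < P) (hc : 1 < c) :
    Continuous fun θ => (g (circleMap c 1 θ) * (circleMap c 1 θ - c)).re :=
  continuous_re.comp ((h.continuousOn_grad.comp_continuous (continuous_circleMap _ _)
    fun θ => circle_subset_wideCell hP hc (by simp [circleMap])).mul
      ((continuous_circleMap _ _).sub continuous_const))

theorem comp_conj (h : PeriodicPotential P c φ g b) :
    PeriodicPotential P c (fun z => φ (conj z)) (fun z => conj (g (conj z))) b where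
  harmonic z hz := harmonicAt_comp_conj (h.harmonic _ (conj_mem_wideCell hz))
  hasFDerivAt z hz := by
    refine ((h.hasFDerivAt _ (conj_mem_wideCell hz)).comp z
      (conjCLE.toContinuousLinearMap.hasFDerivAt (x := z))).congr_fderiv
      (ContinuousLinearMap.ext fun v => ?_)
    rw [reMul_apply, ← conj_re, map_mul, conj_conj]
    rfl
  periodic z := by
    have hshift : conj (z + P * I) + P * I = conj z := by simp
    rw [← h.periodic (conj (z + P * I)), hshift]
  odd z hz := by rw [map_neg, h.odd _ (conj_mem_wideCell hz)]
  value z hz := h.value _ (by rwa [norm_conj_sub_ofReal])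
  flux := by
    set f : ℝ → ℝ := fun θ => (g (circleMap c 1 θ) * (circleMap c 1 θ - c)).re
    have hpt : ∀ θ : ℝ, (conj (g (conj (circleMap (c : ℂ) 1 θ))) * (circleMap c 1 θ - c)).re =
        f (-θ) := fun θ => by
      rw [← conj_re, map_mul, conj_conj, map_sub, conj_ofReal, conj_circleMap, conj_ofReal]
    have hper : Function.Periodic f (2 * π) := fun θ => by
      simp only [f, periodic_circleMap (c : ℂ) 1 θ]
    simp only [hpt]
    have hshift := hper.intervalIntegral_add_eq (-(2 * π)) 0
    rw [neg_add_cancel, zero_add] at hshift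
    rw [intervalIntegral.integral_comp_neg, neg_zero, hshift]
    exact h.flux
  decay := by
    obtain ⟨B, X, hB⟩ := h.decay
    refine ⟨B, X, fun z hz => ?_⟩
    rw [RCLike.norm_conj, ← conj_re]
    exact hB _ (by rwa [conj_re])

theorem midpoint (h₁ : PeriodicPotential P c φ₁ g₁ b) (h₂ : PeriodicPotential P c φ₂ g₂ b)
    (hP : 2 < P) (hc : 1 < c) :
    PeriodicPotential P c (fun z => (2 : ℝ)⁻¹ * (φ₁ z + φ₂ z))
      (fun z => ((2 : ℝ)⁻¹ : ℝ) * (g₁ z + g₂ z)) b where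
  harmonic z hz := ((h₁.harmonic z hz).add (h₂.harmonic z hz)).const_smul (c := (2 : ℝ)⁻¹)
  hasFDerivAt z hz := by
    refine (((h₁.hasFDerivAt z hz).add (h₂.hasFDerivAt z hz)).const_mul (2 : ℝ)⁻¹).congr_fderiv
      (ContinuousLinearMap.ext fun v => ?_)
    simp only [smul_apply, add_apply, reMul_apply, smul_eq_mul, mul_assoc, re_ofReal_mul, add_mul,
      add_re]
  periodic z := by rw [h₁.periodic, h₂.periodic]
  odd z hz := by
    rw [h₁.odd z hz, h₂.odd z hz]
    ring
  value z hz := by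
    rw [h₁.value z hz, h₂.value z hz]
    ring
  flux := by
    simp only [mul_assoc, re_ofReal_mul, add_mul, add_re]
    rw [intervalIntegral.integral_const_mul, intervalIntegral.integral_add
      ((h₁.continuous_flux hP hc).intervalIntegrable _ _)
      ((h₂.continuous_flux hP hc).intervalIntegrable _ _), h₁.flux, h₂.flux]
    norm_num
  decay := by
    obtain ⟨B₁, X₁, hB₁⟩ := h₁.decay
    obtain ⟨B₂, X₂, hB₂⟩ := h₂.decay
    refine ⟨2⁻¹ * (B₁ + B₂), max X₁ X₂, fun z hz => ?_⟩
    rw [norm_mul, norm_real, norm_inv, Real.norm_two, mul_assoc, add_mul]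
    gcongr
    exact (norm_add_le _ _).trans (add_le_add (hB₁ z ((le_max_left _ _).trans hz))
      (hB₂ z ((le_max_right _ _).trans hz)))

end PeriodicPotential

theorem exists_periodicPotential_conj_eq (hP : 2 < P) (hc : 1 < c) :
    ∃ φ g b, PeriodicPotential P c φ g b ∧ ∀ z, φ (conj z) = φ z := by
  obtain ⟨φ, g, b, h⟩ := exists_periodicPotential hP hc
  exact ⟨_, _, b, h.midpoint h.comp_conj hP hc, fun z => by simp only [conj_conj, add_comm]⟩

end Symmetrize

/-! ### Geometry of the period cell -/

section InteriorDisk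

/-- The interior disk condition: `z` lies on the boundary of an open disk of positive radius
contained in `S`. It yields unique differentiability at boundary points of `S`. -/
def HasInteriorDisk (S : Set ℂ) (z : ℂ) : Prop := ∃ w ≠ z, ball w (dist z w) ⊆ S

theorem hasInteriorDisk_of_dist_eq {S : Set ℂ} {z w : ℂ} {t : ℝ} (ht : 0 < t) (hd : dist z w = t)
    (hS : ball w t ⊆ S) : HasInteriorDisk S z :=
  ⟨w, fun hwz => ht.ne (by rw [← hd, hwz, dist_self]), hd.symm ▸ hS⟩

theorem hasInteriorDisk_of_isOpen {S : Set ℂ} (hS : IsOpen S) {z : ℂ} (hz : z ∈ S) :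
    HasInteriorDisk S z := by
  obtain ⟨r, hr, hball⟩ := Metric.isOpen_iff.1 hS z hz
  have hd : dist z (z + (r / 2 : ℝ)) = r / 2 := by
    rw [dist_eq_norm, sub_add_cancel_left, norm_neg, norm_real, Real.norm_of_nonneg (by positivity)]
  refine hasInteriorDisk_of_dist_eq (half_pos hr) hd ((ball_subset_ball' ?_).trans hball)
  rw [dist_comm, hd, add_halves]

namespace HasInteriorDisk

variable {S T : Set ℂ} {z : ℂ}

theorem mem_closure_ball {w : ℂ} (hw : w ≠ z) : z ∈ closure (ball w (dist z w)) := by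
  rw [closure_ball _ (dist_ne_zero.2 hw.symm)]
  exact mem_closedBall.2 le_rfl

theorem mem_closure (h : HasInteriorDisk S z) : z ∈ closure S := by
  obtain ⟨w, hw, hS⟩ := h
  exact closure_mono hS (mem_closure_ball hw)

theorem uniqueDiffWithinAt (h : HasInteriorDisk S z) : UniqueDiffWithinAt ℝ S z := by
  obtain ⟨w, hw, hS⟩ := h
  refine (uniqueDiffWithinAt_convex (convex_ball w _) ?_ (mem_closure_ball hw)).mono hS
  rw [isOpen_ball.interior_eq]
  exact nonempty_ball.2 (dist_pos.2 hw.symm)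

theorem neg (hS : ∀ w ∈ S, -w ∈ S) (h : HasInteriorDisk S (-z)) : HasInteriorDisk S z := by
  obtain ⟨w, hw, hball⟩ := h
  refine ⟨-w, fun hwz => hw (by rw [← hwz, neg_neg]), fun x hx => ?_⟩
  rw [mem_ball, ← dist_neg_neg, ← dist_neg_neg z, neg_neg] at hx
  simpa using hS _ (hball hx)

end HasInteriorDisk

end InteriorDisk

section CellGeometry

variable {P c : ℝ} {z : ℂ}

theorem norm_neg_sub_ofReal (z : ℂ) (c : ℝ) : ‖-z - c‖ = ‖z + c‖ := by
  rw [← norm_neg, neg_sub, sub_neg_eq_add, add_comm]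

theorem norm_neg_add_ofReal (z : ℂ) (c : ℝ) : ‖-z + c‖ = ‖z - c‖ := by
  rw [← norm_neg, neg_add, neg_neg, ← sub_eq_add_neg]

theorem neg_mem_openCell (hz : z ∈ openCell P c) : -z ∈ openCell P c :=
  ⟨by simpa using hz.1, by rw [norm_neg_sub_ofReal]; exact hz.2.2,
    by rw [norm_neg_add_ofReal]; exact hz.2.1⟩

theorem neg_mem_closedCell (hz : z ∈ closedCell P c) : -z ∈ closedCell P c :=
  ⟨by simpa using hz.1, by rw [norm_neg_sub_ofReal]; exact hz.2.2,
    by rw [norm_neg_add_ofReal]; exact hz.2.1⟩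

theorem ball_subset_openCell (hz : ‖z - c‖ = 1) {t : ℝ} (ht : 0 < t) (htP : 4 * t ≤ P - 2)
    (htc : 4 * t ≤ 2 * c - 2) : ball (z + t * (z - c)) t ⊆ openCell P c := by
  have him := abs_im_le_norm (z - c)
  have hre := abs_re_le_norm (z - c)
  simp only [hz, sub_im, ofReal_im, sub_zero, sub_re, ofReal_re, abs_le] at him hre
  set w := z + t * (z - c) with hw
  have hwim : w.im = (1 + t) * z.im := by simp [hw]; ring
  have hwre : w.re = c + (1 + t) * (z.re - c) := by simp [hw]; ring
  have hwc : ‖w - c‖ = 1 + t := by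
    have hsub : w - c = ((1 + t : ℝ) : ℂ) * (z - c) := by rw [hw]; push_cast; ring
    rw [hsub, norm_mul, hz, mul_one, norm_real, Real.norm_of_nonneg (by linarith)]
  intro x hx
  rw [mem_ball, dist_eq_norm] at hx
  have hxim := (abs_im_le_norm (x - w)).trans_lt hx
  have hxre := (abs_re_le_norm (x - w)).trans_lt hx
  rw [sub_im, abs_lt] at hxim
  rw [sub_re, abs_lt] at hxre
  refine ⟨abs_lt.2 ⟨by nlinarith, by nlinarith⟩, ?_, lt_of_lt_of_le ?_ (re_le_norm _)⟩
  · have htri := norm_sub_norm_le (w - c) (w - x)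
    rw [sub_sub_sub_cancel_left, hwc, norm_sub_rev w x] at htri
    linarith
  · rw [add_re, ofReal_re]
    nlinarith

theorem hasInteriorDisk_openCell_of_norm_sub (hP : 2 < P) (hc : 1 < c) (hz : ‖z - c‖ = 1) :
    HasInteriorDisk (openCell P c) z := by
  have hm : 0 < min (P - 2) (2 * c - 2) := lt_min (by linarith) (by linarith)
  set t := min (P - 2) (2 * c - 2) / 4 with ht
  have ht0 : 0 < t := by positivity
  have ht4 : 4 * t = min (P - 2) (2 * c - 2) := by rw [ht]; ring
  refine hasInteriorDisk_of_dist_eq ht0 ?_ (ball_subset_openCell hz ht0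
    (ht4.trans_le (min_le_left _ _)) (ht4.trans_le (min_le_right _ _)))
  rw [dist_eq_norm, sub_add_cancel_left, norm_neg, norm_mul, hz, mul_one, norm_real,
    Real.norm_of_nonneg ht0.le]

theorem hasInteriorDisk_openCell_of_im (hP : 2 < P) (hz : z.im = P / 2) :
    HasInteriorDisk (openCell P c) z := by
  set t := (P - 2) / 4 with ht
  have ht0 : 0 < t := by rw [ht]; linarith
  refine hasInteriorDisk_of_dist_eq (w := z - t * I) ht0 ?_ fun x hx => ?_
  · rw [dist_eq_norm, sub_sub_cancel, norm_mul, norm_I, mul_one, norm_real,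
      Real.norm_of_nonneg ht0.le]
  · rw [mem_ball, dist_eq_norm] at hx
    have him := (abs_im_le_norm _).trans_lt hx
    simp only [sub_im, mul_im, ofReal_re, I_im, mul_one, ofReal_im, I_re, mul_zero, add_zero,
      hz, abs_lt] at him
    have hone : 1 < |x.im| := lt_of_lt_of_le (by linarith) (le_abs_self _)
    exact ⟨abs_lt.2 ⟨by linarith, by linarith⟩, hone.trans_le (norm_sub_ge_abs_im x c),
      hone.trans_le (norm_add_ge_abs_im x c)⟩

theorem hasInteriorDisk_openCell (hP : 2 < P) (hc : 1 < c) (hz : z ∈ closedCell P c) :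
    HasInteriorDisk (openCell P c) z := by
  have hneg : HasInteriorDisk (openCell P c) (-z) → HasInteriorDisk (openCell P c) z :=
    HasInteriorDisk.neg fun _ => neg_mem_openCell
  obtain ⟨him, hright, hleft⟩ := hz
  rcases hright.eq_or_lt with hright' | hright'
  · exact hasInteriorDisk_openCell_of_norm_sub hP hc hright'.symm
  rcases hleft.eq_or_lt with hleft' | hleft'
  · exact hneg (hasInteriorDisk_openCell_of_norm_sub hP hc (by rw [norm_neg_sub_ofReal, hleft']))
  rcases him.eq_or_lt with him' | him'
  · rcases abs_choice z.im with habs | habs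
    · exact hasInteriorDisk_openCell_of_im hP (by rw [← habs, him'])
    · exact hneg (hasInteriorDisk_openCell_of_im hP (by rw [neg_im, ← habs, him']))
  · exact hasInteriorDisk_of_isOpen (isOpen_openCell P c) ⟨him', hright', hleft'⟩

theorem closure_openCell (hP : 2 < P) (hc : 1 < c) : closure (openCell P c) = closedCell P c :=
  (closure_minimal (openCell_subset_closedCell P c) (isClosed_closedCell P c)).antisymm
    fun _ hz => (hasInteriorDisk_openCell hP hc hz).mem_closure

theorem uniqueDiffOn_closedCell (hP : 2 < P) (hc : 1 < c) : UniqueDiffOn ℝ (closedCell P c) :=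
  fun _ hz => (hasInteriorDisk_openCell hP hc hz).uniqueDiffWithinAt.mono
    (openCell_subset_closedCell P c)

theorem circle_subset_closedCell (hP : 2 < P) (hc : 1 < c) (hz : ‖z - c‖ = 1) :
    z ∈ closedCell P c :=
  ⟨by linarith [norm_sub_ge_abs_im z c], (circle_subset_wideCell hP hc hz).2⟩

theorem circle_neg_subset_closedCell (hP : 2 < P) (hc : 1 < c) (hz : ‖z + c‖ = 1) :
    z ∈ closedCell P c := by
  rw [← neg_neg z]
  exact neg_mem_closedCell (circle_subset_closedCell hP hc (by rw [norm_neg_sub_ofReal, hz]))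

theorem line_subset_closedCell (hP : 2 < P) (hz : |z.im| = P / 2) : z ∈ closedCell P c :=
  mem_closedCell_of_one_le_abs_im (by linarith) hz.le

theorem mem_closedCell_of_abs_re (him : |z.im| ≤ P / 2) (hre : |c| + 1 ≤ |z.re|) :
    z ∈ closedCell P c := by
  refine ⟨him, le_trans ?_ (abs_re_le_norm _), le_trans ?_ (abs_re_le_norm _)⟩
  · rw [sub_re, ofReal_re]
    linarith [abs_sub_abs_le_abs_sub z.re c]
  · rw [add_re, ofReal_re, ← sub_neg_eq_add]
    linarith [abs_sub_abs_le_abs_sub z.re (-c), abs_neg c]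

theorem isCompact_closedCell_inter (P c X : ℝ) :
    IsCompact (closedCell P c ∩ {z | |z.re| ≤ X}) :=
  ((isCompact_Icc (a := -X) (b := X)).reProdIm
    (isCompact_Icc (a := -(P / 2)) (b := P / 2))).of_isClosed_subset
    ((isClosed_closedCell P c).inter (isClosed_le continuous_re.abs continuous_const))
    fun _ hz => ⟨abs_le.1 hz.2, abs_le.1 hz.1.1⟩

end CellGeometry

section StripDomain

variable {ε δ : ℝ}

theorem centerR_zero (ε δ : ℝ) : centerR ε δ 0 = ((1 + ε / 2 : ℝ) : ℂ) := by
  apply Complex.ext <;> simp [centerR]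

theorem centerL_zero (ε δ : ℝ) : centerL ε δ 0 = -((1 + ε / 2 : ℝ) : ℂ) := by
  apply Complex.ext <;> simp [centerL]
  ring

theorem stripDomain_eq (ε δ : ℝ) : stripDomain ε δ = openCell (2 + δ) (1 + ε / 2) := by
  ext z
  have him : (-1 - δ / 2 < z.im ∧ z.im < 1 + δ / 2) ↔ |z.im| < (2 + δ) / 2 := by
    rw [abs_lt]
    constructor <;> rintro ⟨hlow, hupp⟩ <;> constructor <;> linarith
  rw [stripDomain, closure_union, diskL, diskR, closure_ball _ one_ne_zero,
    closure_ball _ one_ne_zero, centerL_zero, centerR_zero, openCell, strip]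
  simp only [Set.mem_sdiff, mem_ofPred_eq, mem_union, mem_closedBall, dist_eq_norm,
    sub_neg_eq_add, not_or, not_le]
  rw [him, and_comm (a := 1 < ‖z + ((1 + ε / 2 : ℝ) : ℂ)‖)]

theorem closure_stripDomain (hε : 0 < ε) (hδ : 0 < δ) :
    closure (stripDomain ε δ) = closedCell (2 + δ) (1 + ε / 2) := by
  rw [stripDomain_eq, closure_openCell (by linarith) (by linarith)]

theorem bdryDeriv_eq (hε : 0 < ε) (hδ : 0 < δ) {f : ℂ → ℝ} {g z : ℂ}
    (hf : HasFDerivAt f (reMul g) z) (hz : z ∈ closedCell (2 + δ) (1 + ε / 2)) (v : ℂ) :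
    bdryDeriv ε δ f z v = (g * v).re := by
  rw [bdryDeriv, closure_stripDomain hε hδ, hf.hasFDerivWithinAt.fderivWithin
    (uniqueDiffOn_closedCell (by linarith) (by linarith) z hz), reMul_apply]

end StripDomain

/-! ### The periodic potential in the cell -/

section ExpDecay

theorem norm_le_add_div_of_norm_deriv_le_exp {E : Type*} [NormedAddCommGroup E] [NormedSpace ℝ E]
    {f f' : ℝ → E} {a K κ : ℝ} (ha : 0 ≤ a) (hK : 0 ≤ K) (hκ : 0 < κ)
    (hf : ∀ x, a ≤ x → HasDerivAt f (f' x) x)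
    (hf' : ∀ x, a ≤ x → ‖f' x‖ ≤ K * Real.exp (-(κ * x))) {x : ℝ} (hx : a ≤ x) :
    ‖f x‖ ≤ ‖f a‖ + K / κ := by
  have hB : ∀ t : ℝ, HasDerivAt (fun t => ‖f a‖ + K / κ * (1 - Real.exp (-(κ * t))))
      (K * Real.exp (-(κ * t))) t := fun t => by
    have hexp := ((((hasDerivAt_id t).const_mul κ).neg.exp.const_sub 1).const_mul
      (K / κ)).const_add ‖f a‖
    convert! hexp using 1
    simp only [Pi.neg_apply, id, mul_one]
    field_simp
  have hstart : ‖f a‖ ≤ ‖f a‖ + K / κ * (1 - Real.exp (-(κ * a))) :=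
    le_add_of_nonneg_right (mul_nonneg (by positivity)
      (sub_nonneg.2 (Real.exp_le_one_iff.2 (neg_nonpos.2 (by positivity)))))
  refine (image_norm_le_of_norm_deriv_right_le_deriv_boundary (b := x)
    (fun t ht => (hf t ht.1).continuousAt.continuousWithinAt)
    (fun t ht => (hf t ht.1).hasDerivWithinAt) hstart hB (fun t ht => hf' t ht.1)
    (right_mem_Icc.2 hx)).trans ?_
  gcongr
  exact mul_le_of_le_one_right (by positivity) (by linarith [Real.exp_pos (-(κ * x))])

theorem integrable_exp_neg_mul_abs {κ : ℝ} (hκ : 0 < κ) :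
    Integrable fun x : ℝ => Real.exp (-(κ * |x|)) := by
  rw [← integrableOn_univ, ← Iic_union_Ioi (a := (0 : ℝ))]
  refine IntegrableOn.union ?_ ?_
  · refine (integrableOn_exp_mul_Iic hκ 0).congr_fun (fun x hx => ?_) measurableSet_Iic
    rw [abs_of_nonpos hx, mul_neg, neg_neg]
  · refine (integrableOn_exp_mul_Ioi (neg_lt_zero.2 hκ) 0).congr_fun (fun x hx => ?_)
      measurableSet_Ioi
    simp only [abs_of_pos (mem_Ioi.1 hx), neg_mul]

theorem lintegral_re_mul_im {F G : ℝ → ENNReal} (hF : Measurable F) (hG : Measurable G) :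
    ∫⁻ z : ℂ, F z.re * G z.im = (∫⁻ x, F x) * ∫⁻ y, G y := by
  rw [← lintegral_prod_mul hF.aemeasurable hG.aemeasurable, ← Measure.volume_eq_prod,
    ← volume_preserving_equiv_real_prod.lintegral_comp_emb
      measurableEquivRealProd.measurableEmbedding]
  rfl

theorem norm_gradient_eq (f : ℂ → ℝ) (z : ℂ) : ‖∇ f z‖ = ‖fderiv ℝ f z‖ :=
  (toDual ℝ ℂ).symm.norm_map _

theorem norm_reMul_le (g : ℂ) : ‖reMul g‖ ≤ ‖g‖ := by
  refine ContinuousLinearMap.opNorm_le_bound _ (norm_nonneg _) fun v => ?_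
  rw [reMul_apply, ← norm_mul]
  exact abs_re_le_norm _

theorem lintegral_norm_gradient_sq_lt_top {f : ℂ → ℝ} {g : ℂ → ℂ} {S : Set ℂ} {K κ L : ℝ}
    (hS : MeasurableSet S) (hL : ∀ z ∈ S, |z.im| ≤ L) (hκ : 0 < κ)
    (hf : ∀ z ∈ S, HasFDerivAt f (reMul (g z)) z)
    (hg : ∀ z ∈ S, ‖g z‖ ≤ K * Real.exp (-(κ * |z.re|))) :
    ∫⁻ z in S, ENNReal.ofReal (‖∇ f z‖ ^ 2) < ⊤ := by
  set F : ℝ → ENNReal := fun x => ENNReal.ofReal (K ^ 2 * Real.exp (-(2 * κ * |x|)))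
  set G : ℝ → ENNReal := (Icc (-L) L).indicator 1
  have hF : ∫⁻ x, F x < ⊤ :=
    ((integrable_exp_neg_mul_abs (κ := 2 * κ) (by positivity)).const_mul (K ^ 2)).lintegral_lt_top
  have hG : ∫⁻ y, G y < ⊤ := by
    rw [lintegral_indicator_one measurableSet_Icc]
    exact measure_Icc_lt_top
  have hle : ∀ z ∈ S, ENNReal.ofReal (‖∇ f z‖ ^ 2) ≤ F z.re * G z.im := fun z hz => by
    have hGz : G z.im = 1 := indicator_of_mem (mem_Icc.2 (abs_le.1 (hL z hz))) _
    have hnorm : ‖∇ f z‖ ≤ K * Real.exp (-(κ * |z.re|)) := by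
      rw [norm_gradient_eq, (hf z hz).fderiv]
      exact (norm_reMul_le _).trans (hg z hz)
    have hsq : (K * Real.exp (-(κ * |z.re|))) ^ 2 = K ^ 2 * Real.exp (-(2 * κ * |z.re|)) := by
      rw [mul_pow, ← Real.exp_nat_mul]
      congr 2
      push_cast
      ring
    rw [hGz, mul_one]
    exact ENNReal.ofReal_le_ofReal (hsq ▸ pow_le_pow_left₀ (norm_nonneg _) hnorm 2)
  calc ∫⁻ z in S, ENNReal.ofReal (‖∇ f z‖ ^ 2)
      ≤ ∫⁻ z in S, F z.re * G z.im := setLIntegral_mono' hS hle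
    _ ≤ ∫⁻ z : ℂ, F z.re * G z.im := setLIntegral_le_lintegral _ _
    _ = (∫⁻ x, F x) * ∫⁻ y, G y :=
        lintegral_re_mul_im (by fun_prop) (measurable_one.indicator measurableSet_Icc)
    _ < ⊤ := ENNReal.mul_lt_top hF hG

end ExpDecay

namespace PeriodicPotential

section Bounds

variable {P c : ℝ} {φ : ℂ → ℝ} {g : ℂ → ℂ} {b : ℝ} {z : ℂ}

theorem hasFDerivAt_of_mem_closedCell (h : PeriodicPotential P c φ g b) (hP : 2 < P)
    (hz : z ∈ closedCell P c) : HasFDerivAt φ (reMul (g z)) z :=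
  h.hasFDerivAt z (closedCell_subset_wideCell hP hz)

theorem grad_neg (h : PeriodicPotential P c φ g b) (hP : 2 < P) (hc : 1 < c)
    (hz : z ∈ closedCell P c) : g (-z) = g z := by
  have hodd : ∀ w ∈ closedCell P c, -φ w = φ (-w) := fun w hw =>
    (h.odd w (closedCell_subset_wideCell hP hw)).symm
  have hcomp : HasFDerivWithinAt (fun w => -φ w) _ (closedCell P c) z :=
    ((h.hasFDerivAt_of_mem_closedCell hP (neg_mem_closedCell hz)).comp z
      (hasFDerivAt_id z).neg).hasFDerivWithinAt.congr hodd (hodd z hz)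
  have heq := (uniqueDiffOn_closedCell hP hc z hz).eq hcomp
    (h.hasFDerivAt_of_mem_closedCell hP hz).neg.hasFDerivWithinAt
  refine reMul_injective (ContinuousLinearMap.ext fun v => ?_)
  have happ := congrArg (fun l : ℂ →L[ℝ] ℝ => l v) heq
  simp only [ContinuousLinearMap.comp_apply, neg_apply, map_neg] at happ
  simpa using happ

theorem value_neg (h : PeriodicPotential P c φ g b) (hP : 2 < P) (hc : 1 < c)
    (hz : ‖z + c‖ = 1) : φ z = -b := by
  have hz' : ‖-z - c‖ = 1 := by rw [norm_neg_sub_ofReal, hz]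
  have hodd := h.odd (-z) (circle_subset_wideCell hP hc hz')
  rwa [neg_neg, h.value _ hz'] at hodd

theorem grad_mul_I_re_eq_zero (h : PeriodicPotential P c φ g b) (hz : z ∈ wideCell P c)
    (hsymm : ∀ t : ℝ, φ (z + t * I) = φ (z - t * I)) : (g z * I).re = 0 := by
  have hline : ∀ s : ℂ, HasDerivAt (fun t : ℝ => φ (z + t * s)) ((g z * s).re) 0 := fun s => by
    have hmap : HasDerivAt (fun t : ℝ => z + t * s) s 0 := by
      simpa using ((hasDerivAt_id (0 : ℝ)).ofReal_comp.mul_const s).const_add z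
    have hz0 : z + ((0 : ℝ) : ℂ) * s = z := by simp
    exact HasFDerivAt.comp_hasDerivAt (0 : ℝ) (l' := reMul (g z)) (hz0.symm ▸ h.hasFDerivAt z hz)
      hmap
  have hup : (fun t : ℝ => φ (z + t * I)) = fun t : ℝ => φ (z + t * -I) := by
    funext t
    rw [hsymm, mul_neg, sub_eq_add_neg]
  have heq := (hup ▸ hline I).unique (hline (-I))
  rw [mul_neg, neg_re] at heq
  linarith

theorem grad_mul_I_re_eq_zero_of_abs_im (h : PeriodicPotential P c φ g b) (hP : 2 < P)
    (hconj : ∀ z, φ (conj z) = φ z) (hz : |z.im| = P / 2) : (g z * I).re = 0 := by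
  have hmem := closedCell_subset_wideCell hP (line_subset_closedCell (c := c) hP hz)
  refine h.grad_mul_I_re_eq_zero hmem fun t => ?_
  rcases abs_choice z.im with habs | habs <;> rw [habs] at hz
  · have hrefl : conj (z + t * I) + P * I = z - t * I :=
      Complex.ext (by simp) (by simp; linarith)
    rw [← hconj, ← h.periodic, hrefl]
  · have hrefl : conj (z + t * I) = z - t * I + P * I :=
      Complex.ext (by simp) (by simp; linarith)
    rw [← hconj, hrefl, h.periodic]

theorem exists_norm_grad_le (h : PeriodicPotential P c φ g b) (hP : 2 < P) :
    ∃ K κ, 0 < κ ∧ 0 ≤ K ∧ ∀ z ∈ closedCell P c, ‖g z‖ ≤ K * Real.exp (-(κ * |z.re|)) := by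
  obtain ⟨B, X, hB⟩ := h.decay
  obtain ⟨M, hM⟩ := (isCompact_closedCell_inter P c X).exists_bound_of_continuousOn
    (h.continuousOn_grad.mono (inter_subset_left.trans (closedCell_subset_wideCell hP)))
  have hκ : 0 < 2 * π / P := by positivity
  set κ := 2 * π / P
  refine ⟨max (max B 0) (max M 0 * Real.exp (κ * X)), κ, hκ, by positivity, fun z hz => ?_⟩
  rcases le_total X |z.re| with hx | hx
  · exact (hB z hx).trans (mul_le_mul_of_nonneg_right
      ((le_max_left _ _).trans (le_max_left _ _)) (Real.exp_pos _).le)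
  · calc ‖g z‖ ≤ max M 0 := (hM z ⟨hz, hx⟩).trans (le_max_left M 0)
      _ ≤ max M 0 * (Real.exp (κ * X) * Real.exp (-(κ * |z.re|))) := by
          rw [← Real.exp_add]
          exact le_mul_of_one_le_right (le_max_right _ _) (Real.one_le_exp (by nlinarith))
      _ ≤ _ := by
          rw [← mul_assoc]
          exact mul_le_mul_of_nonneg_right (le_max_right _ _) (Real.exp_pos _).le

theorem exists_abs_le (h : PeriodicPotential P c φ g b) (hP : 2 < P) :
    ∃ B, 0 ≤ B ∧ ∀ z ∈ closedCell P c, |φ z| ≤ B := by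
  obtain ⟨K, κ, hκ, hK, hg⟩ := h.exists_norm_grad_le hP
  set X := |c| + 1
  have hX0 : 0 ≤ X := by positivity
  obtain ⟨M, hM⟩ := (isCompact_closedCell_inter P c X).exists_bound_of_continuousOn (f := φ)
    fun z hz => (h.hasFDerivAt_of_mem_closedCell hP hz.1).continuousAt.continuousWithinAt
  have hright : ∀ z ∈ closedCell P c, X ≤ z.re → |φ z| ≤ max M 0 + K / κ := by
    intro z hz hx
    have hre : ∀ x : ℝ, ((x : ℂ) + z.im * I).re = x := fun x => by simp
    have habs : ∀ x : ℝ, X ≤ x → |((x : ℂ) + z.im * I).re| = x := fun x hx => by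
      rw [hre, abs_of_nonneg (hX0.trans hx)]
    have hmem : ∀ x : ℝ, X ≤ x → (x : ℂ) + z.im * I ∈ closedCell P c := fun x hx =>
      mem_closedCell_of_abs_re (by simpa using hz.1) (by rwa [habs x hx])
    have hline := norm_le_add_div_of_norm_deriv_le_exp (f := fun x : ℝ => φ (x + z.im * I))
      (f' := fun x : ℝ => (g (x + z.im * I)).re) hX0 hK hκ (fun x hx => ?_) (fun x hx => ?_) hx
    · rw [re_add_im] at hline
      refine hline.trans (add_le_add_left ?_ _)
      exact (hM _ ⟨hmem X le_rfl, (habs X le_rfl).le⟩).trans (le_max_left M 0)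
    · have hmap : HasDerivAt (fun t : ℝ => (t : ℂ) + z.im * I) 1 x := by
        simpa using (hasDerivAt_id x).ofReal_comp.add_const ((z.im : ℂ) * I)
      simpa only [reMul_apply, mul_one] using!
        (h.hasFDerivAt_of_mem_closedCell hP (hmem x hx)).comp_hasDerivAt x hmap
    · have hgx := hg _ (hmem x hx)
      rw [habs x hx] at hgx
      exact (abs_re_le_norm _).trans hgx
  refine ⟨max M 0 + K / κ, by positivity, fun z hz => ?_⟩
  rcases le_total |z.re| X with hx | hx
  · exact (hM z ⟨hz, hx⟩).trans ((le_max_left M 0).trans (le_add_of_nonneg_right (by positivity)))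
  · rcases abs_choice z.re with habs | habs <;> rw [habs] at hx
    · exact hright z hz hx
    · simpa only [h.odd z (closedCell_subset_wideCell hP hz), abs_neg] using
        hright (-z) (neg_mem_closedCell hz) hx

end Bounds

section IsPotential

variable {ε δ : ℝ} {φ : ℂ → ℝ} {g : ℂ → ℂ} {b : ℝ}

theorem finiteEnergy (hδ : 0 < δ) (h : PeriodicPotential (2 + δ) (1 + ε / 2) φ g b) :
    FiniteEnergy ε δ φ := by
  obtain ⟨K, κ, hκ, -, hg⟩ := h.exists_norm_grad_le (by linarith)
  have hsub := openCell_subset_closedCell (2 + δ) (1 + ε / 2)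
  rw [FiniteEnergy, stripDomain_eq]
  exact lintegral_norm_gradient_sq_lt_top (isOpen_openCell _ _).measurableSet
    (fun z hz => (hsub hz).1) hκ
    (fun z hz => h.hasFDerivAt_of_mem_closedCell (by linarith) (hsub hz))
    (fun z hz => hg z (hsub hz))

theorem circleInt_normalDeriv_centerR (hε : 0 < ε) (hδ : 0 < δ)
    (h : PeriodicPotential (2 + δ) (1 + ε / 2) φ g b) :
    circleInt (centerR ε δ 0) (normalDeriv ε δ (centerR ε δ 0) φ) = 1 := by
  have hpt : ∀ θ : ℝ, normalDeriv ε δ (centerR ε δ 0) φ (circleMap (centerR ε δ 0) 1 θ) =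
      -(g (circleMap ((1 + ε / 2 : ℝ) : ℂ) 1 θ) *
        (circleMap ((1 + ε / 2 : ℝ) : ℂ) 1 θ - ((1 + ε / 2 : ℝ) : ℂ))).re := fun θ => by
    have hmem : circleMap ((1 + ε / 2 : ℝ) : ℂ) 1 θ ∈ closedCell (2 + δ) (1 + ε / 2) :=
      circle_subset_closedCell (by linarith) (by linarith) (by simp [circleMap])
    rw [normalDeriv, centerR_zero, bdryDeriv_eq hε hδ
      (h.hasFDerivAt_of_mem_closedCell (by linarith) hmem) hmem, ← neg_re, ← mul_neg, neg_sub]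
  simp only [circleInt, hpt]
  rw [intervalIntegral.integral_neg, h.flux, neg_neg]

theorem normalDeriv_neg (hε : 0 < ε) (hδ : 0 < δ)
    (h : PeriodicPotential (2 + δ) (1 + ε / 2) φ g b) {z : ℂ}
    (hz : z ∈ closedCell (2 + δ) (1 + ε / 2)) :
    normalDeriv ε δ (centerL ε δ 0) φ (-z) = -normalDeriv ε δ (centerR ε δ 0) φ z := by
  have hP : 2 < 2 + δ := by linarith
  have hz' := neg_mem_closedCell hz
  rw [normalDeriv, normalDeriv, bdryDeriv_eq hε hδ (h.hasFDerivAt_of_mem_closedCell hP hz) hz,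
    bdryDeriv_eq hε hδ (h.hasFDerivAt_of_mem_closedCell hP hz') hz',
    h.grad_neg hP (by linarith) hz, centerL_zero, centerR_zero, ← neg_re, ← mul_neg]
  congr 2
  ring

theorem circleInt_normalDeriv_centerL (hε : 0 < ε) (hδ : 0 < δ)
    (h : PeriodicPotential (2 + δ) (1 + ε / 2) φ g b) :
    -circleInt (centerL ε δ 0) (normalDeriv ε δ (centerL ε δ 0) φ) = 1 := by
  set G : ℝ → ℝ := fun θ =>
    normalDeriv ε δ (centerR ε δ 0) φ (circleMap (centerR ε δ 0) 1 θ) with hG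
  have hpt : ∀ θ : ℝ, normalDeriv ε δ (centerL ε δ 0) φ (circleMap (centerL ε δ 0) 1 θ) =
      -G (θ + π) := fun θ => by
    have hneg : circleMap (centerL ε δ 0) 1 θ = -circleMap (centerR ε δ 0) 1 (θ + π) := by
      rw [centerL_zero, centerR_zero]
      simp only [circleMap, ofReal_add, add_mul, exp_add, exp_pi_mul_I]
      ring
    rw [hneg, h.normalDeriv_neg hε hδ]
    refine circle_subset_closedCell (by linarith) (by linarith) ?_
    rw [centerR_zero, circleMap_sub_center, norm_circleMap_zero, abs_one]
  have hper : Function.Periodic G (2 * π) := fun θ => by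
    simp only [hG, (periodic_circleMap (centerR ε δ 0) 1) θ]
  simp only [circleInt, hpt]
  rw [intervalIntegral.integral_neg, neg_neg, intervalIntegral.integral_comp_add_right, zero_add,
    add_comm (2 * π), hper.intervalIntegral_add_eq π 0, zero_add]
  exact h.circleInt_normalDeriv_centerR hε hδ

theorem isPotential (hε : 0 < ε) (hδ : 0 < δ) (h : PeriodicPotential (2 + δ) (1 + ε / 2) φ g b)
    (hconj : ∀ z, φ (conj z) = φ z) : IsPotential ε δ φ b := by
  have hP : 2 < 2 + δ := by linarith
  have hW := closedCell_subset_wideCell (c := 1 + ε / 2) hP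
  have hneumann : ∀ z : ℂ, |z.im| = (2 + δ) / 2 → bdryDeriv ε δ φ z I = 0 := fun z hz => by
    have hmem := line_subset_closedCell (c := 1 + ε / 2) hP hz
    rw [bdryDeriv_eq hε hδ (h.hasFDerivAt_of_mem_closedCell hP hmem) hmem,
      h.grad_mul_I_re_eq_zero_of_abs_im hP hconj hz]
  exact
    { harmonic := by
        rw [stripDomain_eq]
        exact fun z hz => h.harmonic z (hW (openCell_subset_closedCell _ _ hz))
      regular := by
        rw [closure_stripDomain hε hδ]
        exact fun z hz => ((h.harmonic z (hW hz)).1.of_le one_le_two).contDiffWithinAt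
      neumannTop := fun z hz => hneumann z (by rw [hz, abs_of_pos (by linarith)]; ring)
      neumannBottom := fun z hz => by
        rw [bdryDeriv, map_neg, ← bdryDeriv, neg_eq_zero]
        exact hneumann z (by rw [hz, abs_of_neg (by linarith)]; ring)
      valueR := fun z hz => h.value z (by rwa [centerR_zero, mem_sphere_iff_norm] at hz)
      valueL := fun z hz => h.value_neg hP (by linarith)
        (by rwa [centerL_zero, mem_sphere_iff_norm, sub_neg_eq_add] at hz)
      fluxR := h.circleInt_normalDeriv_centerR hε hδ
      fluxL := h.circleInt_normalDeriv_centerL hε hδ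
      energy := h.finiteEnergy hδ }

end IsPotential

end PeriodicPotential

/-! ### Integration over a perforated rectangle -/

section PolarCoordinates

variable {E : Type*} [NormedAddCommGroup E]

theorem polarCoord_symm_eq_circleMap (q : ℝ × ℝ) :
    Complex.polarCoord.symm q = circleMap 0 q.1 q.2 := by
  rw [Complex.polarCoord_symm_apply, circleMap_zero, exp_mul_I, ofReal_cos, ofReal_sin]

variable [NormedSpace ℝ E]

theorem integrableOn_polarCoord_smul {f : ℂ → E} (hf : Integrable f) :
    IntegrableOn (fun q : ℝ × ℝ => q.1 • f (circleMap 0 q.1 q.2)) (Ioi 0 ×ˢ Ioo (-π) π) := by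
  have hf' : Integrable (fun q : ℝ × ℝ => f (measurableEquivRealProd.symm q)) :=
    (volume_preserving_equiv_real_prod.symm.integrable_comp_emb
      measurableEquivRealProd.symm.measurableEmbedding).2 hf
  have := (integrableOn_image_iff_integrableOn_abs_det_fderiv_smul volume
    polarCoord.open_target.measurableSet
    (fun q _ => (hasFDerivAt_polarCoord_symm q).hasFDerivWithinAt) polarCoord.symm.injOn _).1
    hf'.integrableOn
  refine this.congr_fun (fun q hq => ?_) polarCoord.open_target.measurableSet
  simp only [det_fderivPolarCoordSymm, abs_of_pos (show 0 < q.1 from hq.1),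
    measurableEquivRealProd_symm_polarCoord_symm_apply, polarCoord_symm_eq_circleMap]

theorem integral_eq_integral_circleMap {f : ℂ → E} (hf : Integrable f) :
    ∫ z, f z = ∫ ρ in Ioi (0 : ℝ), ρ • ∫ θ in (0 : ℝ)..(2 * π), f (circleMap 0 ρ θ) := by
  rw [← Complex.integral_comp_polarCoord_symm]
  simp only [polarCoord_symm_eq_circleMap]
  have hpolar := integrableOn_polarCoord_smul hf
  rw [Measure.volume_eq_prod] at hpolar
  rw [polarCoord_target, Measure.volume_eq_prod, setIntegral_prod _ hpolar]
  refine integral_congr_ae (Eventually.of_forall fun ρ => ?_)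
  have hper : Function.Periodic (fun θ => f (circleMap 0 ρ θ)) (2 * π) :=
    (periodic_circleMap 0 ρ).comp f
  have hshift := hper.intervalIntegral_add_eq (-π) 0
  rw [zero_add, neg_add_eq_sub, two_mul, add_sub_cancel_right, ← two_mul] at hshift
  simp only [integral_smul]
  rw [← hshift, intervalIntegral.integral_of_le (by linarith [Real.pi_pos]),
    integral_Ioc_eq_integral_Ioo]

end PolarCoordinates

section Cutoff

variable {s ρ r : ℝ}

/-- A smooth radial cutoff: `0` for `ρ ≤ 1 + s` and `1` for `ρ ≥ 1 + 2s`. -/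
def cutoff (s ρ : ℝ) : ℝ := Real.smoothTransition ((ρ - 1 - s) / s)

theorem contDiff_cutoff (s : ℝ) : ContDiff ℝ 1 (cutoff s) :=
  Real.smoothTransition.contDiff.comp
    (((contDiff_id.sub contDiff_const).sub contDiff_const).div_const s)

theorem cutoff_eq_zero (hs : 0 < s) (hρ : ρ ≤ 1 + s) : cutoff s ρ = 0 :=
  Real.smoothTransition.zero_of_nonpos (div_nonpos_of_nonpos_of_nonneg (by linarith) hs.le)

theorem cutoff_eq_one (hs : 0 < s) (hρ : 1 + 2 * s ≤ ρ) : cutoff s ρ = 1 :=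
  Real.smoothTransition.one_of_one_le (by rw [le_div_iff₀ hs]; linarith)

theorem monotone_cutoff (hs : 0 < s) : Monotone (cutoff s) := fun a b hab =>
  Real.smoothTransition.monotone (by gcongr)

theorem hasDerivAt_cutoff (s ρ : ℝ) : HasDerivAt (cutoff s) (deriv (cutoff s) ρ) ρ :=
  ((contDiff_cutoff s).differentiable one_ne_zero ρ).hasDerivAt

theorem continuous_deriv_cutoff (s : ℝ) : Continuous (deriv (cutoff s)) :=
  (contDiff_cutoff s).continuous_deriv le_rfl

theorem deriv_cutoff_nonneg (hs : 0 < s) (ρ : ℝ) : 0 ≤ deriv (cutoff s) ρ :=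
  (hasDerivAt_cutoff s ρ).nonneg_of_monotone (monotone_cutoff hs)

theorem deriv_cutoff_eq_zero_of_lt (hs : 0 < s) (hρ : ρ < 1 + s) : deriv (cutoff s) ρ = 0 := by
  have : cutoff s =ᶠ[𝓝 ρ] fun _ => 0 := by
    filter_upwards [Iio_mem_nhds hρ] with t ht using cutoff_eq_zero hs (le_of_lt ht)
  rw [this.deriv_eq, deriv_const]

theorem deriv_cutoff_eq_zero_of_gt (hs : 0 < s) (hρ : 1 + 2 * s < ρ) : deriv (cutoff s) ρ = 0 := by
  have : cutoff s =ᶠ[𝓝 ρ] fun _ => 1 := by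
    filter_upwards [Ioi_mem_nhds hρ] with t ht using cutoff_eq_one hs (le_of_lt ht)
  rw [this.deriv_eq, deriv_const]

theorem deriv_cutoff_eq_zero_of_notMem (hs : 0 < s) (hr : 1 + 2 * s ≤ r) (hρ : ρ ∉ Icc 1 r) :
    deriv (cutoff s) ρ = 0 := by
  rw [mem_Icc, not_and_or, not_le, not_le] at hρ
  exact hρ.elim (fun h => deriv_cutoff_eq_zero_of_lt hs (by linarith))
    fun h => deriv_cutoff_eq_zero_of_gt hs (by linarith)

theorem integral_deriv_cutoff (hs : 0 < s) (hr : 1 + 2 * s ≤ r) :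
    ∫ ρ in Icc 1 r, deriv (cutoff s) ρ = 1 := by
  rw [integral_Icc_eq_integral_Ioc, ← intervalIntegral.integral_of_le (by linarith),
    intervalIntegral.integral_deriv_eq_sub
    (fun x _ => (hasDerivAt_cutoff s x).differentiableAt)
    ((continuous_deriv_cutoff s).intervalIntegrable _ _), cutoff_eq_one hs hr,
    cutoff_eq_zero hs (by linarith), sub_zero]

/-- The derivatives of the cutoffs form an approximate identity at the right of `1`. -/
theorem tendsto_integral_deriv_cutoff_mul {g : ℝ → ℝ} (hr : 1 < r) (hg : ContinuousOn g (Icc 1 r)) :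
    Tendsto (fun s => ∫ ρ in Icc 1 r, deriv (cutoff s) ρ * g ρ) (𝓝[>] 0) (𝓝 (g 1)) := by
  have hpos : ∀ᶠ s : ℝ in 𝓝[>] 0, 0 < s := self_mem_nhdsWithin
  refine tendsto_setIntegral_peak_smul_of_integrableOn_of_tendsto (x₀ := 1) measurableSet_Icc
    measurableSet_Icc subset_rfl self_mem_nhdsWithin isCompact_Icc.measure_ne_top
    (hpos.mono fun s hs x _ => deriv_cutoff_nonneg hs x) (fun u hu hu1 => ?_) ?_
    (Eventually.of_forall fun s => (continuous_deriv_cutoff s).aestronglyMeasurable)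
    (hg.integrableOn_compact isCompact_Icc) (hg 1 (left_mem_Icc.2 hr.le))
  · rw [Metric.tendstoUniformlyOn_iff]
    intro η hη
    obtain ⟨d, hd, hdu⟩ := Metric.isOpen_iff.1 hu 1 hu1
    filter_upwards [Ioo_mem_nhdsGT (half_pos hd)] with s hs x hx
    have hx1 : 1 + 2 * s < x := by
      by_contra! hle
      refine hx.2 (hdu ?_)
      rw [mem_ball, Real.dist_eq, abs_of_nonneg (sub_nonneg.2 hx.1.1)]
      linarith [hs.2]
    simpa [deriv_cutoff_eq_zero_of_gt hs.1 hx1] using hη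
  · refine tendsto_const_nhds.congr' ?_
    filter_upwards [Ioo_mem_nhdsGT (half_pos (sub_pos.2 hr))] with s hs
    exact (integral_deriv_cutoff hs.1 (by linarith [hs.2])).symm

theorem hasFDerivAt_norm_sub {a z : ℂ} (hz : z ≠ a) :
    HasFDerivAt (fun z => ‖z - a‖) (reMul ((‖z - a‖ : ℂ) / (z - a))) z := by
  have hza : z - a ≠ 0 := sub_ne_zero.2 hz
  refine ((hasFDerivAt_log_norm ((hasDerivAt_id z).sub_const a) hza).exp.congr_of_eventuallyEq
    ?_).congr_fderiv ?_
  · filter_upwards [eventually_ne_nhds hz] with w hw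
    exact (Real.exp_log (norm_pos_iff.2 (sub_ne_zero.2 hw))).symm
  · ext v
    simp only [id_eq, Real.exp_log (norm_pos_iff.2 hza), smul_apply, reMul_apply, smul_eq_mul]
    rw [← re_ofReal_mul, ← mul_assoc, mul_one_div]

theorem hasFDerivAt_cutoff_norm (hs : 0 < s) (a z : ℂ) :
    HasFDerivAt (fun z => cutoff s ‖z - a‖)
      (deriv (cutoff s) ‖z - a‖ • reMul ((‖z - a‖ : ℂ) / (z - a))) z := by
  rcases eq_or_ne z a with rfl | hz
  · have hzero : (fun w => cutoff s ‖w - z‖) =ᶠ[𝓝 z] fun _ => 0 := by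
      filter_upwards [ball_mem_nhds z one_pos] with w hw
      exact cutoff_eq_zero hs (by linarith [mem_ball_iff_norm.1 hw])
    refine ((hasFDerivAt_const (0 : ℝ) z).congr_of_eventuallyEq hzero).congr_fderiv ?_
    rw [sub_self, norm_zero, deriv_cutoff_eq_zero_of_lt hs (by linarith), zero_smul]
  · exact HasDerivAt.comp_hasFDerivAt (h₂ := cutoff s) z (hasDerivAt_cutoff s ‖z - a‖)
      (hasFDerivAt_norm_sub hz)

end Cutoff

section RadialIntegral

variable {r s : ℝ} {g : ℂ → ℝ}

/-- The closed annulus between the unit circle and the circle of radius `r` around `0`. -/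
def annulus (r : ℝ) : Set ℂ := {z | ‖z‖ ∈ Icc 1 r}

theorem isCompact_annulus (r : ℝ) : IsCompact (annulus r) :=
  (isCompact_closedBall (0 : ℂ) r).of_isClosed_subset (isClosed_Icc.preimage continuous_norm)
    fun _ hz => mem_closedBall_zero_iff.2 hz.2

theorem integrable_deriv_cutoff_norm_mul (hs : 0 < s) (hr : 1 + 2 * s ≤ r)
    (hg : ContinuousOn g (annulus r)) : Integrable fun z : ℂ => deriv (cutoff s) ‖z‖ * g z := by
  have : IntegrableOn (fun z : ℂ => deriv (cutoff s) ‖z‖ * g z) (annulus r) :=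
    (((continuous_deriv_cutoff s).comp continuous_norm).continuousOn.mul hg).integrableOn_compact
      (isCompact_annulus r)
  refine this.integrable_of_forall_notMem_eq_zero fun z hz => ?_
  rw [deriv_cutoff_eq_zero_of_notMem hs hr hz, zero_mul]

theorem continuousOn_integral_circleMap (hg : ContinuousOn g (annulus r)) :
    ContinuousOn (fun ρ => ρ * ∫ θ in (0 : ℝ)..(2 * π), g (circleMap 0 ρ θ)) (Icc 1 r) := by
  refine continuousOn_id.mul (continuousOn_iff_continuous_domRestrict.2 ?_)
  refine intervalIntegral.continuous_parametric_intervalIntegral_of_continuous'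
    (f := fun (ρ : Icc 1 r) θ => g (circleMap 0 ρ θ)) (hg.comp_continuous ?_ fun q => ?_) _ _
  · unfold circleMap
    fun_prop
  · rw [annulus, mem_ofPred_eq, norm_circleMap_zero, abs_of_nonneg (zero_le_one.trans q.1.2.1)]
    exact q.1.2

theorem integral_deriv_cutoff_norm_mul (hs : 0 < s) (hr : 1 + 2 * s ≤ r)
    (hg : ContinuousOn g (annulus r)) :
    ∫ z : ℂ, deriv (cutoff s) ‖z‖ * g z = ∫ ρ in Icc 1 r, deriv (cutoff s) ρ *
      (ρ * ∫ θ in (0 : ℝ)..(2 * π), g (circleMap 0 ρ θ)) := by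
  rw [integral_eq_integral_circleMap (integrable_deriv_cutoff_norm_mul hs hr hg),
    ← setIntegral_eq_of_subset_of_forall_sdiff_eq_zero measurableSet_Ioi
      (fun ρ (hρ : ρ ∈ Icc 1 r) => zero_lt_one.trans_le hρ.1)
      fun ρ hρ => by rw [deriv_cutoff_eq_zero_of_notMem hs hr hρ.2, zero_mul] ]
  refine setIntegral_congr_fun measurableSet_Ioi fun ρ (hρ : 0 < ρ) => ?_
  simp only [norm_circleMap_zero, abs_of_pos hρ, intervalIntegral.integral_const_mul, smul_eq_mul]
  ring

theorem tendsto_integral_deriv_cutoff_norm_mul (hr : 1 < r) (hg : ContinuousOn g (annulus r)) :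
    Tendsto (fun s => ∫ z : ℂ, deriv (cutoff s) ‖z‖ * g z) (𝓝[>] 0)
      (𝓝 (∫ θ in (0 : ℝ)..(2 * π), g (circleMap 0 1 θ))) := by
  have hlim := tendsto_integral_deriv_cutoff_mul hr (continuousOn_integral_circleMap hg)
  rw [one_mul] at hlim
  refine hlim.congr' ?_
  filter_upwards [Ioo_mem_nhdsGT (half_pos (sub_pos.2 hr))] with s hs
  exact (integral_deriv_cutoff_norm_mul hs.1 (by linarith [hs.2]) hg).symm

end RadialIntegral

section Flux

variable {r : ℝ} {a : ℂ} {p q : ℂ → ℝ}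

/-- The outward flux of the field `(p, q)` through the unit circle around `a`. -/
def circleFlux (a : ℂ) (p q : ℂ → ℝ) : ℝ :=
  ∫ θ in (0 : ℝ)..(2 * π), (Real.cos θ * p (circleMap a 1 θ) + Real.sin θ * q (circleMap a 1 θ))

/-- The outward flux of the field `(p, q)` through the boundary of the rectangle
`|x| ≤ X`, `|y| ≤ Y`. -/
def rectFlux (X Y : ℝ) (p q : ℂ → ℝ) : ℝ :=
  (∫ x in (-X)..X, q (equivRealProdCLM.symm (x, Y))) -
    (∫ x in (-X)..X, q (equivRealProdCLM.symm (x, -Y))) +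
    (∫ y in (-Y)..Y, p (equivRealProdCLM.symm (X, y))) -
    ∫ y in (-Y)..Y, p (equivRealProdCLM.symm (-X, y))

/-- The component of the field `(p, q)` in the radial direction from `a`, in terms of `ζ = z - a`.
The factor `‖ζ‖ / ζ` is the conjugate of the unit radial vector. -/
def radialPart (a : ℂ) (p q : ℂ → ℝ) (ζ : ℂ) : ℝ :=
  ((‖ζ‖ : ℂ) / ζ).re * p (a + ζ) + ((‖ζ‖ : ℂ) / ζ * I).re * q (a + ζ)

theorem integral_radialPart (a : ℂ) (p q : ℂ → ℝ) :
    ∫ θ in (0 : ℝ)..(2 * π), radialPart a p q (circleMap 0 1 θ) = circleFlux a p q := by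
  refine intervalIntegral.integral_congr fun θ _ => ?_
  have hdir : (‖circleMap 0 1 θ‖ : ℂ) / circleMap 0 1 θ = Real.cos θ - Real.sin θ * I := by
    rw [norm_circleMap_zero, abs_one, ofReal_one, circleMap_zero, ofReal_one, one_mul, one_div,
      ← exp_neg, ← neg_mul, ← ofReal_neg, exp_mul_I, ← ofReal_cos, ← ofReal_sin, Real.cos_neg,
      Real.sin_neg, ofReal_neg, neg_mul, ← sub_eq_add_neg]
  have hadd : a + circleMap 0 1 θ = circleMap a 1 θ := by rw [circleMap_zero, circleMap]
  simp only [radialPart, hdir, hadd]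
  simp [-ofReal_cos, -ofReal_sin]

theorem continuousOn_radialPart {S : Set ℂ} (hp : ContinuousOn p S) (hq : ContinuousOn q S)
    (hS : ∀ ζ ∈ annulus r, a + ζ ∈ S) : ContinuousOn (radialPart a p q) (annulus r) := by
  have hdir : ContinuousOn (fun ζ : ℂ => (‖ζ‖ : ℂ) / ζ) (annulus r) :=
    (continuous_ofReal.comp continuous_norm).continuousOn.div continuousOn_id fun ζ hζ =>
      norm_pos_iff.1 (zero_lt_one.trans_le hζ.1)
  have hadd : ContinuousOn (fun ζ : ℂ => a + ζ) (annulus r) := by fun_prop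
  exact ((continuous_re.comp_continuousOn hdir).mul (hp.comp hadd hS)).add
    ((continuous_re.comp_continuousOn (hdir.mul continuousOn_const)).mul (hq.comp hadd hS))

end Flux

section Rectangle

variable {X Y : ℝ}

theorem integral_integral_eq_integral {T : ℂ → ℝ} (hT : Integrable T) (hX : 0 ≤ X) (hY : 0 ≤ Y)
    (hsupp : ∀ z : ℂ, T z ≠ 0 → |z.re| < X ∧ |z.im| < Y) :
    ∫ x in (-X)..X, ∫ y in (-Y)..Y, T (equivRealProdCLM.symm (x, y)) = ∫ z, T z := by
  have hT' : Integrable (fun q : ℝ × ℝ => T (equivRealProdCLM.symm q)) :=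
    (volume_preserving_equiv_real_prod.symm.integrable_comp_emb
      measurableEquivRealProd.symm.measurableEmbedding).2 hT
  simp only [intervalIntegral.integral_of_le (neg_le_self hX),
    intervalIntegral.integral_of_le (neg_le_self hY)]
  calc ∫ x in Ioc (-X) X, ∫ y in Ioc (-Y) Y, T (equivRealProdCLM.symm (x, y))
      = ∫ q in Ioc (-X) X ×ˢ Ioc (-Y) Y, T (equivRealProdCLM.symm q) := by
        rw [Measure.volume_eq_prod] at hT' ⊢
        exact (setIntegral_prod _ hT'.integrableOn).symm
    _ = ∫ q : ℝ × ℝ, T (equivRealProdCLM.symm q) := by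
        refine setIntegral_eq_integral_of_forall_compl_eq_zero fun q hq => ?_
        by_contra hne
        obtain ⟨hx, hy⟩ := hsupp _ hne
        rw [abs_lt] at hx hy
        exact hq ⟨⟨hx.1, hx.2.le⟩, ⟨hy.1, hy.2.le⟩⟩
    _ = ∫ z, T z := volume_preserving_equiv_real_prod.symm.integral_comp
        measurableEquivRealProd.symm.measurableEmbedding T

theorem rectFlux_eq_integral {p q T : ℂ → ℝ} {p' q' : ℂ → ℂ →L[ℝ] ℝ} (hX : 0 ≤ X) (hY : 0 ≤ Y)
    (hp : ContinuousOn p {z | |z.re| ≤ X ∧ |z.im| ≤ Y})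
    (hq : ContinuousOn q {z | |z.re| ≤ X ∧ |z.im| ≤ Y})
    (hp' : ∀ z : ℂ, |z.re| < X → |z.im| < Y → HasFDerivAt p (p' z) z)
    (hq' : ∀ z : ℂ, |z.re| < X → |z.im| < Y → HasFDerivAt q (q' z) z)
    (hdiv : ∀ z, p' z 1 + q' z I = T z) (hT : Integrable T)
    (hsupp : ∀ z : ℂ, T z ≠ 0 → |z.re| < X ∧ |z.im| < Y) :
    rectFlux X Y p q = ∫ z, T z := by
  let e : ℝ × ℝ →L[ℝ] ℂ := equivRealProdCLM.symm
  have hclosed : MapsTo e ([[-X, X]] ×ˢ [[-Y, Y]]) {z | |z.re| ≤ X ∧ |z.im| ≤ Y} := fun x hx => by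
    rw [uIcc_of_le (neg_le_self hX), uIcc_of_le (neg_le_self hY)] at hx
    exact ⟨abs_le.2 hx.1, abs_le.2 hx.2⟩
  have hopen : ∀ x ∈ Ioo (min (-X) X) (max (-X) X) ×ˢ Ioo (min (-Y) Y) (max (-Y) Y),
      |(e x).re| < X ∧ |(e x).im| < Y := fun x hx => by
    rw [min_eq_left (neg_le_self hX), max_eq_right (neg_le_self hX),
      min_eq_left (neg_le_self hY), max_eq_right (neg_le_self hY)] at hx
    exact ⟨abs_lt.2 hx.1, abs_lt.2 hx.2⟩
  have hdiv' : ∀ x, (p' (e x)).comp e (1, 0) + (q' (e x)).comp e (0, 1) = T (e x) := fun x => by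
    rw [← hdiv]
    exact congr_arg₂ (· + ·) (congr_arg (p' (e x)) (Complex.ext rfl rfl))
      (congr_arg (q' (e x)) (Complex.ext rfl rfl))
  have key := integral2_divergence_prod_of_hasFDerivAt (p ∘ e) (q ∘ e)
    (fun x => (p' (e x)).comp e) (fun x => (q' (e x)).comp e) (-X) (-Y) X Y
    (hp.comp e.continuous.continuousOn hclosed) (hq.comp e.continuous.continuousOn hclosed)
    (fun x hx => (hp' _ (hopen x hx).1 (hopen x hx).2).comp x e.hasFDerivAt)
    (fun x hx => (hq' _ (hopen x hx).1 (hopen x hx).2).comp x e.hasFDerivAt) (by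
      simp only [hdiv']
      exact ((volume_preserving_equiv_real_prod.symm.integrable_comp_emb
        measurableEquivRealProd.symm.measurableEmbedding).2 hT).integrableOn)
  simp only [hdiv'] at key
  exact key.symm.trans (integral_integral_eq_integral hT hX hY hsupp)

end Rectangle

section PerforatedRectangle

variable {A : Finset ℂ} {r s X Y : ℝ} {a z : ℂ} {p q f : ℂ → ℝ}

/-- The rectangle `|x| ≤ X`, `|y| ≤ Y` without the open unit disks around the points of `A`. -/
def perforatedRect (A : Finset ℂ) (X Y : ℝ) : Set ℂ :=
  {z | (|z.re| ≤ X ∧ |z.im| ≤ Y) ∧ ∀ a ∈ A, 1 ≤ ‖z - a‖}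

/-- The interior of `perforatedRect A X Y`. -/
def openPerforatedRect (A : Finset ℂ) (X Y : ℝ) : Set ℂ :=
  {z | (|z.re| < X ∧ |z.im| < Y) ∧ ∀ a ∈ A, 1 < ‖z - a‖}

/-- The closed disks of radius `r` around the points of `A` are pairwise disjoint and lie in the
open rectangle `|x| < X`, `|y| < Y`. -/
structure SeparatedDisks (A : Finset ℂ) (r X Y : ℝ) : Prop where
  mem_rect : ∀ a ∈ A, ∀ z, ‖z - a‖ ≤ r → |z.re| < X ∧ |z.im| < Y
  lt_norm_sub : ∀ a ∈ A, ∀ b ∈ A, b ≠ a → ∀ z, ‖z - a‖ ≤ r → r < ‖z - b‖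

/-- A cutoff that vanishes near the unit disks around the points of `A` and is `1` away from
them. -/
def disksCutoff (A : Finset ℂ) (s : ℝ) (z : ℂ) : ℝ := 1 - ∑ a ∈ A, (1 - cutoff s ‖z - a‖)

/-- The derivative of `disksCutoff A s` at `z`. -/
def disksCutoffDeriv (A : Finset ℂ) (s : ℝ) (z : ℂ) : ℂ →L[ℝ] ℝ :=
  ∑ a ∈ A, deriv (cutoff s) ‖z - a‖ • reMul ((‖z - a‖ : ℂ) / (z - a))

theorem hasFDerivAt_disksCutoff (hs : 0 < s) (A : Finset ℂ) (z : ℂ) :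
    HasFDerivAt (disksCutoff A s) (disksCutoffDeriv A s z) z := by
  have := (HasFDerivAt.fun_sum fun a (_ : a ∈ A) =>
    (hasFDerivAt_cutoff_norm hs a z).const_sub 1).const_sub 1
  rwa [Finset.sum_neg_distrib, neg_neg] at this

theorem disksCutoffDeriv_apply (A : Finset ℂ) (s : ℝ) (p q : ℂ → ℝ) (z : ℂ) :
    p z * disksCutoffDeriv A s z 1 + q z * disksCutoffDeriv A s z I =
      ∑ a ∈ A, deriv (cutoff s) ‖z - a‖ * radialPart a p q (z - a) := by
  simp only [disksCutoffDeriv, sum_apply, smul_apply, reMul_apply, smul_eq_mul, mul_one,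
    radialPart, add_sub_cancel, Finset.mul_sum, ← Finset.sum_add_distrib]
  exact Finset.sum_congr rfl fun a _ => by ring

theorem disksCutoff_eq_one (hs : 0 < s) (hz : ∀ a ∈ A, 1 + 2 * s ≤ ‖z - a‖) :
    disksCutoff A s z = 1 := by
  rw [disksCutoff, Finset.sum_eq_zero fun a ha => by rw [cutoff_eq_one hs (hz a ha), sub_self],
    sub_zero]

namespace SeparatedDisks

theorem disksCutoff_eventuallyEq_zero (h : SeparatedDisks A r X Y) (hs : 0 < s)
    (hr : 1 + 2 * s ≤ r) (ha : a ∈ A) (hz : ‖z - a‖ ≤ 1) : disksCutoff A s =ᶠ[𝓝 z] 0 := by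
  have hnear : ∀ᶠ w in 𝓝 z, ‖w - a‖ < 1 + s :=
    (continuous_id.sub continuous_const).norm.continuousAt.eventually_lt continuousAt_const
      (show ‖z - a‖ < 1 + s by linarith)
  filter_upwards [hnear] with w hw
  rw [disksCutoff, Finset.sum_eq_single_of_mem a ha fun b hb hba => ?_, cutoff_eq_zero hs hw.le]
  · simp
  · rw [cutoff_eq_one hs (hr.trans (h.lt_norm_sub a ha b hb hba w (by linarith)).le), sub_self]

theorem continuousOn_disksCutoff_mul (h : SeparatedDisks A r X Y) (hs : 0 < s)
    (hr : 1 + 2 * s ≤ r) (hf : ContinuousOn f (perforatedRect A X Y)) :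
    ContinuousOn (fun z => disksCutoff A s z * f z) {z | |z.re| ≤ X ∧ |z.im| ≤ Y} := by
  intro z hz
  by_cases hA : ∀ a ∈ A, 1 < ‖z - a‖
  · refine (hasFDerivAt_disksCutoff hs A z).continuousAt.continuousWithinAt.mul ?_
    refine (hf z ⟨hz, fun a ha => (hA a ha).le⟩).mono_of_mem_nhdsWithin ?_
    have hnear : ∀ᶠ w in 𝓝 z, ∀ a ∈ A, 1 < ‖w - a‖ := (Filter.eventually_all_finset A).2
      fun a ha => continuousAt_const.eventually_lt
        (continuous_id.sub continuous_const).norm.continuousAt (hA a ha)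
    filter_upwards [self_mem_nhdsWithin, nhdsWithin_le_nhds hnear] with w hw hwA
      using ⟨hw, fun a ha => (hwA a ha).le⟩
  · push Not at hA
    obtain ⟨a, ha, hza⟩ := hA
    refine (continuousAt_const (y := (0 : ℝ)).congr ?_).continuousWithinAt
    filter_upwards [h.disksCutoff_eventuallyEq_zero hs hr ha hza] with w hw
    rw [hw, Pi.zero_apply, zero_mul]

theorem hasFDerivAt_disksCutoff_mul (h : SeparatedDisks A r X Y) (hs : 0 < s)
    (hr : 1 + 2 * s ≤ r) (hf : ∀ z ∈ openPerforatedRect A X Y, DifferentiableAt ℝ f z)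
    (hre : |z.re| < X) (him : |z.im| < Y) :
    HasFDerivAt (fun z => disksCutoff A s z * f z)
      (disksCutoff A s z • (openPerforatedRect A X Y).indicator (fderiv ℝ f) z +
        f z • disksCutoffDeriv A s z) z := by
  have hψ := hasFDerivAt_disksCutoff hs A z
  by_cases hA : ∀ a ∈ A, 1 < ‖z - a‖
  · have hz : z ∈ openPerforatedRect A X Y := ⟨⟨hre, him⟩, hA⟩
    rw [indicator_of_mem hz]
    exact hψ.mul (hf z hz).hasFDerivAt
  · have hz : z ∉ openPerforatedRect A X Y := fun hz => hA hz.2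
    push Not at hA
    obtain ⟨a, ha, hza⟩ := hA
    have hzero := h.disksCutoff_eventuallyEq_zero hs hr ha hza
    have hψ0 : disksCutoffDeriv A s z = 0 :=
      hψ.unique ((hasFDerivAt_const (0 : ℝ) z).congr_of_eventuallyEq hzero)
    rw [indicator_of_notMem hz, hψ0, smul_zero, smul_zero, add_zero]
    refine (hasFDerivAt_const (0 : ℝ) z).congr_of_eventuallyEq ?_
    filter_upwards [hzero] with w hw
    rw [hw, Pi.zero_apply, zero_mul]

theorem continuousOn_radialPart (h : SeparatedDisks A r X Y) (ha : a ∈ A)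
    (hp : ContinuousOn p (perforatedRect A X Y)) (hq : ContinuousOn q (perforatedRect A X Y)) :
    ContinuousOn (radialPart a p q) (annulus r) :=
  TwoRows.continuousOn_radialPart hp hq fun ζ hζ => by
    have hζa : ‖a + ζ - a‖ = ‖ζ‖ := by rw [add_sub_cancel_left]
    obtain ⟨hre, him⟩ := h.mem_rect a ha (a + ζ) (hζa.le.trans hζ.2)
    refine ⟨⟨hre.le, him.le⟩, fun b hb => ?_⟩
    rcases eq_or_ne b a with rfl | hba
    · exact hζ.1.trans_eq hζa.symm
    · exact (hζ.1.trans hζ.2).trans (h.lt_norm_sub a ha b hb hba _ (hζa.le.trans hζ.2)).le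

theorem rectFlux_disksCutoff_mul (h : SeparatedDisks A r X Y) (hs : 0 < s) (hr : 1 + 2 * s ≤ r)
    (hX : 0 ≤ X) (hY : 0 ≤ Y) (hp : ContinuousOn p (perforatedRect A X Y))
    (hq : ContinuousOn q (perforatedRect A X Y))
    (hdp : ∀ z ∈ openPerforatedRect A X Y, DifferentiableAt ℝ p z)
    (hdq : ∀ z ∈ openPerforatedRect A X Y, DifferentiableAt ℝ q z)
    (hdiv : ∀ z ∈ openPerforatedRect A X Y, fderiv ℝ p z 1 + fderiv ℝ q z I = 0) :
    rectFlux X Y (fun z => disksCutoff A s z * p z) (fun z => disksCutoff A s z * q z) =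
      ∑ a ∈ A, ∫ z, deriv (cutoff s) ‖z‖ * radialPart a p q z := by
  have hint : ∀ a ∈ A,
      Integrable fun z => deriv (cutoff s) ‖z - a‖ * radialPart a p q (z - a) := fun a ha =>
    (integrable_deriv_cutoff_norm_mul hs hr (h.continuousOn_radialPart ha hp hq)).comp_sub_right a
  rw [rectFlux_eq_integral hX hY (h.continuousOn_disksCutoff_mul hs hr hp)
    (h.continuousOn_disksCutoff_mul hs hr hq)
    (fun z => h.hasFDerivAt_disksCutoff_mul hs hr hdp)
    (fun z => h.hasFDerivAt_disksCutoff_mul hs hr hdq) (fun z => ?_)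
    (integrable_finsetSum A hint) fun z hz => ?_, integral_finsetSum A hint]
  · exact Finset.sum_congr rfl fun a _ =>
      integral_sub_right_eq_self (fun z => deriv (cutoff s) ‖z‖ * radialPart a p q z) a
  · have hdiv' : (openPerforatedRect A X Y).indicator (fderiv ℝ p) z 1 +
        (openPerforatedRect A X Y).indicator (fderiv ℝ q) z I = 0 := by
      by_cases hz : z ∈ openPerforatedRect A X Y
      · simpa only [indicator_of_mem hz] using hdiv z hz
      · simp only [indicator_of_notMem hz, zero_apply, add_zero]
    rw [← disksCutoffDeriv_apply]
    simp only [add_apply, smul_apply, smul_eq_mul]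
    linear_combination disksCutoff A s z * hdiv'
  · obtain ⟨a, ha, hne⟩ := Finset.exists_ne_zero_of_sum_ne_zero hz
    refine h.mem_rect a ha z (not_lt.1 fun hlt => hne ?_)
    rw [deriv_cutoff_eq_zero_of_gt hs (hr.trans_lt hlt), zero_mul]

theorem rectFlux_disksCutoff_mul_eq (h : SeparatedDisks A r X Y) (hs : 0 < s)
    (hr : 1 + 2 * s ≤ r) (hX : 0 ≤ X) (hY : 0 ≤ Y) (p q : ℂ → ℝ) :
    rectFlux X Y (fun z => disksCutoff A s z * p z) (fun z => disksCutoff A s z * q z) =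
      rectFlux X Y p q := by
  have hone : ∀ z : ℂ, (|z.re| = X ∨ |z.im| = Y) → disksCutoff A s z = 1 := fun z hz =>
    disksCutoff_eq_one hs fun a ha => hr.trans <| le_of_not_ge fun hza => by
      obtain ⟨hre, him⟩ := h.mem_rect a ha z hza
      exact hz.elim hre.ne him.ne
  have hright : ∀ y, disksCutoff A s (equivRealProdCLM.symm (X, y)) = 1 := fun _ =>
    hone _ (Or.inl (abs_of_nonneg hX))
  have hleft : ∀ y, disksCutoff A s (equivRealProdCLM.symm (-X, y)) = 1 := fun _ =>
    hone _ (Or.inl ((abs_neg X).trans (abs_of_nonneg hX)))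
  have htop : ∀ x, disksCutoff A s (equivRealProdCLM.symm (x, Y)) = 1 := fun _ =>
    hone _ (Or.inr (abs_of_nonneg hY))
  have hbottom : ∀ x, disksCutoff A s (equivRealProdCLM.symm (x, -Y)) = 1 := fun _ =>
    hone _ (Or.inr ((abs_neg Y).trans (abs_of_nonneg hY)))
  simp only [rectFlux, hright, hleft, htop, hbottom, one_mul]

/-- The field is only continuous up to the circles, so the divergence theorem is applied to the
field multiplied by `disksCutoff A s`; the circle fluxes appear in the limit `s → 0`. -/
theorem rectFlux_eq_sum_circleFlux (h : SeparatedDisks A r X Y) (hr : 1 < r) (hX : 0 ≤ X)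
    (hY : 0 ≤ Y) (hp : ContinuousOn p (perforatedRect A X Y))
    (hq : ContinuousOn q (perforatedRect A X Y))
    (hdp : ∀ z ∈ openPerforatedRect A X Y, DifferentiableAt ℝ p z)
    (hdq : ∀ z ∈ openPerforatedRect A X Y, DifferentiableAt ℝ q z)
    (hdiv : ∀ z ∈ openPerforatedRect A X Y, fderiv ℝ p z 1 + fderiv ℝ q z I = 0) :
    rectFlux X Y p q = ∑ a ∈ A, circleFlux a p q := by
  have hlim : Tendsto (fun s => ∑ a ∈ A, ∫ z, deriv (cutoff s) ‖z‖ * radialPart a p q z)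
      (𝓝[>] 0) (𝓝 (∑ a ∈ A, circleFlux a p q)) := tendsto_finsetSum A fun a ha => by
    rw [← integral_radialPart]
    exact tendsto_integral_deriv_cutoff_norm_mul hr (h.continuousOn_radialPart ha hp hq)
  refine tendsto_nhds_unique (tendsto_const_nhds.congr' ?_) hlim
  filter_upwards [Ioo_mem_nhdsGT (half_pos (sub_pos.2 hr))] with s hs
  have hsr : 1 + 2 * s ≤ r := by linarith [hs.2]
  rw [← h.rectFlux_disksCutoff_mul_eq hs.1 hsr hX hY,
    h.rectFlux_disksCutoff_mul hs.1 hsr hX hY hp hq hdp hdq hdiv]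

end SeparatedDisks

end PerforatedRectangle

/-! ### Lines carrying little energy -/

section LineEnergy

variable {v : ℂ → ℝ}

/-- The energy density `|∇v|²`, valued in `[0, ∞]` so that it can be integrated unconditionally. -/
def energyDensity (v : ℂ → ℝ) (z : ℂ) : ENNReal := ENNReal.ofReal (‖fderiv ℝ v z‖ ^ 2)

theorem measurable_energyDensity (v : ℂ → ℝ) : Measurable (energyDensity v) :=
  ((measurable_fderiv ℝ v).norm.pow_const 2).ennreal_ofReal

theorem integral_abs_le_of_lintegral_sq_le {g : ℝ → ℝ} {a b t E : ℝ} (hab : a ≤ b)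
    (hg : ContinuousOn g (Icc a b)) (ht : 0 < t) (hE₀ : 0 ≤ E)
    (hE : ∫⁻ x in Ioc a b, ENNReal.ofReal (g x ^ 2) ≤ ENNReal.ofReal E) :
    ∫ x in a..b, |g x| ≤ t * (b - a) + E / t := by
  have hg' : ContinuousOn g [[a, b]] := by rwa [uIcc_of_le hab]
  have hsq_int : IntervalIntegrable (fun x => g x ^ 2) volume a b := (hg'.pow 2).intervalIntegrable
  have hsq : ∫ x in a..b, g x ^ 2 ≤ E := by
    rw [intervalIntegral.integral_of_le hab, ← ENNReal.ofReal_le_ofReal_iff hE₀,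
      ofReal_integral_eq_lintegral_ofReal
        ((intervalIntegrable_iff_integrableOn_Ioc_of_le hab).1 hsq_int)
        (Eventually.of_forall fun x => sq_nonneg _)]
    exact hE
  have hyoung : ∀ x, |g x| ≤ t + g x ^ 2 / t := fun x => by
    have : |g x| * t ≤ t * t + g x ^ 2 := by
      nlinarith [sq_nonneg (|g x| - t), sq_abs (g x), sq_nonneg (|g x|), sq_nonneg t]
    rw [← sub_le_iff_le_add', le_div_iff₀ ht]
    linarith
  calc ∫ x in a..b, |g x|
      ≤ ∫ x in a..b, (t + g x ^ 2 / t) :=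
        intervalIntegral.integral_mono_on hab hg'.abs.intervalIntegrable
          (intervalIntegrable_const.add (hsq_int.div_const t)) fun x _ => hyoung x
    _ = t * (b - a) + (∫ x in a..b, g x ^ 2) / t := by
        rw [intervalIntegral.integral_add intervalIntegrable_const (hsq_int.div_const t),
          intervalIntegral.integral_const, intervalIntegral.integral_div, smul_eq_mul, mul_comm]
    _ ≤ t * (b - a) + E / t := by gcongr

theorem integral_abs_fderiv_le {γ : ℝ → ℂ} {w : ℂ} {a b t E : ℝ} (hγ : Continuous γ)
    (hw : ‖w‖ = 1) (hab : a ≤ b) (hv : ∀ x ∈ Icc a b, ContDiffAt ℝ 1 v (γ x)) (ht : 0 < t)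
    (hE₀ : 0 ≤ E) (hE : ∫⁻ x in Ioc a b, energyDensity v (γ x) ≤ ENNReal.ofReal E) :
    ∫ x in a..b, |fderiv ℝ v (γ x) w| ≤ t * (b - a) + E / t := by
  refine integral_abs_le_of_lintegral_sq_le hab (fun x hx => ?_) ht hE₀
    ((lintegral_mono fun x => ENNReal.ofReal_le_ofReal ?_).trans hE)
  · exact ((((hv x hx).continuousAt_fderiv one_ne_zero).comp hγ.continuousAt).clm_apply
      continuousAt_const).continuousWithinAt
  · rw [← sq_abs]
    gcongr
    simpa [hw] using (fderiv ℝ v (γ x)).le_opNorm w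

theorem abs_sub_le_of_lintegral_energyDensity_le {γ : ℝ → ℂ} {w : ℂ} {a b E : ℝ}
    (hγ : ∀ x, HasDerivAt γ w x) (hw : ‖w‖ = 1) (hab : a ≤ b)
    (hv : ∀ x ∈ Icc a b, ContDiffAt ℝ 1 v (γ x)) (hE₀ : 0 ≤ E)
    (hE : ∫⁻ x in Ioc a b, energyDensity v (γ x) ≤ ENNReal.ofReal E) :
    |v (γ b) - v (γ a)| ≤ (b - a) + E := by
  have hcont : Continuous γ := continuous_iff_continuousAt.2 fun x => (hγ x).continuousAt
  have hderiv : ∀ x ∈ [[a, b]], HasDerivAt (v ∘ γ) (fderiv ℝ v (γ x) w) x := fun x hx =>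
    ((hv x (uIcc_of_le hab ▸ hx)).differentiableAt one_ne_zero).hasFDerivAt.comp_hasDerivAt x (hγ x)
  have hint : IntervalIntegrable (fun x => fderiv ℝ v (γ x) w) volume a b :=
    ContinuousOn.intervalIntegrable fun x hx =>
      ((((hv x (uIcc_of_le hab ▸ hx)).continuousAt_fderiv one_ne_zero).comp
        hcont.continuousAt).clm_apply continuousAt_const).continuousWithinAt
  calc |v (γ b) - v (γ a)|
      = |∫ x in a..b, fderiv ℝ v (γ x) w| :=
        congr_arg _ (intervalIntegral.integral_eq_sub_of_hasDerivAt hderiv hint).symm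
    _ ≤ ∫ x in a..b, |fderiv ℝ v (γ x) w| := intervalIntegral.abs_integral_le_integral_abs hab
    _ ≤ 1 * (b - a) + E / 1 := integral_abs_fderiv_le hcont hw hab hv one_pos hE₀ hE
    _ = (b - a) + E := by rw [one_mul, div_one]

end LineEnergy

section FarLines

variable {v : ℂ → ℝ} {R Y y₀ : ℝ}

theorem hasDerivAt_horizontal (x y : ℝ) :
    HasDerivAt (fun x : ℝ => equivRealProdCLM.symm (x, y)) 1 x :=
  (equivRealProdCLM.symm : ℝ × ℝ →L[ℝ] ℂ).hasFDerivAt.comp_hasDerivAt x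
    ((hasDerivAt_id x).prodMk (hasDerivAt_const x y))

theorem hasDerivAt_vertical (x y : ℝ) :
    HasDerivAt (fun y : ℝ => equivRealProdCLM.symm (x, y)) I y :=
  (equivRealProdCLM.symm : ℝ × ℝ →L[ℝ] ℂ).hasFDerivAt.comp_hasDerivAt y
    ((hasDerivAt_const y x).prodMk (hasDerivAt_id y))

theorem exists_le_of_lintegral_lt_top {f : ℝ → ENNReal} (hf : Measurable f)
    (hint : ∫⁻ x in {x | R < |x|}, f x < ⊤) {η : ENNReal} (hη : 0 < η) (X₀ : ℝ) :
    ∃ X ≥ X₀, f X ≤ η ∧ f (-X) ≤ η := by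
  by_contra! hlarge
  set M := max X₀ R
  have hpos : ∫⁻ x in Ioi M, f x < ⊤ :=
    (lintegral_mono_set fun x (hx : M < x) => show R < |x| from
      ((le_max_right _ _).trans_lt hx).trans_le (le_abs_self x)).trans_lt hint
  have hneg : ∫⁻ x in Ioi M, f (-x) < ⊤ := by
    have hpre : Ioi M = Neg.neg ⁻¹' Iio (-M) := by simp
    rw [hpre, (Measure.measurePreserving_neg (volume : Measure ℝ)).setLIntegral_comp_preimage
      measurableSet_Iio hf]
    exact (lintegral_mono_set fun x (hx : x < -M) => show R < |x| from
      ((le_max_right _ _).trans_lt (lt_neg.1 hx)).trans_le (neg_le_abs x)).trans_lt hint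
  have hadd : ∫⁻ x in Ioi M, (f x + f (-x)) < ⊤ := by
    rw [lintegral_add_left hf]
    exact ENNReal.add_lt_top.2 ⟨hpos, hneg⟩
  have hle : ∫⁻ _ in Ioi M, η ≤ ∫⁻ x in Ioi M, (f x + f (-x)) := by
    refine setLIntegral_mono' measurableSet_Ioi fun x hx => ?_
    by_cases hfx : f x ≤ η
    · exact (hlarge x ((le_max_left _ _).trans (le_of_lt hx)) hfx).le.trans le_add_self
    · exact (not_le.1 hfx).le.trans le_self_add
  rw [setLIntegral_const, Real.volume_Ioi, ENNReal.mul_top hη.ne'] at hle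
  exact hadd.not_ge hle

/-- The two ends `|x| > R` of the strip `|y| < Y`. -/
def farStrip (R Y : ℝ) : Set ℂ := {z | R < |z.re| ∧ |z.im| < Y}

theorem setLIntegral_farStrip {F : ℂ → ENNReal} (hF : Measurable F) (R Y : ℝ) :
    ∫⁻ z in farStrip R Y, F z = ∫⁻ q in {x | R < |x|} ×ˢ Ioo (-Y) Y,
      F (equivRealProdCLM.symm q) := by
  have hmeas : MeasurableSet (farStrip R Y) :=
    ((isOpen_lt continuous_const (continuous_abs.comp continuous_re)).inter
      (isOpen_lt (continuous_abs.comp continuous_im) continuous_const)).measurableSet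
  have hpre : {x | R < |x|} ×ˢ Ioo (-Y) Y = measurableEquivRealProd.symm ⁻¹' farStrip R Y := by
    ext q
    exact and_congr_right fun _ => abs_lt.symm
  rw [hpre]
  exact (volume_preserving_equiv_real_prod.symm.setLIntegral_comp_preimage hmeas hF).symm

theorem exists_horizontal_lintegral_lt_top {F : ℂ → ENNReal} (hF : Measurable F) (hY : 0 < Y)
    (hint : ∫⁻ z in farStrip R Y, F z < ⊤) :
    ∃ y₀, |y₀| < Y ∧ ∫⁻ x in {x | R < |x|}, F (equivRealProdCLM.symm (x, y₀)) < ⊤ := by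
  have hF' : Measurable fun q : ℝ × ℝ => F (equivRealProdCLM.symm q) :=
    hF.comp equivRealProdCLM.symm.continuous.measurable
  rw [setLIntegral_farStrip hF, Measure.volume_eq_prod, ← Measure.prod_restrict,
    lintegral_prod_symm' _ hF'] at hint
  have hne : NeBot (ae (volume.restrict (Ioo (-Y) Y))) := by
    rw [ae_restrict_neBot, Real.volume_Ioo]
    simpa using hY
  obtain ⟨y₀, hfin, hy₀⟩ := ((ae_lt_top hF'.lintegral_prod_left' hint.ne).and
    (ae_restrict_mem measurableSet_Ioo)).exists
  exact ⟨y₀, abs_lt.2 hy₀, hfin⟩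

theorem exists_vertical_lintegral_le {F : ℂ → ENNReal} (hF : Measurable F)
    (hint : ∫⁻ z in farStrip R Y, F z < ⊤) {η : ENNReal} (hη : 0 < η) (X₀ : ℝ) :
    ∃ X ≥ X₀, ∀ x, |x| = X → ∫⁻ y in Ioc (-Y) Y, F (equivRealProdCLM.symm (x, y)) ≤ η := by
  have hF' : Measurable fun q : ℝ × ℝ => F (equivRealProdCLM.symm q) :=
    hF.comp equivRealProdCLM.symm.continuous.measurable
  rw [setLIntegral_farStrip hF, Measure.volume_eq_prod, ← Measure.prod_restrict,
    lintegral_prod _ hF'.aemeasurable] at hint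
  obtain ⟨X, hX, hright, hleft⟩ :=
    exists_le_of_lintegral_lt_top hF'.lintegral_prod_right' hint hη X₀
  rw [Measure.restrict_congr_set Ioo_ae_eq_Ioc] at hright hleft
  refine ⟨X, hX, fun x hx => ?_⟩
  rcases eq_or_eq_neg_of_abs_eq hx with rfl | rfl
  exacts [hright, hleft]

theorem exists_abs_le_add_abs_on_horizontal
    (hv : ∀ z : ℂ, R < |z.re| → |z.im| ≤ Y → ContDiffAt ℝ 1 v z) (hy₀ : |y₀| ≤ Y)
    (hE : ∫⁻ x in {x | R < |x|}, energyDensity v (equivRealProdCLM.symm (x, y₀)) < ⊤) :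
    ∃ A, ∀ x, R + 1 ≤ |x| → |v (equivRealProdCLM.symm (x, y₀))| ≤ A + |x| := by
  set γ : ℝ → ℂ := fun x => equivRealProdCLM.symm (x, y₀)
  set E := (∫⁻ x in {x | R < |x|}, energyDensity v (γ x)).toReal
  have hosc : ∀ a b, a ≤ b → Icc a b ⊆ {x | R < |x|} → |v (γ b) - v (γ a)| ≤ (b - a) + E :=
    fun a b hab hsub => abs_sub_le_of_lintegral_energyDensity_le
      (fun x => hasDerivAt_horizontal x y₀) norm_one hab (fun x hx => hv _ (hsub hx) hy₀)
      ENNReal.toReal_nonneg ((lintegral_mono_set (Ioc_subset_Icc_self.trans hsub)).trans_eq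
        (ENNReal.ofReal_toReal hE.ne).symm)
  refine ⟨|v (γ (R + 1))| + |v (γ (-(R + 1)))| + E + |R + 1|, fun x hx => ?_⟩
  have hright := abs_nonneg (v (γ (R + 1)))
  have hleft := abs_nonneg (v (γ (-(R + 1))))
  have hR := neg_abs_le (R + 1)
  rcases le_abs'.1 hx with hneg | hpos
  · have hvar := hosc x (-(R + 1)) hneg fun u hu =>
      show R < |u| from (by linarith [hu.2] : R < -u).trans_le (neg_le_abs u)
    have htri := abs_sub_abs_le_abs_sub (v (γ x)) (v (γ (-(R + 1))))
    rw [abs_sub_comm] at htri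
    linarith [neg_le_abs x]
  · have hvar := hosc (R + 1) x hpos fun u hu =>
      show R < |u| from (by linarith [hu.1] : R < u).trans_le (le_abs_self u)
    have htri := abs_sub_abs_le_abs_sub (v (γ x)) (v (γ (R + 1)))
    linarith [le_abs_self x]

theorem abs_le_of_vertical {x E B : ℝ} (hv : ∀ y, |y| ≤ Y → ContDiffAt ℝ 1 v
      (equivRealProdCLM.symm (x, y))) (hE₀ : 0 ≤ E)
    (hE : ∫⁻ y in Ioc (-Y) Y, energyDensity v (equivRealProdCLM.symm (x, y)) ≤ ENNReal.ofReal E)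
    (hy₀ : |y₀| ≤ Y) (hB : |v (equivRealProdCLM.symm (x, y₀))| ≤ B) {y : ℝ} (hy : |y| ≤ Y) :
    |v (equivRealProdCLM.symm (x, y))| ≤ B + (2 * Y + E) := by
  set γ : ℝ → ℂ := fun y => equivRealProdCLM.symm (x, y)
  have hosc : ∀ a b, |a| ≤ Y → |b| ≤ Y → a ≤ b → |v (γ b) - v (γ a)| ≤ 2 * Y + E :=
    fun a b ha hb hab => by
      have hsub : Icc a b ⊆ Icc (-Y) Y := Icc_subset_Icc (abs_le.1 ha).1 (abs_le.1 hb).2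
      have := abs_sub_le_of_lintegral_energyDensity_le (hasDerivAt_vertical x) norm_I hab
        (fun y hy => hv y (abs_le.2 (hsub hy))) hE₀ ((lintegral_mono_set
          (Ioc_subset_Ioc (abs_le.1 ha).1 (abs_le.1 hb).2)).trans hE)
      linarith [(abs_le.1 ha).1, (abs_le.1 hb).2]
  have hdist : |v (γ y) - v (γ y₀)| ≤ 2 * Y + E := by
    rcases le_total y₀ y with h | h
    · exact hosc y₀ y hy₀ hy h
    · rw [abs_sub_comm]
      exact hosc y y₀ hy hy₀ h
  linarith [abs_sub_abs_le_abs_sub (v (γ y)) (v (γ y₀))]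

/-- Linear growth of `v` is harmless because Green's identity multiplies `v` by an exponentially
decaying gradient. -/
theorem exists_far_lines (hY : 0 < Y)
    (hv : ∀ z : ℂ, R < |z.re| → |z.im| ≤ Y → ContDiffAt ℝ 1 v z)
    (hE : ∫⁻ z in farStrip R Y, energyDensity v z < ⊤) :
    ∃ A, ∀ t > 0, ∀ X₀, ∃ X ≥ X₀, ∀ x, |x| = X →
      (∀ y, |y| ≤ Y → |v (equivRealProdCLM.symm (x, y))| ≤ A + X) ∧
      ∫ y in (-Y)..Y, |fderiv ℝ v (equivRealProdCLM.symm (x, y)) 1| ≤ t := by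
  obtain ⟨y₀, hy₀, hEy₀⟩ :=
    exists_horizontal_lintegral_lt_top (measurable_energyDensity v) hY hE
  obtain ⟨A, hA⟩ := exists_abs_le_add_abs_on_horizontal hv hy₀.le hEy₀
  refine ⟨A + (2 * Y + 1), fun t ht X₀ => ?_⟩
  set τ := t / (4 * Y) with hτ
  have hτ₀ : 0 < τ := by positivity
  set η := min 1 (τ * (t / 2))
  have hη : 0 < η := lt_min one_pos (by positivity)
  obtain ⟨X, hX, hline⟩ := exists_vertical_lintegral_le (measurable_energyDensity v) hE
    (ENNReal.ofReal_pos.2 hη) (max X₀ (R + 1))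
  refine ⟨X, (le_max_left _ _).trans hX, fun x hx => ?_⟩
  have hR : R + 1 ≤ |x| := hx ▸ (le_max_right _ _).trans hX
  have hvx : ∀ y, |y| ≤ Y → ContDiffAt ℝ 1 v (equivRealProdCLM.symm (x, y)) := fun y hy =>
    hv _ (show R < |x| by linarith) hy
  constructor
  · intro y hy
    have := abs_le_of_vertical hvx hη.le (hline x hx) hy₀.le (hA x hR) hy
    linarith [min_le_left 1 (τ * (t / 2))]
  · have hητ : η / τ ≤ t / 2 := by
      rw [div_le_iff₀' hτ₀]
      exact min_le_right _ _
    have hτY : τ * (Y - -Y) = t / 2 := by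
      rw [hτ]
      field_simp
      ring
    have := integral_abs_fderiv_le
      (continuous_iff_continuousAt.2 fun y => (hasDerivAt_vertical x y).continuousAt) norm_one
      (neg_le_self hY.le) (fun y hy => hvx y (abs_le.2 hy)) hτ₀ hη.le (hline x hx)
    linarith

end FarLines

/-! ### Green's identity in the cell -/

section SeparatedPair

variable {P c X Y : ℝ}

theorem exists_separatedDisks_pair (hY : 1 < Y) (hc : 1 < c) (hX : c + 1 < X) :
    ∃ r > 1, SeparatedDisks {(c : ℂ), -(c : ℂ)} r X Y := by
  obtain ⟨r, hr, hr'⟩ := exists_between (lt_min hc (lt_min hY (by linarith : 1 < X - c)))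
  obtain ⟨hrc, hrY, hrX⟩ : r < c ∧ r < Y ∧ r < X - c := by simpa only [lt_min_iff] using hr'
  have hbound : ∀ {z a : ℂ}, ‖z - a‖ ≤ r → |z.re - a.re| ≤ r ∧ |z.im - a.im| ≤ r := fun hz =>
    ⟨by simpa using (abs_re_le_norm _).trans hz, by simpa using (abs_im_le_norm _).trans hz⟩
  refine ⟨r, hr, ⟨fun a ha z hz => ?_, fun a ha b hb hba z hz => ?_⟩⟩
  · obtain ⟨hre, him⟩ := hbound hz
    rw [Finset.mem_insert, Finset.mem_singleton] at ha
    rw [abs_le] at hre him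
    rw [abs_lt, abs_lt]
    rcases ha with rfl | rfl <;> simp only [neg_re, neg_im, ofReal_re, ofReal_im] at hre him <;>
      refine ⟨⟨?_, ?_⟩, ?_, ?_⟩ <;> linarith
  · have hsep : ‖a - b‖ = 2 * c := by
      have hcc : ‖(c : ℂ) + c‖ = 2 * c := by
        rw [← two_mul, norm_mul, RCLike.norm_ofNat, norm_real, Real.norm_of_nonneg (by linarith)]
      rw [Finset.mem_insert, Finset.mem_singleton] at ha hb
      rcases ha with rfl | rfl <;> rcases hb with rfl | rfl
      · exact absurd rfl hba
      · rw [sub_neg_eq_add, hcc]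
      · rw [← norm_neg, neg_sub, sub_neg_eq_add, hcc]
      · exact absurd rfl hba
    have htri : ‖a - b‖ ≤ ‖z - a‖ + ‖z - b‖ := by
      rw [norm_sub_rev z a]
      exact norm_sub_le_norm_sub_add_norm_sub a z b
    linarith

theorem rectFlux_eq_circleFlux_add (hP : 2 < P) (hc : 1 < c) (hX : c + 1 < X) {p q : ℂ → ℝ}
    (hp : ContinuousOn p (closedCell P c)) (hq : ContinuousOn q (closedCell P c))
    (hdp : ∀ z ∈ openCell P c, DifferentiableAt ℝ p z)
    (hdq : ∀ z ∈ openCell P c, DifferentiableAt ℝ q z)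
    (hdiv : ∀ z ∈ openCell P c, fderiv ℝ p z 1 + fderiv ℝ q z I = 0) :
    rectFlux X (P / 2) p q = circleFlux c p q + circleFlux (-c) p q := by
  obtain ⟨r, hr, hsep⟩ := exists_separatedDisks_pair (by linarith : 1 < P / 2) hc hX
  have hclosed : perforatedRect {(c : ℂ), -(c : ℂ)} X (P / 2) ⊆ closedCell P c := fun z hz =>
    ⟨hz.1.2, hz.2 c (by simp), by simpa using hz.2 (-c) (by simp)⟩
  have hopen : openPerforatedRect {(c : ℂ), -(c : ℂ)} X (P / 2) ⊆ openCell P c := fun z hz =>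
    ⟨hz.1.2, hz.2 c (by simp), by simpa using hz.2 (-c) (by simp)⟩
  have hne : (c : ℂ) ≠ -(c : ℂ) := self_ne_neg.2 (ofReal_ne_zero.2 (by linarith))
  rw [hsep.rectFlux_eq_sum_circleFlux hr (by linarith) (by linarith) (hp.mono hclosed)
    (hq.mono hclosed) (fun z hz => hdp z (hopen hz)) (fun z hz => hdq z (hopen hz))
    (fun z hz => hdiv z (hopen hz)), Finset.sum_pair hne]

end SeparatedPair

section GreenField

variable {S : Set ℂ} {v φ : ℂ → ℝ} {z : ℂ}

/-- The component in the direction `w` of `v ∇φ - φ ∇v`, with gradients taken from within `S`. -/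
def greenField (S : Set ℂ) (v φ : ℂ → ℝ) (w z : ℂ) : ℝ :=
  v z * fderivWithin ℝ φ S z w - φ z * fderivWithin ℝ v S z w

/-- The outward flux of `v ∇φ - φ ∇v` through the unit circle around `a`. -/
def greenFlux (S : Set ℂ) (v φ : ℂ → ℝ) (a : ℂ) : ℝ :=
  circleFlux a (greenField S v φ 1) (greenField S v φ I)

theorem continuousOn_greenField (hS : UniqueDiffOn ℝ S) (hv : ContDiffOn ℝ 1 v S)
    (hφ : ContDiffOn ℝ 1 φ S) (w : ℂ) : ContinuousOn (greenField S v φ w) S :=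
  (hv.continuousOn.mul ((hφ.continuousOn_fderivWithin hS le_rfl).clm_apply continuousOn_const)).sub
    (hφ.continuousOn.mul ((hv.continuousOn_fderivWithin hS le_rfl).clm_apply continuousOn_const))

theorem exists_hasFDerivAt_partials {f : ℂ → ℝ} (hf : HarmonicAt f z) :
    ∃ G, HasFDerivAt (fun z => fderiv ℝ f z 1) (reMul G) z ∧
      HasFDerivAt (fun z => fderiv ℝ f z I) (reMul (I * G)) z := by
  have hG := (HarmonicAt.differentiableAt_complex_partial hf).hasDerivAt
  refine ⟨deriv (fun z => (fderiv ℝ f z 1 : ℂ) - I * fderiv ℝ f z I) z, ?_, ?_⟩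
  · simpa using hasFDerivAt_re_of_hasDerivAt hG
  · simpa using hasFDerivAt_re_of_hasDerivAt (hG.const_mul I)

theorem hasFDerivAt_greenField {w a b : ℂ} (hS : S ∈ 𝓝 z) (hv : DifferentiableAt ℝ v z)
    (hφ : DifferentiableAt ℝ φ z) (hvw : HasFDerivAt (fun z => fderiv ℝ v z w) (reMul a) z)
    (hφw : HasFDerivAt (fun z => fderiv ℝ φ z w) (reMul b) z) :
    HasFDerivAt (greenField S v φ w) ((v z • reMul b + fderiv ℝ φ z w • fderiv ℝ v z) -
      (φ z • reMul a + fderiv ℝ v z w • fderiv ℝ φ z)) z := by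
  refine ((hv.hasFDerivAt.mul hφw).sub (hφ.hasFDerivAt.mul hvw)).congr_of_eventuallyEq ?_
  filter_upwards [eventually_mem_nhds_iff.2 hS] with x hx
  simp only [greenField, fderivWithin_of_mem_nhds hx, Pi.sub_apply, Pi.mul_apply]

theorem differentiableAt_greenField (hS : S ∈ 𝓝 z) (hv : HarmonicAt v z) (hφ : HarmonicAt φ z) :
    DifferentiableAt ℝ (greenField S v φ 1) z ∧ DifferentiableAt ℝ (greenField S v φ I) z ∧
      fderiv ℝ (greenField S v φ 1) z 1 + fderiv ℝ (greenField S v φ I) z I = 0 := by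
  obtain ⟨a, ha, haI⟩ := exists_hasFDerivAt_partials hv
  obtain ⟨b, hb, hbI⟩ := exists_hasFDerivAt_partials hφ
  have hdv := hv.1.differentiableAt two_ne_zero
  have hdφ := hφ.1.differentiableAt two_ne_zero
  have hre := hasFDerivAt_greenField hS hdv hdφ ha hb
  have him := hasFDerivAt_greenField hS hdv hdφ haI hbI
  refine ⟨hre.differentiableAt, him.differentiableAt, ?_⟩
  have hIaI : ∀ a : ℂ, (I * a * I).re = -a.re := fun a => by
    rw [mul_right_comm, I_mul_I, neg_one_mul, neg_re]
  rw [hre.fderiv, him.fderiv]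
  simp only [sub_apply, add_apply, smul_apply, reMul_apply, smul_eq_mul, mul_one, hIaI]
  ring

end GreenField

section GreenIdentity

variable {P c b B M G t x X : ℝ} {v φ : ℂ → ℝ} {g : ℂ → ℂ} {z : ℂ}

/-- A function that is harmonic in the cell and across its horizontal sides, `C¹` up to the
circles, and has a `P`-periodic gradient of finite energy. Green's identity is applied to the
difference `u - H`, which has these properties. -/
structure PeriodicGradient (P c : ℝ) (v : ℂ → ℝ) : Prop where
  harmonic : ∀ z : ℂ, |z.im| ≤ P / 2 → 1 < ‖z - c‖ → 1 < ‖z + c‖ → HarmonicAt v z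
  regular : ContDiffOn ℝ 1 v (closedCell P c)
  periodic : ∀ z : ℂ, z.im = -(P / 2) → fderiv ℝ v z = fderiv ℝ v (z + P * I)
  energy : ∫⁻ z in openCell P c, energyDensity v z < ⊤

theorem one_lt_norm_of_lt_abs_re (hz : |c| + 1 < |z.re|) : 1 < ‖z - c‖ ∧ 1 < ‖z + c‖ := by
  refine ⟨lt_of_lt_of_le ?_ (abs_re_le_norm _), lt_of_lt_of_le ?_ (abs_re_le_norm _)⟩
  · rw [sub_re, ofReal_re]
    linarith [abs_sub_abs_le_abs_sub z.re c]
  · rw [add_re, ofReal_re]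
    linarith [abs_sub_abs_le_abs_add z.re c]

theorem tendsto_add_mul_exp_neg (A : ℝ) {κ : ℝ} (hκ : 0 < κ) :
    Tendsto (fun X : ℝ => (A + X) * Real.exp (-(κ * X))) atTop (𝓝 0) := by
  have hexp := tendsto_rpow_mul_exp_neg_mul_atTop_nhds_zero 0 κ hκ
  have hlin := tendsto_rpow_mul_exp_neg_mul_atTop_nhds_zero 1 κ hκ
  have := (hexp.const_mul A).add hlin
  rw [mul_zero, zero_add] at this
  refine this.congr fun X => ?_
  rw [Real.rpow_zero, Real.rpow_one, one_mul, neg_mul]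
  ring

theorem greenField_closedCell_eq (hv : HarmonicAt v z) (h : PeriodicPotential P c φ g b)
    (hP : 2 < P) (hc : 1 < c) (hz : z ∈ closedCell P c) (w : ℂ) :
    greenField (closedCell P c) v φ w z = v z * (g z * w).re - φ z * fderiv ℝ v z w := by
  have huniq := uniqueDiffOn_closedCell hP hc z hz
  rw [greenField, (hv.1.differentiableAt two_ne_zero).fderivWithin huniq,
    (h.hasFDerivAt_of_mem_closedCell hP hz).hasFDerivWithinAt.fderivWithin huniq, reMul_apply]

namespace PeriodicGradient

theorem harmonicAt_of_abs_im (hv : PeriodicGradient P c v) (hP : 2 < P) (hz : |z.im| = P / 2) :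
    HarmonicAt v z :=
  hv.harmonic z hz.le (by linarith [norm_sub_ge_abs_im z c]) (by linarith [norm_add_ge_abs_im z c])

theorem harmonicAt_of_lt_abs_re (hv : PeriodicGradient P c v) (hre : |c| + 1 < |z.re|)
    (him : |z.im| ≤ P / 2) : HarmonicAt v z :=
  hv.harmonic z him (one_lt_norm_of_lt_abs_re hre).1 (one_lt_norm_of_lt_abs_re hre).2

theorem greenField_top_eq_bottom (hv : PeriodicGradient P c v) (h : PeriodicPotential P c φ g b)
    (hconj : ∀ z, φ (conj z) = φ z) (hP : 2 < P) (hc : 1 < c) (x : ℝ) :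
    greenField (closedCell P c) v φ I (equivRealProdCLM.symm (x, P / 2)) =
      greenField (closedCell P c) v φ I (equivRealProdCLM.symm (x, -(P / 2))) := by
  have hshift : equivRealProdCLM.symm (x, -(P / 2)) + P * I = equivRealProdCLM.symm (x, P / 2) :=
    Complex.ext (by simp) (by simp; ring)
  have htop : |(equivRealProdCLM.symm (x, P / 2)).im| = P / 2 :=
    abs_of_pos (show 0 < P / 2 by linarith)
  have hbottom : |(equivRealProdCLM.symm (x, -(P / 2))).im| = P / 2 :=
    (abs_neg (P / 2)).trans htop
  rw [greenField_closedCell_eq (hv.harmonicAt_of_abs_im hP htop) h hP hc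
      (line_subset_closedCell hP htop),
    greenField_closedCell_eq (hv.harmonicAt_of_abs_im hP hbottom) h hP hc
      (line_subset_closedCell hP hbottom),
    h.grad_mul_I_re_eq_zero_of_abs_im hP hconj htop,
    h.grad_mul_I_re_eq_zero_of_abs_im hP hconj hbottom,
    hv.periodic (equivRealProdCLM.symm (x, -(P / 2))) rfl, hshift,
    ← h.periodic (equivRealProdCLM.symm (x, -(P / 2))), hshift, mul_zero, mul_zero]

theorem abs_integral_greenField_le (hv : PeriodicGradient P c v)
    (h : PeriodicPotential P c φ g b) (hP : 2 < P) (hc : 1 < c) (hx : |c| + 1 < |x|)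
    (hM : ∀ y, |y| ≤ P / 2 → |v (equivRealProdCLM.symm (x, y))| ≤ M)
    (hG : ∀ y, |y| ≤ P / 2 → ‖g (equivRealProdCLM.symm (x, y))‖ ≤ G) (hB₀ : 0 ≤ B)
    (hB : ∀ z ∈ closedCell P c, |φ z| ≤ B)
    (ht : ∫ y in (-(P / 2))..(P / 2), |fderiv ℝ v (equivRealProdCLM.symm (x, y)) 1| ≤ t) :
    |∫ y in (-(P / 2))..(P / 2),
      greenField (closedCell P c) v φ 1 (equivRealProdCLM.symm (x, y))| ≤
        P * (M * G) + B * t := by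
  have hP' : -(P / 2) ≤ P / 2 := by linarith
  have hharm : ∀ y, |y| ≤ P / 2 → HarmonicAt v (equivRealProdCLM.symm (x, y)) := fun y hy =>
    hv.harmonicAt_of_lt_abs_re hx hy
  have hcont : ContinuousOn (fun y : ℝ => fderiv ℝ v (equivRealProdCLM.symm (x, y)) 1)
      [[-(P / 2), P / 2]] := fun y hy => by
    rw [uIcc_of_le hP'] at hy
    exact ((ContinuousAt.comp (f := fun y : ℝ => equivRealProdCLM.symm (x, y))
      ((hharm y (abs_le.2 hy)).1.continuousAt_fderiv two_ne_zero)
      (hasDerivAt_vertical x y).continuousAt).clm_apply continuousAt_const).continuousWithinAt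
  have hint : IntervalIntegrable
      (fun y : ℝ => B * |fderiv ℝ v (equivRealProdCLM.symm (x, y)) 1|) volume (-(P / 2)) (P / 2) :=
    (continuousOn_const.mul hcont.abs).intervalIntegrable
  have hpt : ∀ y, |y| ≤ P / 2 →
      ‖greenField (closedCell P c) v φ 1 (equivRealProdCLM.symm (x, y))‖ ≤
        M * G + B * |fderiv ℝ v (equivRealProdCLM.symm (x, y)) 1| := fun y hy => by
    have hmem : equivRealProdCLM.symm (x, y) ∈ closedCell P c :=
      mem_closedCell_of_abs_re hy hx.le
    rw [greenField_closedCell_eq (hharm y hy) h hP hc hmem, mul_one]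
    refine (norm_sub_le _ _).trans (add_le_add ?_ ?_) <;>
      rw [norm_mul, Real.norm_eq_abs, Real.norm_eq_abs]
    · exact mul_le_mul (hM y hy) ((abs_re_le_norm _).trans (hG y hy)) (abs_nonneg _)
        ((abs_nonneg _).trans (hM y hy))
    · exact mul_le_mul_of_nonneg_right (hB _ hmem) (abs_nonneg _)
  refine (intervalIntegral.norm_integral_le_of_norm_le hP' (Eventually.of_forall fun y hy =>
    hpt y (abs_le.2 ⟨hy.1.le, hy.2⟩)) (intervalIntegrable_const.add hint)).trans ?_
  rw [intervalIntegral.integral_add intervalIntegrable_const hint,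
    intervalIntegral.integral_const, intervalIntegral.integral_const_mul, smul_eq_mul,
    sub_neg_eq_add, add_halves]
  gcongr

theorem rectFlux_greenField (hv : PeriodicGradient P c v) (h : PeriodicPotential P c φ g b)
    (hP : 2 < P) (hc : 1 < c) (hX : c + 1 < X) :
    rectFlux X (P / 2) (greenField (closedCell P c) v φ 1) (greenField (closedCell P c) v φ I) =
      greenFlux (closedCell P c) v φ c + greenFlux (closedCell P c) v φ (-c) := by
  have hφ : ∀ z ∈ closedCell P c, HarmonicAt φ z := fun z hz =>
    h.harmonic z (closedCell_subset_wideCell hP hz)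
  have hcont := continuousOn_greenField (uniqueDiffOn_closedCell hP hc) hv.regular
    fun z hz => ((hφ z hz).1.of_le one_le_two).contDiffWithinAt
  have hdiff := fun z (hz : z ∈ openCell P c) => differentiableAt_greenField
    (mem_of_superset ((isOpen_openCell P c).mem_nhds hz) (openCell_subset_closedCell P c))
    (hv.harmonic z hz.1.le hz.2.1 hz.2.2) (hφ z (openCell_subset_closedCell P c hz))
  exact rectFlux_eq_circleFlux_add hP hc hX (hcont 1) (hcont I) (fun z hz => (hdiff z hz).1)
    (fun z hz => (hdiff z hz).2.1) fun z hz => (hdiff z hz).2.2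

theorem exists_abs_greenFlux_add_le (hv : PeriodicGradient P c v)
    (h : PeriodicPotential P c φ g b) (hconj : ∀ z, φ (conj z) = φ z) (hP : 2 < P)
    (hc : 1 < c) : ∃ A B K κ : ℝ, 0 < κ ∧ ∀ t > 0, ∃ᶠ X in atTop,
      |greenFlux (closedCell P c) v φ c + greenFlux (closedCell P c) v φ (-c)| ≤
        2 * (P * K * ((A + X) * Real.exp (-(κ * X))) + B * t) := by
  have hc' : |c| = c := abs_of_pos (by linarith)
  obtain ⟨K, κ, hκ, -, hg⟩ := h.exists_norm_grad_le hP
  obtain ⟨B, hB₀, hB⟩ := h.exists_abs_le hP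
  have hfar : farStrip (c + 1) (P / 2) ⊆ openCell P c := fun z hz =>
    ⟨hz.2, one_lt_norm_of_lt_abs_re (hc'.symm ▸ hz.1)⟩
  obtain ⟨A, hA⟩ := exists_far_lines (R := c + 1) (Y := P / 2) (by linarith)
    (fun z hre him => (hv.harmonicAt_of_lt_abs_re (hc'.symm ▸ hre) him).1.of_le one_le_two)
    ((lintegral_mono_set hfar).trans_lt hv.energy)
  refine ⟨A, B, K, κ, hκ, fun t ht => frequently_atTop.2 fun X₀ => ?_⟩
  obtain ⟨X, hX, hlines⟩ := hA t ht (max X₀ (c + 2))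
  have hXc : c + 2 ≤ X := (le_max_right _ _).trans hX
  have hside : ∀ x, |x| = X → |∫ y in (-(P / 2))..(P / 2),
      greenField (closedCell P c) v φ 1 (equivRealProdCLM.symm (x, y))| ≤
        P * ((A + X) * (K * Real.exp (-(κ * X)))) + B * t := fun x hx => by
    have hxc : |c| + 1 < |x| := by linarith
    exact hv.abs_integral_greenField_le h hP hc hxc (hlines x hx).1
      (fun y hy => hx ▸ hg _ (mem_closedCell_of_abs_re hy hxc.le)) hB₀ hB (hlines x hx).2
  have hright := hside X (abs_of_pos (by linarith))
  have hleft := hside (-X) ((abs_neg X).trans (abs_of_pos (by linarith)))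
  refine ⟨X, (le_max_left _ _).trans hX, ?_⟩
  rw [← hv.rectFlux_greenField h hP hc (by linarith : c + 1 < X), rectFlux]
  simp only [hv.greenField_top_eq_bottom h hconj hP hc, sub_self, zero_add]
  refine (abs_sub _ _).trans ?_
  linarith

theorem greenFlux_add_eq_zero (hv : PeriodicGradient P c v) (h : PeriodicPotential P c φ g b)
    (hconj : ∀ z, φ (conj z) = φ z) (hP : 2 < P) (hc : 1 < c) :
    greenFlux (closedCell P c) v φ c + greenFlux (closedCell P c) v φ (-c) = 0 := by
  obtain ⟨A, B, K, κ, hκ, hle⟩ := hv.exists_abs_greenFlux_add_le h hconj hP hc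
  set Φ := greenFlux (closedCell P c) v φ c + greenFlux (closedCell P c) v φ (-c)
  have hfar : ∀ t > 0, |Φ| ≤ 2 * B * t := fun t ht => by
    have hlim :=
      ((((tendsto_add_mul_exp_neg A hκ).const_mul (P * K)).add_const (B * t)).const_mul 2)
    rw [mul_zero, zero_add, ← mul_assoc] at hlim
    exact ge_of_tendsto_of_frequently hlim (hle t ht)
  have hzero : Tendsto (fun t => 2 * B * t) (𝓝[>] 0) (𝓝 0) :=
    ((continuous_const_mul (2 * B)).tendsto' 0 0 (mul_zero _)).mono_left nhdsWithin_le_nhds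
  exact abs_nonpos_iff.1 (ge_of_tendsto hzero (eventually_mem_nhdsWithin.mono hfar))

end PeriodicGradient

end GreenIdentity

section Reciprocity

variable {ε δ k b cL cR : ℝ} {u v H φ : ℂ → ℝ} {g : ℂ → ℂ} {a : ℂ}

theorem openWideCell_subset_exterior (hδ : 0 < δ) :
    openWideCell (2 + δ) (1 + ε / 2) ⊆ exterior ε δ := by
  refine (Disjoint.closure_right ?_ (isOpen_openWideCell _ _)).subset_compl_right
  rw [disjoint_iUnion_right]
  refine fun n => Set.disjoint_left.2 fun z hz hdisk => ?_
  have hR : z - centerR ε δ n =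
      z - ((1 + ε / 2 : ℝ) : ℂ) - n * ((2 + δ : ℝ) : ℂ) * I := by
    apply Complex.ext <;> simp [centerR]
  have hL : z - centerL ε δ n =
      z + ((1 + ε / 2 : ℝ) : ℂ) - n * ((2 + δ : ℝ) : ℂ) * I := by
    apply Complex.ext <;> simp [centerL]
    ring
  have hfar : ∀ r < 1, r < ‖z - centerR ε δ n‖ ∧ r < ‖z - centerL ε δ n‖ := fun r hr => by
    rw [hR, hL]
    exact wideCell_subset_farSet (by linarith) hr (openWideCell_subset_wideCell _ _ hz) n
  rcases hdisk with hdisk | hdisk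
  · exact (hfar _ (mem_ball_iff_norm.1 hdisk)).2.false
  · exact (hfar _ (mem_ball_iff_norm.1 hdisk)).1.false

theorem uniqueDiffOn_closure_stripDomain (hε : 0 < ε) (hδ : 0 < δ) :
    UniqueDiffOn ℝ (closure (stripDomain ε δ)) := by
  rw [closure_stripDomain hε hδ]
  exact uniqueDiffOn_closedCell (by linarith) (by linarith)

theorem sphere_centerR_subset (hε : 0 < ε) (hδ : 0 < δ) :
    sphere (centerR ε δ 0) 1 ⊆ closure (stripDomain ε δ) := fun z hz => by
  rw [closure_stripDomain hε hδ]
  rw [centerR_zero, mem_sphere_iff_norm] at hz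
  exact circle_subset_closedCell (by linarith) (by linarith) hz

theorem sphere_centerL_subset (hε : 0 < ε) (hδ : 0 < δ) :
    sphere (centerL ε δ 0) 1 ⊆ closure (stripDomain ε δ) := fun z hz => by
  rw [closure_stripDomain hε hδ]
  rw [centerL_zero, mem_sphere_iff_norm, sub_neg_eq_add] at hz
  exact circle_neg_subset_closedCell (by linarith) (by linarith) hz

theorem continuous_normalDeriv_circleMap (hε : 0 < ε) (hδ : 0 < δ)
    (hv : ContDiffOn ℝ 1 v (closure (stripDomain ε δ)))
    (ha : sphere a 1 ⊆ closure (stripDomain ε δ)) :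
    Continuous fun θ => normalDeriv ε δ a v (circleMap a 1 θ) :=
  ((hv.continuousOn_fderivWithin (uniqueDiffOn_closure_stripDomain hε hδ) le_rfl).comp_continuous
    (continuous_circleMap a 1) fun θ => ha (circleMap_mem_sphere a zero_le_one θ)).clm_apply
    (continuous_const.sub (continuous_circleMap a 1))

theorem continuous_mul_normalDeriv_circleMap (hε : 0 < ε) (hδ : 0 < δ)
    (hv : ContDiffOn ℝ 1 v (closure (stripDomain ε δ)))
    (hφ : ContDiffOn ℝ 1 φ (closure (stripDomain ε δ)))
    (ha : sphere a 1 ⊆ closure (stripDomain ε δ)) :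
    Continuous fun θ => v (circleMap a 1 θ) * normalDeriv ε δ a φ (circleMap a 1 θ) :=
  (hv.continuousOn.comp_continuous (continuous_circleMap a 1) fun θ =>
    ha (circleMap_mem_sphere a zero_le_one θ)).mul
      (continuous_normalDeriv_circleMap hε hδ hφ ha)

theorem greenField_circleMap (v φ : ℂ → ℝ) (a : ℂ) (θ : ℝ) :
    Real.cos θ * greenField (closure (stripDomain ε δ)) v φ 1 (circleMap a 1 θ) +
      Real.sin θ * greenField (closure (stripDomain ε δ)) v φ I (circleMap a 1 θ) =
    φ (circleMap a 1 θ) * normalDeriv ε δ a v (circleMap a 1 θ) -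
      v (circleMap a 1 θ) * normalDeriv ε δ a φ (circleMap a 1 θ) := by
  have hν : a - circleMap a 1 θ = -(Real.cos θ • (1 : ℂ) + Real.sin θ • I) := by
    rw [circleMap, sub_add_cancel_left, ofReal_one, one_mul, exp_mul_I, real_smul, real_smul,
      mul_one, ofReal_cos, ofReal_sin]
  simp only [normalDeriv, bdryDeriv, hν, map_neg, map_add, map_smul, smul_eq_mul, greenField]
  ring

theorem greenFlux_eq_neg_circleInt (hε : 0 < ε) (hδ : 0 < δ)
    (hv : ContDiffOn ℝ 1 v (closure (stripDomain ε δ)))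
    (hφ : ContDiffOn ℝ 1 φ (closure (stripDomain ε δ)))
    (ha : sphere a 1 ⊆ closure (stripDomain ε δ)) (hφk : ∀ z ∈ sphere a 1, φ z = k)
    (hflux : circleInt a (normalDeriv ε δ a v) = 0) :
    greenFlux (closure (stripDomain ε δ)) v φ a =
      -circleInt a (fun z => v z * normalDeriv ε δ a φ z) := by
  have hk : ∀ θ, φ (circleMap a 1 θ) = k := fun θ =>
    hφk _ (circleMap_mem_sphere a zero_le_one θ)
  simp only [circleInt] at hflux
  simp only [greenFlux, circleFlux, circleInt, greenField_circleMap, hk]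
  rw [intervalIntegral.integral_sub
    (((continuous_normalDeriv_circleMap hε hδ hv ha).const_mul k).intervalIntegrable _ _)
    ((continuous_mul_normalDeriv_circleMap hε hδ hv hφ ha).intervalIntegrable _ _),
    intervalIntegral.integral_const_mul, hflux, mul_zero, zero_sub]

theorem circleInt_normalDeriv_sub (hε : 0 < ε) (hδ : 0 < δ)
    (hu : ContDiffOn ℝ 1 u (closure (stripDomain ε δ)))
    (hH : ContDiffOn ℝ 1 H (closure (stripDomain ε δ)))
    (ha : sphere a 1 ⊆ closure (stripDomain ε δ)) :
    circleInt a (normalDeriv ε δ a fun z => u z - H z) =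
      circleInt a (normalDeriv ε δ a u) - circleInt a (normalDeriv ε δ a H) := by
  have hpt : ∀ θ, normalDeriv ε δ a (fun z => u z - H z) (circleMap a 1 θ) =
      normalDeriv ε δ a u (circleMap a 1 θ) - normalDeriv ε δ a H (circleMap a 1 θ) := fun θ => by
    have hmem := ha (circleMap_mem_sphere a zero_le_one θ)
    simp only [normalDeriv, bdryDeriv]
    rw [fderivWithin_fun_sub (uniqueDiffOn_closure_stripDomain hε hδ _ hmem)
      (hu.differentiableOn one_ne_zero _ hmem) (hH.differentiableOn one_ne_zero _ hmem), sub_apply]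
  simp only [circleInt, hpt]
  exact intervalIntegral.integral_sub
    ((continuous_normalDeriv_circleMap hε hδ hu ha).intervalIntegrable _ _)
    ((continuous_normalDeriv_circleMap hε hδ hH ha).intervalIntegrable _ _)

theorem circleInt_normalDeriv_eq_zero (hε : 0 < ε) (hδ : 0 < δ) (hH : HarmonicOnNhd H univ)
    (ha : sphere a 1 ⊆ closure (stripDomain ε δ)) :
    circleInt a (normalDeriv ε δ a H) = 0 := by
  obtain ⟨F, hF, rfl⟩ := hH.exists_analyticOnNhd_univ_re_eq
  have hF' : ∀ z, HasDerivAt F (deriv F z) z := fun z =>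
    (hF z (mem_univ z)).differentiableAt.hasDerivAt
  have hcont : Continuous fun θ => deriv F (a + circleMap 0 1 θ) * circleMap 0 1 θ :=
    ((continuous_iff_continuousAt.2 fun z => (hF z (mem_univ z)).deriv.continuousAt).comp
      (continuous_const.add (continuous_circleMap 0 1))).mul (continuous_circleMap 0 1)
  have hpt : ∀ θ, normalDeriv ε δ a (fun z => (F z).re) (circleMap a 1 θ) =
      -(deriv F (a + circleMap 0 1 θ) * circleMap 0 1 θ).re := fun θ => by
    have hmem := ha (circleMap_mem_sphere a zero_le_one θ)
    rw [closure_stripDomain hε hδ] at hmem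
    have hadd : circleMap a 1 θ = a + circleMap 0 1 θ := by simp [circleMap]
    rw [normalDeriv, bdryDeriv_eq hε hδ (hasFDerivAt_re_of_hasDerivAt (hF' _)) hmem, hadd,
      sub_add_cancel_left, mul_neg, neg_re]
  have hcauchy := integral_deriv_mul_circleMap (f := fun ζ => F (a + ζ))
    (f' := fun ζ => deriv F (a + ζ)) fun ζ _ => (hF' (a + ζ)).comp_const_add a ζ
  have hre := reCLM.intervalIntegral_comp_comm (μ := volume) (hcont.intervalIntegrable 0 (2 * π))
  rw [hcauchy, map_zero] at hre
  simp only [circleInt, hpt]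
  rw [intervalIntegral.integral_neg, neg_eq_zero]
  exact hre

theorem fderiv_eq_of_gradient_eq {z w : ℂ} (h : ∇ v z = ∇ v w) : fderiv ℝ v z = fderiv ℝ v w :=
  (toDual ℝ ℂ).symm.injective h

theorem Admissible.contDiff (hH : Admissible δ H) : ContDiff ℝ 1 H :=
  contDiff_iff_contDiffAt.2 fun z => (hH.harmonic z (mem_univ z)).1.of_le one_le_two

namespace IsSolution

theorem periodicGradient_sub (hε : 0 < ε) (hδ : 0 < δ) (hH : Admissible δ H)
    (hu : IsSolution ε δ H u cL cR) :
    PeriodicGradient (2 + δ) (1 + ε / 2) fun z => u z - H z where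
  harmonic z him hright hleft :=
    (hu.harmonic z (openWideCell_subset_exterior hδ ⟨by linarith, hright, hleft⟩)).sub
      (hH.harmonic z (mem_univ z))
  regular := by
    rw [← closure_stripDomain hε hδ]
    exact hu.regular.sub hH.contDiff.contDiffOn
  periodic z hz := by
    have hmem : ∀ w : ℂ, |w.im| = (2 + δ) / 2 → w ∈ exterior ε δ := fun w hw =>
      openWideCell_subset_exterior hδ ⟨by linarith,
        by linarith [norm_sub_ge_abs_im w (1 + ε / 2)],
        by linarith [norm_add_ge_abs_im w (1 + ε / 2)]⟩
    have him : (z + ((2 + δ : ℝ) : ℂ) * I).im = (2 + δ) / 2 := by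
      rw [add_im, im_ofReal_mul, I_im, hz]
      ring
    have hbottom := hmem z (by rw [hz, abs_neg, abs_of_pos (by linarith)])
    have htop := hmem (z + ((2 + δ : ℝ) : ℂ) * I) (by rw [him, abs_of_pos (by linarith)])
    have hHd := hH.contDiff.differentiable one_ne_zero
    rw [fderiv_fun_sub ((hu.harmonic _ hbottom).1.differentiableAt two_ne_zero) (hHd _),
      fderiv_fun_sub ((hu.harmonic _ htop).1.differentiableAt two_ne_zero) (hHd _),
      fderiv_eq_of_gradient_eq (hu.periodic z hbottom),
      fderiv_eq_of_gradient_eq (hH.periodic z (mem_univ z))]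
  energy := by
    have henergy := hu.energy
    rw [FiniteEnergy, stripDomain_eq] at henergy
    simpa only [energyDensity, norm_gradient_eq] using henergy

theorem greenFlux_eq (hε : 0 < ε) (hδ : 0 < δ) (hH : Admissible δ H)
    (hu : IsSolution ε δ H u cL cR) (hφ : ContDiffOn ℝ 1 φ (closure (stripDomain ε δ)))
    (ha : sphere a 1 ⊆ closure (stripDomain ε δ)) (huk : ∀ z ∈ sphere a 1, u z = k)
    (hφb : ∀ z ∈ sphere a 1, φ z = b) (hflux : circleInt a (normalDeriv ε δ a u) = 0) :
    greenFlux (closure (stripDomain ε δ)) (fun z => u z - H z) φ a =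
      circleInt a (fun z => H z * normalDeriv ε δ a φ z) -
        k * circleInt a (normalDeriv ε δ a φ) := by
  have hHd := hH.contDiff.contDiffOn (s := closure (stripDomain ε δ))
  have hflux_sub : circleInt a (normalDeriv ε δ a fun z => u z - H z) = 0 := by
    rw [circleInt_normalDeriv_sub hε hδ hu.regular hHd ha, hflux,
      circleInt_normalDeriv_eq_zero hε hδ hH.harmonic ha, sub_zero]
  have hk : ∀ θ, u (circleMap a 1 θ) = k := fun θ =>
    huk _ (circleMap_mem_sphere a zero_le_one θ)
  rw [greenFlux_eq_neg_circleInt hε hδ (hu.regular.sub hHd) hφ ha hφb hflux_sub]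
  simp only [circleInt, hk, sub_mul]
  rw [intervalIntegral.integral_sub
    (((continuous_normalDeriv_circleMap hε hδ hφ ha).const_mul k).intervalIntegrable _ _)
    ((continuous_mul_normalDeriv_circleMap hε hδ hHd hφ ha).intervalIntegrable _ _),
    intervalIntegral.integral_const_mul, neg_sub]

theorem sub_eq (hε : 0 < ε) (hδ : 0 < δ) (h : PeriodicPotential (2 + δ) (1 + ε / 2) φ g b)
    (hconj : ∀ z, φ (conj z) = φ z) (hH : Admissible δ H) (hu : IsSolution ε δ H u cL cR) :
    cR - cL = circleInt (centerL ε δ 0) (fun z => H z * normalDeriv ε δ (centerL ε δ 0) φ z) +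
      circleInt (centerR ε δ 0) (fun z => H z * normalDeriv ε δ (centerR ε δ 0) φ z) := by
  have hφ := h.isPotential hε hδ hconj
  have hgreen := (hu.periodicGradient_sub hε hδ hH).greenFlux_add_eq_zero h hconj
    (by linarith) (by linarith)
  rw [← closure_stripDomain hε hδ, ← centerL_zero, ← centerR_zero,
    hu.greenFlux_eq hε hδ hH hφ.regular (sphere_centerR_subset hε hδ) hu.valueR hφ.valueR
      hu.fluxR,
    hu.greenFlux_eq hε hδ hH hφ.regular (sphere_centerL_subset hε hδ) hu.valueL hφ.valueL
      hu.fluxL, hφ.fluxR, neg_eq_iff_eq_neg.1 hφ.fluxL] at hgreen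
  linarith

end IsSolution

end Reciprocity

end TwoRows

end

theorem proposition2p4 (ε δ : ℝ) (hε : 0 < ε) (hδ : 0 < δ) :
    ∃ (c₀ : ℝ) (φ : ℂ → ℝ), TwoRows.IsPotential ε δ φ c₀ ∧
      ∀ H : ℂ → ℝ, TwoRows.Admissible δ H →
        ∀ (u : ℂ → ℝ) (cL cR : ℝ), TwoRows.IsSolution ε δ H u cL cR →
          cR - cL =
            TwoRows.circleInt (TwoRows.centerL ε δ 0)
                (fun z => H z * TwoRows.normalDeriv ε δ (TwoRows.centerL ε δ 0) φ z) +
              TwoRows.circleInt (TwoRows.centerR ε δ 0)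
                (fun z => H z * TwoRows.normalDeriv ε δ (TwoRows.centerR ε δ 0) φ z) := by
  obtain ⟨φ, g, b, h, hconj⟩ := TwoRows.exists_periodicPotential_conj_eq (P := 2 + δ)
    (c := 1 + ε / 2) (by linarith) (by linarith)
  exact ⟨b, φ, h.isPotential hε hδ hconj, fun H hH u cL cR hu => hu.sub_eq hε hδ h hconj hH⟩
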